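/- **Circuit locality implies local simulation.** *Stabilizer games.* Let $d\ge 1$, $\omega=e^{2\pi i/d}$, and for $q\in(\mathbb Z_d^2)^k$ let $\sigma_q=\bigotimes_i X^{q_{i,0}}Z^{q_{i,1}}$. For $q,r\in(\mathbb Z_d^2)^k$ let $\mathrm{cor}_r(q)\in\mathbb Z_d$ be defined by $\omega^{\mathrm{cor}_r(q)}=\sigma_q\sigma_r\sigma_q^{-1}\sigma_r^{-1}$. An $(\ell,k,m)$ stabilizer game $\mathfrak G$ has $\ell$ players; a question $x_j$ to player $j$ is an $m_j$-tuple of labels of $k_j$-qudit Pauli operators from a set $X_j$ (commuting, for queries in the support of the query distribution $\pi$), an answer is $a_j\in\mathbb Z_d^{m_j}$, and the players win on a query $x$ if $w_x\cdot a=b_x$. We assume that $\mathfrak G$ has a perfect honest strategy: a pure state $\psi$ on which measuring the Pauli observables named by the questions (multiplied by phases that make them observables over $\mathbb Z_d$) wins on every query in the support of $\pi$ with certainty. In the rotated stretched game $\mathfrak G^{S,R}_\Gamma$ player $j$ has a larger set of qudits, of which $k_j$ are designated; Paulis are extended by the identity from the designated qudits, player $j$ answers with $a_j$ and a rotation string $r_j$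 (a Pauli label on all its qudits), and the win condition is $w_x\cdot(a-\mathrm{cor}_r(x))=b_x$. *Patterns.* The grid is $\mathbb Z_N\times\mathbb Z_N$. A star consists of a central box, $\ell$ further boxes (all disjoint, boxes being $L_\infty$-balls) and $\ell$ vertex-disjoint paths from the boundary of the central box to the boundaries of the other boxes that avoid all boxes in between. An input pattern is $P=\{(u^{(i)},\Gamma^{(i)})\}_{1\le i\le r}$, $1\le r\le N$, with $\Gamma^{(i)}$ a star and $u^{(i)}_j$ a vertex of its $j$-th noncentral box. Random patterns are sampled as follows: fix $r$ disjoint squares of side $M\le\lfloor N/\sqrt r\rfloor$ with $3L\sqrt{\ell+1}\le M$, $1\le\ell\le L$, in each square $T$ disjoint boxes of radius $L$, $\ell+1\le T\le\lfloor M/(2L+1)\rfloor^2$, and for each choice of $\ell+1$ distinct boxes in a square $\lfloor L/\ell\rfloor$ stars on them, contained in the square, of total path length at most $2\ell M$, the paths of different stars being vertex-disjoint; in each square choose uniformly and independently $\ell+1$ distinct boxes, the locations in the noncentral ones, and a star. For each pattern the paths are extended inside the boxes to vertex-disjoint routes, the $j$-th one from a vertex $g^{(i)}_j$ of the central box to $u^{(i)}_j$.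 *Circuit game $G_{\mathfrak G,N,r}$.* An input is a random pattern together with $r$ independent queries $x^{(1)},\dots,x^{(r)}\sim\pi$, encoded as a string in $\Sigma^{\mathrm{grid}}$, $\Sigma$ a finite alphabet: the vertex $u^{(i)}_j$ carries $x^{(i)}_j$, and the vertices of the routes carry the teleportation instructions. The ideal circuit places $4k$ qudits at each vertex ($k=\max_jk_j$; a group of $k$ facing each neighbour), prepares maximally entangled states between facing groups of neighbours and a copy of $\psi$ (padded) on $g^{(i)}_1,\dots,g^{(i)}_\ell$ for each $i$, performs Bell measurements along the routes, with outcomes labelled by $(a,b)\in\mathbb Z_d^2$ for the Bell state $(Z^b\otimes X^a)\frac1{\sqrt d}\sum_i|ii\rangle$, and performs the honest measurement of $x^{(i)}_j$ at $u^{(i)}_j$; outcomes are output at the vertex where they are obtained. A circuit wins on an input if the symbols it outputs along the routes are in the support of the output distribution of the ideal circuit on that input. *Circuits.* Let $\mathcal C$ be a (classical or quantum) layered circuit of depth $D$ with gates of fan-in at most $K$ and arbitrary fan-out, with inputs and outputs in $\Sigma^{\mathrm{grid}}$; gates may be arbitrary quantum channels. Let $L_f(u)$ be the set of output vertices that can be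 reached from the input vertex $u$ in the circuit graph, and $L_b(v)$ the set of input vertices from which $v$ can be reached. Let $\mathrm{BAD}_{in}$ be any set of vertices, and $\mathrm{Spec}=(L_f,\mathrm{BAD}_{in},\emptyset)$. A pair $(u^{(i)},\Gamma^{(i)})$ is *valid* if no $u^{(i)}_j$ lies in $\mathrm{BAD}_{in}$. A pattern is *Spec-causal* if for each of its pairs $i$: $L_f(u^{(i)}_j)\cap\Gamma^{(i)}$ is contained in the box of $u^{(i)}_j$ for all $j$; $L_f(u^{(i')}_j)\cap\Gamma^{(i)}=\emptyset$ for all other pairs $i'$ of the pattern and all $j$; and the pair is valid. **Lemma.** Let $P$ be a pattern in the support of the input distribution of $G_{\mathfrak G,N,r}$, and let $p$ be the probability that $\mathcal C$ wins in $G_{\mathfrak G,N,r}$ conditioned on the input pattern being $P$. Let $\delta\in[0,1]$. Assume that at least a fraction $1-\delta$ of the $r$ pairs of $P$ are valid and that the subpattern of $P$ that consists of the valid pairs is Spec-causal (so this holds with all pairs valid if $P$ itself is Spec-causal). Let $V\subseteq\{1,\dots,r\}$ be the set of valid pairs. Then there are, for each $i$, a partition of the vertices of $\Gamma^{(i)}$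 into sets $\widetilde\Gamma^{(i)}_1,\dots,\widetilde\Gamma^{(i)}_\ell$, with $\widetilde\Gamma^{(i)}_j$ containing the $j$-th route, such that for $i\in V$ no vertex of $\widetilde\Gamma^{(i)}_j$ has in its backward lightcone an input location of a valid pair other than $u^{(i)}_j$, and an $(r\ell)$-player entangled strategy for the $r$-fold repeated rotated stretched game, in whose $i$-th instance player $j$ has $k$ qudits for each vertex of $\widetilde\Gamma^{(i)}_j$, the first $k_j$ qudits at $u^{(i)}_j$ being designated, such that: 1. with probability at least $p$ (over $x\sim\pi^r$ and the players' measurements) the strategy wins in at least $(1-\delta)r$ of the $r$ instances; 2. there are queries $\bar x^{(i)}$, $1\le i\le r$, in the support of $\pi$ such that for every tuple of queries $x^{(1)},\dots,x^{(r)}$ the joint distribution of the answers of all players of the instances $i\in V$ is exactly that of the decoded output of $\mathcal C$ on the input that encodes $P$ and the queries $x^{(i)}$ for $i\in V$ and $\bar x^{(i)}$ for $i\notin V$. In particular, if $P$ is Spec-causal, the strategy reproduces exactly the decoded output distribution of $\mathcal C$, on every choice of queries. Here the decoded answer of player $j$ of instance $i$ depends on the output symbols in $\widetilde\Gamma^{(i)}_j$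 only: $a_j$ is the answer output at $u^{(i)}_j$, and the rotation string consists of the teleportation outcomes at the vertices other than $u^{(i)}_j$ and, at $u^{(i)}_j$, of the total Pauli correction $(\sum a,-\sum b)$ along the $j$-th route. -/

import Mathlib

open scoped ComplexOrder Matrix

/-! ### Pauli operators and stabilizer games -/

/-- Labels of Pauli operators on a set `κ` of qudits of dimension `d`: one pair in `ℤ_d²` per qudit. -/
abbrev PauliLabel (d : ℕ) (κ : Type) : Type := κ → ZMod d × ZMod d

/-- `ω ^ a` for `a : ℤ_d`, where `ω = exp (2πi / d)`. -/
noncomputable def rootPow (d : ℕ) [NeZero d] (a : ZMod d) : ℂ := ZMod.stdAddChar a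

/-- The Pauli operator `σ_q = ⨂ᵢ X ^ (q i).1 * Z ^ (q i).2` on `(ℂ^d)^{⊗ κ}`; in the computational
basis `X^a Z^b |g⟩ = ω^(b g) |g + a⟩`. -/
noncomputable def pauli {d : ℕ} [NeZero d] {κ : Type} [Fintype κ] (q : PauliLabel d κ) :
    Matrix (κ → ZMod d) (κ → ZMod d) ℂ :=
  Matrix.of fun f g => ∏ i, if f i = g i + (q i).1 then rootPow d ((q i).2 * g i) else 0

/-- The correction value `cor_r(q)`; see `pauli_commutator` for its characterization
`ω ^ cor_r(q) = [σ_q, σ_r]`. -/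
def cor {d : ℕ} {κ : Type} [Fintype κ] (r q : PauliLabel d κ) : ZMod d :=
  ∑ i, ((q i).2 * (r i).1 - (q i).1 * (r i).2)

theorem pauli_apply {d : ℕ} [NeZero d] {κ : Type} [Fintype κ] [DecidableEq κ]
    (q : PauliLabel d κ) (f g : κ → ZMod d) :
    pauli q f g = if f = (fun i => g i + (q i).1) then rootPow d (∑ i, (q i).2 * g i) else 0 := by
  unfold pauli
  rw [Matrix.of_apply]
  by_cases h : f = fun i => g i + (q i).1
  · rw [if_pos h]
    subst h
    simp only [if_true]
    exact (map_prod (ZMod.stdAddChar (N := d)).toMonoidHom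
      (fun i => Multiplicative.ofAdd ((q i).2 * g i)) Finset.univ).symm
  · rw [if_neg h]
    obtain ⟨i, hi⟩ := Function.ne_iff.mp h
    exact Finset.prod_eq_zero (Finset.mem_univ i) (if_neg hi)

theorem pauli_mul_apply {d : ℕ} [NeZero d] {κ : Type} [Fintype κ] [DecidableEq κ]
    (q r : PauliLabel d κ) (f g : κ → ZMod d) :
    (pauli q * pauli r) f g =
      if f = (fun i => g i + (r i).1 + (q i).1) then
        rootPow d (∑ i, ((q i).2 * (g i + (r i).1) + (r i).2 * g i)) else 0 := by
  rw [Matrix.mul_apply, Finset.sum_eq_single (fun i => g i + (r i).1)]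
  · simp only [pauli_apply, if_true]
    split_ifs with h
    · simp [rootPow, Finset.sum_add_distrib, AddChar.map_add_eq_mul]
    · simp
  · intro b _ hb
    rw [pauli_apply r, if_neg hb, mul_zero]
  · simp

/-- `σ_q σ_r = ω ^ cor_r(q) σ_r σ_q`, i.e. `ω ^ cor_r(q)` is the group commutator of `σ_q`, `σ_r`. -/
theorem pauli_commutator {d : ℕ} [NeZero d] {κ : Type} [Fintype κ] [DecidableEq κ]
    (q r : PauliLabel d κ) :
    pauli q * pauli r = rootPow d (cor r q) • (pauli r * pauli q) := by
  ext f g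
  rw [Matrix.smul_apply, pauli_mul_apply, pauli_mul_apply]
  have h : (fun i => g i + (r i).1 + (q i).1) = fun i => g i + (q i).1 + (r i).1 := by
    funext i; ring
  rw [h]
  split_ifs with hf
  · rw [smul_eq_mul, rootPow, rootPow, rootPow, ← AddChar.map_add_eq_mul]
    congr 1
    rw [cor, ← Finset.sum_add_distrib]
    refine Finset.sum_congr rfl fun i _ => ?_
    ring
  · simp

/-- An `(ℓ, k, m)` stabilizer game over `ℤ_d`. The `k_j` qudits of player `j` are indexed by the
type `κ j`. A question to player `j` is an `m_j`-tuple of elements of the set `labels j` (`X_j`).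
The values of `w` and `b` matter only for queries in the support of `dist` (`π`). -/
structure StabilizerGame (ℓ d : ℕ) [NeZero d] (κ : Fin ℓ → Type) [∀ j, Fintype (κ j)]
    [∀ j, DecidableEq (κ j)] (m : Fin ℓ → ℕ) where
  labels : ∀ j, Finset (PauliLabel d (κ j))
  dist : PMF (∀ j, Fin (m j) → labels j)
  commuting : ∀ x ∈ dist.support, ∀ j s t,
    Commute (pauli (x j s : PauliLabel d (κ j))) (pauli (x j t : PauliLabel d (κ j)))
  w : (∀ j, Fin (m j) → labels j) → ∀ j, Fin (m j) → ZMod d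
  b : (∀ j, Fin (m j) → labels j) → ZMod d

namespace StabilizerGame

variable {ℓ d : ℕ} [NeZero d] {κ κ' : Fin ℓ → Type} [∀ j, Fintype (κ j)] [∀ j, DecidableEq (κ j)]
  [∀ j, Fintype (κ' j)] [∀ j, DecidableEq (κ' j)] {m : Fin ℓ → ℕ}

/-- Questions to player `j`. -/
abbrev Question (G : StabilizerGame ℓ d κ m) (j : Fin ℓ) : Type := Fin (m j) → G.labels j

/-- Queries: one question for each player. -/
abbrev Query (G : StabilizerGame ℓ d κ m) : Type := ∀ j, G.Question j

/-- The win condition `w_x · a = b_x`. -/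
def Wins (G : StabilizerGame ℓ d κ m) (x : G.Query) (a : ∀ j, Fin (m j) → ZMod d) : Prop :=
  ∑ j, ∑ s, G.w x j s * a j s = G.b x

end StabilizerGame

/-! ### Nonlocal games, rotated, stretched and repeated games -/

/-- A nonlocal game (with `0/1`-valued win condition) whose players are indexed by `ι`, with
question sets `Q` and answer sets `A`. -/
structure NonlocalGame {ι : Type} (Q A : ι → Type) where
  dist : PMF (∀ i, Q i)
  wins : (∀ i, Q i) → (∀ i, A i) → Prop

/-- A strategy: a finite-dimensional Hilbert space `ℂ^(H i)` for each player, a density matrix on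
their tensor product, and a POVM on the player's space for each player and question. -/
structure Strategy {ι : Type} [Fintype ι] [DecidableEq ι] (Q A : ι → Type)
    [∀ i, Fintype (A i)] where
  H : ι → Type
  [fintypeH : ∀ i, Fintype (H i)]
  [decEqH : ∀ i, DecidableEq (H i)]
  ρ : Matrix (∀ i, H i) (∀ i, H i) ℂ
  ρ_pos : ρ.PosSemidef
  ρ_trace : ρ.trace = 1
  M : ∀ i, Q i → A i → Matrix (H i) (H i) ℂ
  M_pos : ∀ i x a, (M i x a).PosSemidef
  M_sum : ∀ i x, ∑ a, M i x a = 1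

namespace Strategy

attribute [instance] Strategy.fintypeH Strategy.decEqH

variable {ι : Type} [Fintype ι] [DecidableEq ι] {Q A : ι → Type} [∀ i, Fintype (A i)]

/-- Probability `Tr ((⨂ᵢ M_{x_i}^{a_i}) ρ)` that the players answer `a` to the query `x`. -/
noncomputable def prob (S : Strategy Q A) (x : ∀ i, Q i) (a : ∀ i, A i) : ℝ :=
  (Matrix.trace ((Matrix.of fun c c' : ∀ i, S.H i => ∏ i, S.M i (x i) (a i) (c i) (c' i)) *
    S.ρ)).re

end Strategy

/-- The product of finitely many distributions on finite sets (independent samples). -/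
noncomputable def pmfPi {r : ℕ} {X : Fin r → Type} [∀ i, Fintype (X i)] (π : ∀ i, PMF (X i)) :
    PMF (∀ i, X i) :=
  PMF.ofFintype (fun x => ∏ i, π i (x i)) (by
    classical
    have h := Finset.prod_univ_sum (fun i : Fin r => (Finset.univ : Finset (X i)))
      (fun i x => π i x)
    rw [Fintype.piFinset_univ] at h
    rw [← h]
    refine Finset.prod_eq_one fun i _ => ?_
    rw [← tsum_fintype (L := .unconditional _)]
    exact (π i).tsum_coe)

/-- Parallel execution of `r` games by `r` independent groups of `ℓ` players: the query distribution
is the product distribution, and the win condition is the AND of the win conditions. -/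
noncomputable def NonlocalGame.repeated {r ℓ : ℕ} {Q A : Fin r → Fin ℓ → Type}
    [∀ i j, Fintype (Q i j)] (g : ∀ i, NonlocalGame (Q i) (A i)) :
    NonlocalGame (fun p : Fin r × Fin ℓ => Q p.1 p.2) (fun p : Fin r × Fin ℓ => A p.1 p.2) where
  dist := (pmfPi fun i => (g i).dist).map fun x p => x p.1 p.2
  wins x a := ∀ i, (g i).wins (fun j => x (i, j)) (fun j => a (i, j))

open Classical in
/-- Probability that an `rℓ`-player strategy, on a query of the repeated game, wins in at least `c`
of the `r` instances. -/
noncomputable def Strategy.probWinsAtLeast {r ℓ : ℕ} {Q A : Fin r → Fin ℓ → Type}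
    [∀ i j, Fintype (Q i j)] [∀ i j, Fintype (A i j)]
    (S : Strategy (fun p : Fin r × Fin ℓ => Q p.1 p.2) (fun p : Fin r × Fin ℓ => A p.1 p.2))
    (g : ∀ i, NonlocalGame (Q i) (A i)) (c : ℝ) : ℝ :=
  ∑ x, ((NonlocalGame.repeated g).dist x).toReal *
    ∑ a with c ≤ ((Finset.univ.filter fun i : Fin r =>
      (g i).wins (fun j => x (i, j)) (fun j => a (i, j))).card : ℝ), S.prob x a

namespace StabilizerGame

variable {ℓ d : ℕ} [NeZero d] {κ κ' : Fin ℓ → Type} [∀ j, Fintype (κ j)] [∀ j, DecidableEq (κ j)]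
  [∀ j, Fintype (κ' j)] [∀ j, DecidableEq (κ' j)] {m : Fin ℓ → ℕ}

/-- Answers of player `j` in the rotated game: an answer in `ℤ_d^{m_j}` and a rotation string. -/
abbrev RotatedAnswer (d : ℕ) (κ : Fin ℓ → Type) (m : Fin ℓ → ℕ) (j : Fin ℓ) : Type :=
  (Fin (m j) → ZMod d) × PauliLabel d (κ j)

/-- The rotated stabilizer game, with win condition `w_x · (a - cor_r(x)) = b_x`. -/
noncomputable def rotated (G : StabilizerGame ℓ d κ m) :
    NonlocalGame G.Question (RotatedAnswer d κ m) where
  dist := G.dist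
  wins x a := G.Wins x fun j s => (a j).1 s - cor (a j).2 (x j s : PauliLabel d (κ j))

end StabilizerGame

/-- The Pauli label on `κ'` that is `q` on the designated qudits `e '' κ` and the identity
elsewhere. -/
noncomputable def extendLabel {d : ℕ} {κ κ' : Type} (e : κ ↪ κ') :
    PauliLabel d κ ↪ PauliLabel d κ' where
  toFun q := Function.extend e q 0
  inj' q q' h := by
    funext i
    have := congrFun h (e i)
    simpa [e.injective.extend_apply] using this

theorem extendLabel_apply {d : ℕ} {κ κ' : Type} (e : κ ↪ κ') (q : PauliLabel d κ) (i : κ) :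
    extendLabel e q (e i) = q i :=
  e.injective.extend_apply q 0 i

theorem extendLabel_apply_of_not {d : ℕ} {κ κ' : Type} (e : κ ↪ κ') (q : PauliLabel d κ) (i : κ')
    (h : ¬ ∃ a, e a = i) : extendLabel e q i = 0 :=
  Function.extend_apply' (f := e) q (fun _ => 0) i h

theorem extendLabel_comp {d : ℕ} {κ κ' : Type} (e : κ ↪ κ') (q : PauliLabel d κ) :
    (extendLabel e q) ∘ e = q := by
  funext i
  exact extendLabel_apply e q i

theorem cor_extendLabel {d : ℕ} {κ κ' : Type} [Fintype κ] [Fintype κ'] (e : κ ↪ κ')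
    (r q : PauliLabel d κ) : cor (extendLabel e r) (extendLabel e q) = cor r q := by
  classical
  unfold cor
  rw [← Finset.sum_subset (Finset.subset_univ (Finset.univ.map e)), Finset.sum_map]
  · simp only [extendLabel_apply]
  · intro i _ hi
    have : ¬ ∃ a, e a = i := by simpa using hi
    simp [extendLabel_apply_of_not e _ i this]

theorem commute_pauli_iff {d : ℕ} [NeZero d] {κ : Type} [Fintype κ] [DecidableEq κ]
    (q r : PauliLabel d κ) : Commute (pauli q) (pauli r) ↔ cor r q = 0 := by
  constructor
  · intro h
    have h1 := pauli_commutator q r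
    rw [h.eq] at h1
    have h2 := congrFun (congrFun h1 (fun i => 0 + (q i).1 + (r i).1)) 0
    rw [Matrix.smul_apply, pauli_mul_apply] at h2
    simp only [Pi.zero_apply, if_true, smul_eq_mul] at h2
    have h3 : rootPow d (∑ i, ((r i).2 * (0 + (q i).1) + (q i).2 * 0)) ≠ 0 :=
      ((ZMod.stdAddChar (N := d)).val_isUnit _).ne_zero
    have h4 : rootPow d (cor r q) = 1 := by
      by_contra hne
      apply hne
      exact (mul_eq_right₀ h3).mp h2.symm
    apply ZMod.injective_stdAddChar
    rw [AddChar.map_zero_eq_one]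
    exact h4
  · intro h
    have h1 := pauli_commutator q r
    rw [h] at h1
    simpa [rootPow, Commute, SemiconjBy] using h1

namespace StabilizerGame

variable {ℓ d : ℕ} [NeZero d] {κ κ' : Fin ℓ → Type} [∀ j, Fintype (κ j)] [∀ j, DecidableEq (κ j)]
  [∀ j, Fintype (κ' j)] [∀ j, DecidableEq (κ' j)] {m : Fin ℓ → ℕ}

/-- The query of the stretched game that corresponds to a query of the original game. -/
noncomputable def stretchQuery (G : StabilizerGame ℓ d κ m) (e : ∀ j, κ j ↪ κ' j) (x : G.Query) :
    ∀ j, Fin (m j) → ((G.labels j).map (extendLabel (e j)) : Finset (PauliLabel d (κ' j))) :=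
  fun j s => ⟨extendLabel (e j) (x j s), Finset.mem_map_of_mem _ (x j s).2⟩

/-- The query of the original game that corresponds to a query of the stretched game. -/
noncomputable def unstretchQuery (G : StabilizerGame ℓ d κ m) (e : ∀ j, κ j ↪ κ' j)
    (x : ∀ j, Fin (m j) → ((G.labels j).map (extendLabel (e j)) : Finset (PauliLabel d (κ' j)))) :
    G.Query :=
  fun j s => ⟨(x j s : PauliLabel d (κ' j)) ∘ e j, by
    obtain ⟨q, hq, hqx⟩ := Finset.mem_map.mp (x j s).2
    rw [← hqx, extendLabel_comp]
    exact hq⟩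

/-- The stretched game: player `j` has the qudits `κ' j`, among which the qudits `κ j` of the
original game are the designated ones `e j`. Every Pauli observable is extended by the identity,
and the win condition is the same. -/
noncomputable def stretch (G : StabilizerGame ℓ d κ m) (e : ∀ j, κ j ↪ κ' j) :
    StabilizerGame ℓ d κ' m where
  labels j := (G.labels j).map (extendLabel (e j))
  dist := G.dist.map (G.stretchQuery e)
  commuting := by
    intro x hx j s t
    rw [PMF.support_map] at hx
    obtain ⟨y, hy, rfl⟩ := hx
    have h := (commute_pauli_iff _ _).mp (G.commuting y hy j s t)
    rw [commute_pauli_iff]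
    simpa [stretchQuery, cor_extendLabel] using h
  w x := G.w (G.unstretchQuery e x)
  b x := G.b (G.unstretchQuery e x)

end StabilizerGame

/-! ### Perfect honest strategies -/

/-- An honest strategy for a stabilizer game: a pure state `ψ` of `∑ k_j` qudits, on which player
`j` measures the Pauli observables specified by its question. `phase` holds the scalars that turn
`X^a Z^b` into an observable over `ℤ_d` (for example `Y = i X Z` for `d = 2`); it can be `1`
whenever `σ_q ^ d = 1`. -/
structure HonestStrategy {ℓ d : ℕ} [NeZero d] {κ : Fin ℓ → Type} [∀ j, Fintype (κ j)]
    [∀ j, DecidableEq (κ j)] {m : Fin ℓ → ℕ} (G : StabilizerGame ℓ d κ m) where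
  ψ : (∀ j, κ j → ZMod d) → ℂ
  ψ_unit : ∑ c, ‖ψ c‖ ^ 2 = 1
  phase : ∀ j, G.Question j → Fin (m j) → ℂ
  norm_phase : ∀ j x s, ‖phase j x s‖ = 1
  observable : ∀ j x s, (phase j x s • pauli (x s : PauliLabel d (κ j))) ^ d = 1

namespace HonestStrategy

variable {ℓ d : ℕ} [NeZero d] {κ : Fin ℓ → Type} [∀ j, Fintype (κ j)] [∀ j, DecidableEq (κ j)]
  {m : Fin ℓ → ℕ} {G : StabilizerGame ℓ d κ m}

/-- The joint spectral projection of the `m_j` commuting observables `M_{x,1}, …, M_{x,m_j}` of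
player `j` on question `x`, for the outcomes `a`: the product over `s` of the projection
`(1/d) ∑_t ω^(-a_s t) M_{x,s}^t` on the eigenspace of `M_{x,s}` for the eigenvalue `ω^(a_s)`. -/
noncomputable def proj (S : HonestStrategy G) (j : Fin ℓ) (x : G.Question j)
    (a : Fin (m j) → ZMod d) : Matrix (κ j → ZMod d) (κ j → ZMod d) ℂ :=
  (List.ofFn fun s => (1 / (d : ℂ)) • ∑ t ∈ Finset.range d,
    rootPow d (-(a s * (t : ZMod d))) • (S.phase j x s • pauli (x s : PauliLabel d (κ j))) ^ t).prod

/-- Probability of the answers `a` to the query `x` when the players play honestly. -/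
noncomputable def prob (S : HonestStrategy G) (x : G.Query) (a : ∀ j, Fin (m j) → ZMod d) : ℝ :=
  ∑ c : ∀ j, κ j → ZMod d, ‖∑ c', (∏ j, S.proj j (x j) (a j) (c j) (c' j)) * S.ψ c'‖ ^ 2

/-- The honest strategy is perfect: on each query it wins with certainty. -/
def Perfect (S : HonestStrategy G) : Prop :=
  ∀ x ∈ G.dist.support, ∀ a, ¬ G.Wins x a → S.prob x a = 0

end HonestStrategy

/-! ### The grid, boxes, stars and input patterns -/

/-- The vertices of the `N × N` grid, with periodic boundary. -/
abbrev Grid (N : ℕ) : Type := ZMod N × ZMod N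

/-- The four directions on the grid. -/
inductive Dir where
  | right | left | up | down
  deriving DecidableEq

instance : Fintype Dir :=
  ⟨{.right, .left, .up, .down}, by intro e; cases e <;> decide⟩

/-- The opposite direction. -/
def Dir.opp : Dir → Dir
  | .right => .left
  | .left => .right
  | .up => .down
  | .down => .up

/-- The neighbour of a vertex in a direction. -/
def Dir.move {N : ℕ} : Dir → Grid N → Grid N
  | .right, v => (v.1 + 1, v.2)
  | .left, v => (v.1 - 1, v.2)
  | .up, v => (v.1, v.2 + 1)
  | .down, v => (v.1, v.2 - 1)

/-- The box of radius `L` around `u`. -/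
def box {N : ℕ} (L : ℕ) (u : Grid N) : Set (Grid N) :=
  {v | ∃ a b : ℤ, |a| ≤ L ∧ |b| ≤ L ∧ v = (u.1 + (a : ZMod N), u.2 + (b : ZMod N))}

/-- The vertices of a set that have a neighbour outside of it. -/
def gridBoundary {N : ℕ} (S : Set (Grid N)) : Set (Grid N) :=
  {v | v ∈ S ∧ ∃ e : Dir, e.move v ∉ S}

/-- A simple path on the grid with vertices `pt 0, …, pt len`; `dir t` is the direction of the
edge from `pt t` to `pt (t + 1)`. -/
structure GridPath (N : ℕ) where
  len : ℕ
  pt : Fin (len + 1) → Grid N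
  dir : Fin len → Dir
  step : ∀ t : Fin len, pt t.succ = (dir t).move (pt t.castSucc)
  simple : Function.Injective pt

/-- The vertex set of a path. -/
def GridPath.verts {N : ℕ} (p : GridPath N) : Set (Grid N) := Set.range p.pt

/-- A star with `ℓ` rays: a central box, `ℓ` further boxes, all disjoint, and `ℓ` disjoint paths;
the `j`-th path leads from the boundary of the central box to the boundary of the `j`-th box and
avoids all the boxes in between. A box is given by its centre and its radius. -/
structure GridStar (N ℓ : ℕ) where
  center : Grid N × ℕ
  leaf : Fin ℓ → Grid N × ℕ
  path : Fin ℓ → GridPath N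
  center_disjoint : ∀ j, Disjoint (box center.2 center.1) (box (leaf j).2 (leaf j).1)
  leaf_disjoint : ∀ j j', j ≠ j' →
    Disjoint (box (leaf j).2 (leaf j).1) (box (leaf j').2 (leaf j').1)
  path_disjoint : ∀ j j', j ≠ j' → Disjoint (path j).verts (path j').verts
  path_start : ∀ j, (path j).pt 0 ∈ gridBoundary (box center.2 center.1)
  path_end : ∀ j, (path j).pt (Fin.last _) ∈ gridBoundary (box (leaf j).2 (leaf j).1)
  path_inner : ∀ j t, t ≠ 0 → t ≠ Fin.last _ →
    (path j).pt t ∉ box center.2 center.1 ∧ ∀ j', (path j).pt t ∉ box (leaf j').2 (leaf j').1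

namespace GridStar

variable {N ℓ : ℕ}

/-- The central box. -/
def centralBox (Γ : GridStar N ℓ) : Set (Grid N) := box Γ.center.2 Γ.center.1

/-- The `j`-th noncentral box. -/
def leafBox (Γ : GridStar N ℓ) (j : Fin ℓ) : Set (Grid N) := box (Γ.leaf j).2 (Γ.leaf j).1

/-- The vertices in the boxes and paths of a star. -/
def verts (Γ : GridStar N ℓ) : Set (Grid N) :=
  Γ.centralBox ∪ (⋃ j, Γ.leafBox j) ∪ ⋃ j, (Γ.path j).verts

end GridStar

/-- An input pattern: `r` pairs, each of a tuple of `ℓ` input locations and a star, where the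
`j`-th location lies in the `j`-th noncentral box of the star. -/
structure InputPattern (N r ℓ : ℕ) where
  loc : Fin r → Fin ℓ → Grid N
  star : Fin r → GridStar N ℓ
  loc_mem : ∀ i j, loc i j ∈ (star i).leafBox j

/-! ### The distribution on input patterns -/

/-- `⌊N / √r⌋`, the maximal side of the squares. -/
noncomputable def maxSide (N r : ℕ) : ℕ := ⌊(N : ℝ) / √(r : ℝ)⌋₊

/-- The square of side `M` with given corner. -/
def gridSquare {N : ℕ} (M : ℕ) (u : Grid N) : Set (Grid N) :=
  {v | ∃ a b : ℕ, a < M ∧ b < M ∧ v = (u.1 + (a : ZMod N), u.2 + (b : ZMod N))}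

/-- The data from which random input patterns are sampled: `r` disjoint squares of side
`M ≤ ⌊N / √r⌋`, `T ≤ ⌊M / (2L + 1)⌋²` disjoint boxes of side `2L + 1` in each square, and for each
choice of `ℓ + 1` distinct boxes in a square a collection of `⌊L/ℓ⌋` stars in that square. -/
structure PatternSampler (N r ℓ L : ℕ) where
  ell_pos : 1 ≤ ℓ
  ell_le : ℓ ≤ L
  M : ℕ
  M_le : M ≤ maxSide N r
  M_bound : 3 * (L : ℝ) * √((ℓ : ℝ) + 1) ≤ M
  T : ℕ
  T_le : T ≤ (M / (2 * L + 1)) ^ 2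
  T_bound : ℓ + 1 ≤ T
  corner : Fin r → Grid N
  square_disjoint : ∀ i i', i ≠ i' → Disjoint (gridSquare M (corner i)) (gridSquare M (corner i'))
  boxCenter : Fin r → Fin T → Grid N
  box_subset : ∀ i b, box L (boxCenter i b) ⊆ gridSquare M (corner i)
  box_disjoint : ∀ i b b', b ≠ b' → Disjoint (box L (boxCenter i b)) (box L (boxCenter i b'))
  stars : Fin r → (Fin (ℓ + 1) ↪ Fin T) → Fin (L / ℓ) → GridStar N ℓ
  stars_center : ∀ i b s, (stars i b s).center = (boxCenter i (b 0), L)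
  stars_leaf : ∀ i b s j, (stars i b s).leaf j = (boxCenter i (b j.succ), L)
  stars_subset : ∀ i b s, (stars i b s).verts ⊆ gridSquare M (corner i)
  stars_length : ∀ i b s, ∑ j, ((stars i b s).path j).len ≤ 2 * ℓ * M
  stars_disjoint : ∀ i b s s', s ≠ s' → ∀ j j',
    Disjoint ((stars i b s).path j).verts ((stars i b s').path j').verts

namespace PatternSampler

variable {N r ℓ L : ℕ}

/-- The random choices made for one square: `ℓ + 1` distinct boxes, the position of one location
within each noncentral box, and a star from the collection. -/
abbrev Choice (T ℓ L : ℕ) : Type :=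
  (Fin (ℓ + 1) ↪ Fin T) × (Fin ℓ → Fin (2 * L + 1) × Fin (2 * L + 1)) × Fin (L / ℓ)

/-- The input pattern resulting from the random choices. -/
def toPattern (D : PatternSampler N r ℓ L) (ω : Fin r → Choice D.T ℓ L) : InputPattern N r ℓ where
  loc i j :=
    ((D.boxCenter i ((ω i).1 j.succ)).1 + (((((ω i).2.1 j).1 : ℕ) : ℤ) - (L : ℤ) : ℤ),
     (D.boxCenter i ((ω i).1 j.succ)).2 + (((((ω i).2.1 j).2 : ℕ) : ℤ) - (L : ℤ) : ℤ))
  star i := D.stars i (ω i).1 (ω i).2.2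
  loc_mem i j := by
    unfold GridStar.leafBox
    rw [D.stars_leaf]
    refine ⟨(((ω i).2.1 j).1 : ℕ) - (L : ℤ), (((ω i).2.1 j).2 : ℕ) - (L : ℤ), ?_, ?_, rfl⟩
    · have := ((ω i).2.1 j).1.2
      rw [abs_le]; omega
    · have := ((ω i).2.1 j).2.2
      rw [abs_le]; omega

theorem nonempty_choices (D : PatternSampler N r ℓ L) : Nonempty (Fin r → Choice D.T ℓ L) := by
  have h : 0 < L / ℓ := Nat.div_pos D.ell_le D.ell_pos
  exact ⟨fun _ => (Fin.castLEEmb D.T_bound, fun _ => (0, 0), ⟨0, h⟩)⟩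

/-- The distribution on input patterns: all choices are uniform and independent. -/
noncomputable def dist (D : PatternSampler N r ℓ L) : PMF (InputPattern N r ℓ) :=
  haveI := D.nonempty_choices
  (PMF.uniformOfFintype (Fin r → Choice D.T ℓ L)).map D.toPattern

end PatternSampler

/-! ### Circuit specifications and causality -/

/-- A circuit specification. -/
structure CircuitSpec (N : ℕ) where
  lightcone : Grid N → Set (Grid N)
  badIn : Set (Grid N)
  badOut : Set (Grid N)

namespace CircuitSpec

variable {N r ℓ : ℕ}

/-- The pair `i` of the pattern is individually causal with respect to the subpattern that
consists of the pairs with index in `V`. -/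
def IndividuallyCausal (spec : CircuitSpec N) (P : InputPattern N r ℓ) (V : Set (Fin r))
    (i : Fin r) : Prop :=
  (∀ j, spec.lightcone (P.loc i j) ∩ (P.star i).verts ⊆ (P.star i).leafBox j) ∧
  (∀ i' ∈ V, i' ≠ i → ∀ j, spec.lightcone (P.loc i' j) ∩ (P.star i).verts = ∅) ∧
  (P.star i).verts ∩ spec.badOut = ∅

/-- The pair `i` of the pattern is valid: its input locations are not bad. -/
def Valid (spec : CircuitSpec N) (P : InputPattern N r ℓ) (i : Fin r) : Prop :=
  ∀ j, P.loc i j ∉ spec.badIn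

/-- The subpattern of the pairs with index in `V` is causal: each of its pairs is individually
causal with respect to the subpattern, and valid. For `V = univ` this says that the pattern is
causal. -/
def Causal (spec : CircuitSpec N) (P : InputPattern N r ℓ) (V : Set (Fin r)) : Prop :=
  ∀ i ∈ V, spec.IndividuallyCausal P V i ∧ spec.Valid P i

end CircuitSpec

/-! ### Circuits -/

/-- A layered circuit on wires that carry a symbol (qudit) from the finite alphabet `A`, with inputs
and outputs indexed by the grid. Between layer `t` and layer `t + 1`, for `t < depth`, each wire of
layer `t` enters exactly one gate (`reads`) and each wire of layer `t + 1` leaves exactly one gate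
(`writes`). A gate is a quantum channel in Kraus form, with any number of output wires. Hence
unitary gates, measurements, ancillas and discarding are allowed, and so are classical
(deterministic or randomized) gates with arbitrary fan-out, whose Kraus operators are
`√p(y|x) |y … y⟩⟨x|`. A wire of layer `0` carries the basis state of an input symbol (any
number of wires may carry the same one) or a fixed ancilla symbol. All wires of the last layer are
measured in the computational basis, and `target v` is the wire with the output at `v`. The data
for `t ≥ depth` are not used. -/
structure Circuit (N : ℕ) (A : Type) [Fintype A] [DecidableEq A] where
  depth : ℕ
  width : ℕ → ℕ
  gates : ℕ → ℕ
  reads : ∀ t, Fin (width t) → Fin (gates t)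
  writes : ∀ t, Fin (width (t + 1)) → Fin (gates t)
  rank : ∀ t, Fin (gates t) → ℕ
  kraus : ∀ t (g : Fin (gates t)), Fin (rank t g) →
    Matrix ({w // writes t w = g} → A) ({w // reads t w = g} → A) ℂ
  kraus_complete : ∀ t g, ∑ e, (kraus t g e)ᴴ * kraus t g e = 1
  source : Fin (width 0) → Grid N ⊕ A
  target : Grid N → Fin (width depth)

namespace Circuit

variable {N : ℕ} {A : Type} [Fintype A] [DecidableEq A]

/-- Every gate has at most `K` input wires. -/
def FanInLE (C : Circuit N A) (K : ℕ) : Prop :=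
  ∀ t < C.depth, ∀ g : Fin (C.gates t), Fintype.card {w // C.reads t w = g} ≤ K

/-- A Kraus operator of the whole layer `t`: the tensor product of a Kraus operator per gate. -/
noncomputable def layerKraus (C : Circuit N A) (t : ℕ) (e : ∀ g, Fin (C.rank t g)) :
    Matrix (Fin (C.width (t + 1)) → A) (Fin (C.width t) → A) ℂ :=
  Matrix.of fun y x => ∏ g, C.kraus t g (e g) (fun w => y w) (fun w => x w)

/-- The state of the wires of layer `t` on a given input. -/
noncomputable def state (C : Circuit N A) (input : Grid N → A) :
    ∀ t, Matrix (Fin (C.width t) → A) (Fin (C.width t) → A) ℂ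
  | 0 =>
    let c : Fin (C.width 0) → A := fun w => Sum.elim input id (C.source w)
    Matrix.single c c 1
  | t + 1 => ∑ e, C.layerKraus t e * C.state input t * (C.layerKraus t e)ᴴ

open Classical in
/-- Probability that the circuit outputs `y` on the given input. -/
noncomputable def outProb (C : Circuit N A) (input y : Grid N → A) : ℝ :=
  ∑ c : Fin (C.width C.depth) → A with ∀ v, c (C.target v) = y v,
    (C.state input C.depth c c).re

/-- Vertices of the circuit graph: input vertices, gates and output vertices. -/
inductive Vertex (C : Circuit N A) where
  | input (u : Grid N)
  | gate (t : ℕ) (g : Fin (C.gates t))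
  | output (v : Grid N)

/-- Edges of the circuit graph: there is an edge for each wire. -/
inductive Edge (C : Circuit N A) : C.Vertex → C.Vertex → Prop where
  | inputGate (u : Grid N) (w : Fin (C.width 0)) :
      0 < C.depth → C.source w = Sum.inl u → Edge C (.input u) (.gate 0 (C.reads 0 w))
  | gateGate (t : ℕ) (w : Fin (C.width (t + 1))) :
      t + 1 < C.depth → Edge C (.gate t (C.writes t w)) (.gate (t + 1) (C.reads (t + 1) w))
  | gateOutput (t : ℕ) (w : Fin (C.width (t + 1))) (v : Grid N) :
      t + 1 = C.depth → (C.target v : ℕ) = w → Edge C (.gate t (C.writes t w)) (.output v)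
  | inputOutput (u : Grid N) (w : Fin (C.width 0)) (v : Grid N) :
      C.depth = 0 → (C.target v : ℕ) = w → C.source w = Sum.inl u → Edge C (.input u) (.output v)

/-- The input vertices from which there is a path to `v` in the circuit graph. -/
def backwardLightcone (C : Circuit N A) (v : C.Vertex) : Set (Grid N) :=
  {u | Relation.ReflTransGen C.Edge (.input u) v}

/-- The output vertices to which there is a path from the input vertex `u`. -/
def forwardLightcone (C : Circuit N A) (u : Grid N) : Set (Grid N) :=
  {v | u ∈ C.backwardLightcone (.output v)}

end Circuit

/-! ### The circuit game -/

/-- The maximal number `k = max_j k_j` of qudits of a player. -/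
def maxQudits {ℓ : ℕ} (k : Fin ℓ → ℕ) : ℕ := Finset.univ.sup k

theorem le_maxQudits {ℓ : ℕ} (k : Fin ℓ → ℕ) (j : Fin ℓ) : k j ≤ maxQudits k :=
  Finset.le_sup (Finset.mem_univ j)

/-- The extension of the paths of the stars of a pattern inside the boxes. The `j`-th route of the
`i`-th star leads from a vertex `g` of the central box to the `j`-th input location and
consists of vertices of the central box, the `j`-th path of the star, and vertices of the `j`-th
box. The group of qudits of the vertex `g` that faces the direction `share i j`, which is not the
direction of the route, holds the share of player `j` of the state `ψ`. -/
structure Wiring {N r ℓ : ℕ} (P : InputPattern N r ℓ) where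
  route : Fin r → Fin ℓ → GridPath N
  share : Fin r → Fin ℓ → Dir
  route_end : ∀ i j, (route i j).pt (Fin.last _) = P.loc i j
  route_extends : ∀ i j, ∃ B E : List (Grid N),
    List.ofFn (route i j).pt = B ++ List.ofFn ((P.star i).path j).pt ++ E ∧
    (∀ v ∈ B, v ∈ (P.star i).centralBox) ∧ ∀ v ∈ E, v ∈ (P.star i).leafBox j
  route_disjoint : ∀ i j j', j ≠ j' → Disjoint (route i j).verts (route i j').verts
  share_ne : ∀ i j (t : Fin (route i j).len), (t : ℕ) = 0 → share i j ≠ (route i j).dir t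

/-- The direction of the group of qudits at the `t`-th vertex of a route that faces the previous
vertex of the route; at the first vertex, the direction of the group that holds a share of `ψ`. -/
def Wiring.inDir {N r ℓ : ℕ} {P : InputPattern N r ℓ} (W : Wiring P) (i : Fin r) (j : Fin ℓ) :
    Fin ((W.route i j).len + 1) → Dir :=
  Fin.cases (W.share i j) fun t => ((W.route i j).dir t).opp

/-- The natural input symbols at a grid vertex: no operation; first vertex of the `j`-th route of a
star, with the directions of the share of `ψ` and of the next vertex; inner vertex of a route, with
the directions of the previous and of the next vertex (a teleportation measurement is performed
between the groups of qudits facing these directions); input location of player `j`, with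
the player's question and the direction of the group of qudits to be measured. -/
inductive InputSymbol {ℓ : ℕ} (Q : Fin ℓ → Type) where
  | idle
  | start (j : Fin ℓ) (share next : Dir)
  | inner (prev next : Dir)
  | question (j : Fin ℓ) (q : Q j) (prev : Dir)

/-- The data that determine the circuit game: a stabilizer game with a perfect honest
strategy, the distribution on input patterns, an extension of the paths of each pattern inside the
boxes, and embeddings of the natural input and output symbols (questions and teleportation
instructions; answers and teleportation outcomes) in the alphabet `A`. -/
structure CircuitGame (ℓ d : ℕ) [NeZero d] (k m : Fin ℓ → ℕ) (N r L : ℕ) (A : Type) where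
  game : StabilizerGame ℓ d (fun j => Fin (k j)) m
  honest : HonestStrategy game
  perfect : honest.Perfect
  sampler : PatternSampler N r ℓ L
  wiring : ∀ P : InputPattern N r ℓ, Wiring P
  encIn : InputSymbol game.Question ↪ A
  encAns : ∀ j, (Fin (m j) → ZMod d) ↪ A
  encTel : (Fin (maxQudits k) → ZMod d × ZMod d) ↪ A

namespace CircuitGame

variable {ℓ d : ℕ} [NeZero d] {k m : Fin ℓ → ℕ} {N r L : ℕ} {A : Type}

/-- `r`-tuples of queries. -/
abbrev Queries (𝒢 : CircuitGame ℓ d k m N r L A) : Type := Fin r → 𝒢.game.Query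

open Classical in
/-- The natural input symbol at a vertex of the grid. -/
noncomputable def inputSymbol (𝒢 : CircuitGame ℓ d k m N r L A) (P : InputPattern N r ℓ)
    (x : 𝒢.Queries) (v : Grid N) : InputSymbol 𝒢.game.Question :=
  let W := 𝒢.wiring P
  if h : ∃ s : Σ i : Fin r, Σ j : Fin ℓ, Fin ((W.route i j).len + 1),
      (W.route s.1 s.2.1).pt s.2.2 = v then
    let s := h.choose
    if ht : (s.2.2 : ℕ) < (W.route s.1 s.2.1).len then
      if (s.2.2 : ℕ) = 0 then
        .start s.2.1 (W.share s.1 s.2.1) ((W.route s.1 s.2.1).dir ⟨s.2.2, ht⟩)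
      else .inner (W.inDir s.1 s.2.1 s.2.2) ((W.route s.1 s.2.1).dir ⟨s.2.2, ht⟩)
    else .question s.2.1 (x s.1 s.2.1) (W.inDir s.1 s.2.1 s.2.2)
  else .idle

/-- The input string to the circuit that encodes a pattern and an `r`-tuple of queries. -/
noncomputable def encode (𝒢 : CircuitGame ℓ d k m N r L A) (P : InputPattern N r ℓ)
    (x : 𝒢.Queries) : Grid N → A :=
  fun v => 𝒢.encIn (𝒢.inputSymbol P x v)

/-- The qudits on the grid: a group of `k` qudits for each vertex and direction. -/
abbrev Qudit (N : ℕ) {ℓ : ℕ} (k : Fin ℓ → ℕ) : Type := Grid N × Dir × Fin (maxQudits k)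

/-- A group of qudits that holds a share of a copy of `ψ`. -/
def IsShare {P : InputPattern N r ℓ} (W : Wiring P) (v : Grid N) (e : Dir) : Prop :=
  ∃ i j, v = (W.route i j).pt 0 ∧ e = W.share i j

open Classical in
/-- The contribution to the amplitude of the group at `v` that faces `e` and the group opposite to
it: maximally entangled states, unless one of the groups holds a share of `ψ`; in this case the
other one, if it does not hold a share itself, is in the state `|0⟩`. -/
noncomputable def linkAmp [NeZero N] {P : InputPattern N r ℓ} (W : Wiring P)
    (c : Qudit N k → ZMod d) (v : Grid N) (e : Dir) : ℂ :=
  if IsShare W v e then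
    if IsShare W (e.move v) e.opp then 1
    else ∏ s, if c (e.move v, e.opp, s) = 0 then 1 else 0
  else
    if IsShare W (e.move v) e.opp then ∏ s, if c (v, e, s) = 0 then 1 else 0
    else ∏ s, if c (v, e, s) = c (e.move v, e.opp, s) then 1 / (√(d : ℝ) : ℂ) else 0

/-- The amplitude of `ψ`, padded with `|0⟩` to `k` qudits for each player. -/
noncomputable def paddedψ (𝒢 : CircuitGame ℓ d k m N r L A)
    (c : Fin ℓ → Fin (maxQudits k) → ZMod d) : ℂ :=
  𝒢.honest.ψ (fun j s => c j (Fin.castLE (le_maxQudits k j) s)) *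
    ∏ j, ∏ s : Fin (maxQudits k), if (s : ℕ) < k j ∨ c j s = 0 then 1 else 0

/-- The state prepared in the first stage of the ideal circuit. -/
noncomputable def idealState [NeZero N] (𝒢 : CircuitGame ℓ d k m N r L A)
    (P : InputPattern N r ℓ) (c : Qudit N k → ZMod d) : ℂ :=
  (∏ v, linkAmp (𝒢.wiring P) c v .right * linkAmp (𝒢.wiring P) c v .up) *
    ∏ i, 𝒢.paddedψ fun j s => c (((𝒢.wiring P).route i j).pt 0, (𝒢.wiring P).share i j, s)

/-- The amplitudes of the state `(Z^b ⊗ X^a) (1/√d) ∑ᵢ |i i⟩` of a Bell basis. -/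
noncomputable def bellAmp (o : ZMod d × ZMod d) (cin cout : ZMod d) : ℂ :=
  if cout = cin + o.1 then rootPow d (o.2 * cin) / (√(d : ℝ) : ℂ) else 0

/-- Outcomes of the ideal circuit: for each route, the outcomes of the teleportation measurements at
all its vertices but the last one, and an answer in the stabilizer game. -/
abbrev IdealOutcome (𝒢 : CircuitGame ℓ d k m N r L A) (P : InputPattern N r ℓ) : Type :=
  ∀ i j, (Fin ((𝒢.wiring P).route i j).len → Fin (maxQudits k) → ZMod d × ZMod d) ×
    (Fin (m j) → ZMod d)

/-- The qudits that are measured by the ideal circuit. -/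
def Measured (𝒢 : CircuitGame ℓ d k m N r L A) (P : InputPattern N r ℓ) (q : Qudit N k) : Prop :=
  let W := 𝒢.wiring P
  ∃ i j,
    (∃ (t : Fin (W.route i j).len) (s : Fin (maxQudits k)),
      q = ((W.route i j).pt t.castSucc, W.inDir i j t.castSucc, s) ∨
      q = ((W.route i j).pt t.castSucc, (W.route i j).dir t, s)) ∨
    ∃ s : Fin (k j), q = (P.loc i j, W.inDir i j (Fin.last _), Fin.castLE (le_maxQudits k j) s)

open Classical in
/-- The projection for the outcome `o` of the measurements in the ideal circuit: at each vertex of a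
route but the last one, a Bell measurement between the group of qudits facing the previous vertex
(at the first vertex, the share of `ψ`) and the group facing the next one; at each input location,
the honest measurement of the player's question on the qudits that arrive there; the identity on
all other qudits. -/
noncomputable def idealProj (𝒢 : CircuitGame ℓ d k m N r L A) (P : InputPattern N r ℓ)
    (x : 𝒢.Queries) (o : 𝒢.IdealOutcome P) (c c' : Qudit N k → ZMod d) : ℂ :=
  let W := 𝒢.wiring P
  (∏ i, ∏ j,
    (∏ t : Fin (W.route i j).len, ∏ s : Fin (maxQudits k),
      bellAmp ((o i j).1 t s)
          (c ((W.route i j).pt t.castSucc, W.inDir i j t.castSucc, s))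
          (c ((W.route i j).pt t.castSucc, (W.route i j).dir t, s)) *
        (starRingEnd ℂ) (bellAmp ((o i j).1 t s)
          (c' ((W.route i j).pt t.castSucc, W.inDir i j t.castSucc, s))
          (c' ((W.route i j).pt t.castSucc, (W.route i j).dir t, s)))) *
    𝒢.honest.proj j (x i j) (o i j).2
      (fun s => c (P.loc i j, W.inDir i j (Fin.last _), Fin.castLE (le_maxQudits k j) s))
      (fun s => c' (P.loc i j, W.inDir i j (Fin.last _), Fin.castLE (le_maxQudits k j) s))) *
  if ∀ q, 𝒢.Measured P q ∨ c q = c' q then 1 else 0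

/-- Probability of the outcome `o` of the ideal circuit. -/
noncomputable def idealProb [NeZero N] (𝒢 : CircuitGame ℓ d k m N r L A) (P : InputPattern N r ℓ)
    (x : 𝒢.Queries) (o : 𝒢.IdealOutcome P) : ℝ :=
  ∑ c, ‖∑ c', 𝒢.idealProj P x o c c' * 𝒢.idealState P c'‖ ^ 2

/-- The distribution of the input to the circuit game: independently, an input pattern and an
`r`-tuple of independent queries. -/
noncomputable def dist (𝒢 : CircuitGame ℓ d k m N r L A) : PMF (InputPattern N r ℓ × 𝒢.Queries) :=
  𝒢.sampler.dist.bind fun P => (pmfPi fun _ : Fin r => 𝒢.game.dist).map fun x => (P, x)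

/-- The relation of the circuit game: on an input in the support of the input distribution, the
output symbols along the routes are in the support of the output distribution of the ideal
circuit (other output symbols are irrelevant). -/
def relation [NeZero N] (𝒢 : CircuitGame ℓ d k m N r L A) :
    Set ((InputPattern N r ℓ × 𝒢.Queries) × (Grid N → A)) :=
  {z | z.1 ∈ 𝒢.dist.support ∧ ∃ o : 𝒢.IdealOutcome z.1.1, 𝒢.idealProb z.1.1 z.1.2 o ≠ 0 ∧
    ∀ i j, (∀ t, z.2 (((𝒢.wiring z.1.1).route i j).pt t.castSucc) = 𝒢.encTel ((o i j).1 t)) ∧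
      z.2 (z.1.1.loc i j) = 𝒢.encAns j (o i j).2}

open Classical in
/-- Probability that the circuit wins on a given input. -/
noncomputable def winProbOn [NeZero N] [Fintype A] [DecidableEq A]
    (𝒢 : CircuitGame ℓ d k m N r L A) (C : Circuit N A) (z : InputPattern N r ℓ × 𝒢.Queries) : ℝ :=
  ∑ y : Grid N → A with (z, y) ∈ 𝒢.relation, C.outProb (𝒢.encode z.1 z.2) y

/-- Probability that the circuit wins, conditioned on the input pattern being `P`. -/
noncomputable def condWinProb [NeZero N] [Fintype A] [DecidableEq A]
    (𝒢 : CircuitGame ℓ d k m N r L A) (C : Circuit N A) (P : InputPattern N r ℓ) : ℝ :=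
  (∑ x, (𝒢.dist (P, x)).toReal * 𝒢.winProbOn C (P, x)) / ∑ x, (𝒢.dist (P, x)).toReal

/-! ### The stretched game obtained from a pattern, and decoding -/

/-- A partition of the vertices of each star of the pattern into sets `region i j`, one for each
player, that contain the routes of the players. -/
structure Regions {P : InputPattern N r ℓ} (W : Wiring P) where
  region : Fin r → Fin ℓ → Finset (Grid N)
  disjoint : ∀ i j j', j ≠ j' → Disjoint (region i j) (region i j')
  cover : ∀ i v, v ∈ (P.star i).verts ↔ ∃ j, v ∈ region i j
  route_mem : ∀ i j t, (W.route i j).pt t ∈ region i j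

namespace Regions

variable {P : InputPattern N r ℓ} {W : Wiring P}

/-- The qudits of player `j` in the stretched game for the `i`-th star: `k` for each vertex. -/
abbrev StretchedQudit (Γ : Regions W) (k : Fin ℓ → ℕ) (i : Fin r) (j : Fin ℓ) : Type :=
  {v // v ∈ Γ.region i j} × Fin (maxQudits k)

theorem loc_mem (Γ : Regions W) (i : Fin r) (j : Fin ℓ) : P.loc i j ∈ Γ.region i j :=
  W.route_end i j ▸ Γ.route_mem i j (Fin.last _)

/-- The designated qudits of player `j`: the first `k_j` qudits at the input location. -/
def designated (Γ : Regions W) (k : Fin ℓ → ℕ) (i : Fin r) (j : Fin ℓ) :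
    Fin (k j) ↪ Γ.StretchedQudit k i j where
  toFun s := (⟨P.loc i j, Γ.loc_mem i j⟩, Fin.castLE (le_maxQudits k j) s)
  inj' s s' h := by simpa using h

end Regions

variable (𝒢 : CircuitGame ℓ d k m N r L A) {P : InputPattern N r ℓ}

/-- The stretched game for the `i`-th star. -/
noncomputable def stretchedGame (Γ : Regions (𝒢.wiring P)) (i : Fin r) :
    StabilizerGame ℓ d (Γ.StretchedQudit k i) m :=
  𝒢.game.stretch fun j => Γ.designated k i j

/-- The rotated stretched game for the `i`-th star. -/
noncomputable def instanceGame (Γ : Regions (𝒢.wiring P)) (i : Fin r) :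
    NonlocalGame (𝒢.stretchedGame Γ i).Question
      (StabilizerGame.RotatedAnswer d (Γ.StretchedQudit k i) m) :=
  (𝒢.stretchedGame Γ i).rotated

/-- Question sets of the repeated rotated stretched game. -/
abbrev PlayerQuestion (Γ : Regions (𝒢.wiring P)) (p : Fin r × Fin ℓ) : Type :=
  (𝒢.stretchedGame Γ p.1).Question p.2

/-- Answer sets of the repeated rotated stretched game. -/
abbrev PlayerAnswer (Γ : Regions (𝒢.wiring P)) (p : Fin r × Fin ℓ) : Type :=
  StabilizerGame.RotatedAnswer d (Γ.StretchedQudit k p.1) m p.2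

/-- The questions in the repeated rotated stretched game that correspond to an `r`-tuple of
queries. -/
noncomputable def playerQuestions (Γ : Regions (𝒢.wiring P)) (x : 𝒢.Queries) :
    ∀ p, 𝒢.PlayerQuestion Γ p :=
  fun p => 𝒢.game.stretchQuery (fun j => Γ.designated k p.1 j) (x p.1) p.2

/-- Decoding of a symbol as a teleportation outcome. -/
noncomputable def decTel (σ : A) : Fin (maxQudits k) → ZMod d × ZMod d :=
  Function.invFun 𝒢.encTel σ

open Classical in
/-- Decoding of an output of the circuit as answers in the repeated rotated stretched game. The
answer of player `(i, j)` is computed from the output symbols in `region i j` alone. The rotation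
string consists of the teleportation outcomes at all the vertices other than the input location; at
the input location it is the total Pauli correction `X^(∑ a) Z^(-∑ b)` along the route. -/
noncomputable def decode (Γ : Regions (𝒢.wiring P)) (y : Grid N → A) : ∀ p, 𝒢.PlayerAnswer Γ p :=
  fun p =>
    (Function.invFun (𝒢.encAns p.2) (y (P.loc p.1 p.2)),
     fun q =>
      if (q.1 : Grid N) = P.loc p.1 p.2 then
        (∑ t : Fin ((𝒢.wiring P).route p.1 p.2).len,
            (𝒢.decTel (y (((𝒢.wiring P).route p.1 p.2).pt t.castSucc)) q.2).1,
         -∑ t : Fin ((𝒢.wiring P).route p.1 p.2).len,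
            (𝒢.decTel (y (((𝒢.wiring P).route p.1 p.2).pt t.castSucc)) q.2).2)
      else 𝒢.decTel (y q.1) q.2)

end CircuitGame

/-! Simulation. Call the reach of a wire the set of players whose question it may depend on. Wires
of empty reach can be prepared in advance and form the shared entangled state; wires of reach `{i}`
can be produced by player `i` from its own question and its share of that state; wires reached by
two or more players are discarded. This description survives each layer of the circuit. A gate is
reached by everything that reaches one of its inputs, and its outputs inherit that reach. If it is
reached by two players, its inputs are discarded and, because channels preserve the trace, omitting
it does not change the reduced state of the other wires. If it is reached by `i` alone, it reads
only wires of `i` and shared wires, and the latter are handed to `i`. Hence every layer has a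
`LocalPreparation`, by `discard`, `handOver` and `applyGates`. At the end all wires are measured in
the computational basis, so the shared wires can be measured beforehand and their values copied to
all players; this gives `Circuit.exists_strategy`.

Causality. The `j`-th part of a star consists of the `j`-th noncentral box and route, with the
leftover vertices given to one fixed player. A causal light cone meets the valid stars only in the
box of its own input location, and this box lies in one part. So every output in a part has reach at
most one player, the owner.

Winning. Let an ideal outcome have nonzero probability. Translate the computational basis by `h j`
simultaneously in all groups along the `j`-th route of one star. Links do not notice this, Bell
amplitudes acquire phases, and `ψ` and the honest projections are translated. The sum over `h` is
then, up to a factor, an amplitude of the honest measurement on `ψ` rotated by the total Pauli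
correction. Conjugation by a Pauli operator shifts the answers by `cor`, so perfection of the honest
strategy makes the amplitude vanish unless the corrected answers win (`wins_of_idealProb_ne_zero`).
No teleported state has to be computed.

Invalid pairs. Their queries are fixed to values in the support of `π` that do not lower the average
winning probability (`exists_replaceOutside_ge`), and their players give a constant answer. Whenever
the circuit wins, all valid instances are won, and these are at least `(1 - δ) r` many. -/

/-! ### Kraus families and tensor products over the fibers of a map -/

/-- Dependent functions on `W` are families of functions on the fibers of `f : W → G`. -/
def fiberEquiv {W G : Type} (f : W → G) (B : W → Type) :
    (∀ w, B w) ≃ ∀ g, ∀ w : {w // f w = g}, B w where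
  toFun c _ w := c w
  invFun b w := b (f w) ⟨w, rfl⟩
  left_inv _ := rfl
  right_inv b := by
    funext g w
    obtain ⟨w, rfl⟩ := w
    rfl

theorem sum_pi_prod {P : Type} [Fintype P] [DecidableEq P] {B C : P → Type} [∀ p, Fintype (B p)]
    [∀ p, Fintype (C p)] (φ : (∀ p, B p × C p) → ℂ) :
    ∑ hs, φ hs = ∑ h : ∀ p, B p, ∑ s : ∀ p, C p, φ fun p => (h p, s p) := by
  rw [← Fintype.sum_prod_type' (f := fun (h : ∀ p, B p) (s : ∀ p, C p) => φ fun p => (h p, s p))]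
  exact Fintype.sum_equiv (Equiv.arrowProdEquivProdArrow P B C) _ _ fun hs => rfl

/-- The functions `κ e : B × C → ℂ` are the entries of the Kraus operators of a channel from `ℂ^C`
to `ℂ^B`. -/
def IsKraus {R B C : Type} [Fintype R] [Fintype B] [DecidableEq C] (κ : R → B → C → ℂ) : Prop :=
  ∀ a b, ∑ e, ∑ c, star (κ e c a) * κ e c b = if a = b then 1 else 0

theorem isKraus_of_matrix {R B C : Type} [Fintype R] [Fintype B] [Fintype C] [DecidableEq C]
    (κ : R → Matrix B C ℂ) (hκ : ∑ e, (κ e)ᴴ * κ e = 1) : IsKraus fun e b c => κ e b c := by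
  intro a b
  have h := congrFun (congrFun hκ a) b
  rw [Matrix.sum_apply] at h
  simpa only [Matrix.mul_apply, Matrix.conjTranspose_apply, Matrix.one_apply] using h

namespace IsKraus

/-- The completeness sum factors over `g`, so it is a product of Kronecker deltas. -/
theorem tensor {G : Type} [Fintype G] [DecidableEq G] {Bo Bi R : G → Type}
    [∀ g, Fintype (Bo g)] [∀ g, DecidableEq (Bi g)] [DecidableEq (∀ g, Bi g)]
    [∀ g, Fintype (R g)]
    {κ : ∀ g, R g → Bo g → Bi g → ℂ} (hκ : ∀ g, IsKraus (κ g)) :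
    IsKraus fun (e : ∀ g, R g) (c : ∀ g, Bo g) (d : ∀ g, Bi g) =>
      ∏ g, κ g (e g) (c g) (d g) := by
  intro d d'
  simp only [star_prod, ← Finset.prod_mul_distrib]
  have h2 : ∀ e : ∀ g, R g,
      ∑ c : ∀ g, Bo g, ∏ g, star (κ g (e g) (c g) (d g)) * κ g (e g) (c g) (d' g) =
        ∏ g, ∑ b, star (κ g (e g) b (d g)) * κ g (e g) b (d' g) := by
    intro e
    rw [Finset.prod_univ_sum, Fintype.piFinset_univ]
  simp only [h2]
  have h3 := Finset.prod_univ_sum (fun g => (Finset.univ : Finset (R g)))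
    (fun g e => ∑ b, star (κ g e b (d g)) * κ g e b (d' g))
  rw [Fintype.piFinset_univ] at h3
  rw [← h3, Finset.prod_congr rfl fun g _ => hκ g (d g) (d' g)]
  by_cases hd : d = d'
  · simp [hd]
  · rw [if_neg hd]
    obtain ⟨g, hg⟩ := Function.ne_iff.mp hd
    exact Finset.prod_eq_zero (Finset.mem_univ g) (if_neg hg)

theorem reindex {R B B' C C' : Type} [Fintype R] [Fintype B] [Fintype B']
    [DecidableEq C] [DecidableEq C'] {κ : R → B → C → ℂ} (hκ : IsKraus κ)
    (φ : B' ≃ B) (φ' : C' ≃ C) : IsKraus fun e c d => κ e (φ c) (φ' d) := by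
  intro a b
  rw [← if_congr φ'.injective.eq_iff rfl rfl, ← hκ (φ' a) (φ' b)]
  exact Finset.sum_congr rfl fun e _ => φ.sum_comp fun c => star (κ e c (φ' a)) * κ e c (φ' b)

theorem comp {R S B C D : Type} [Fintype R] [Fintype S] [Fintype B]
    [Fintype C] [DecidableEq C] [DecidableEq D] {κ : S → B → C → ℂ} {τ : R → C → D → ℂ}
    (hκ : IsKraus κ) (hτ : IsKraus τ) :
    IsKraus fun (e : R × S) b d => ∑ c, κ e.2 b c * τ e.1 c d := by
  intro a b
  rw [← hτ a b, Fintype.sum_prod_type]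
  refine Finset.sum_congr rfl fun r _ => ?_
  have h1 : ∀ s b', star (∑ c, κ s b' c * τ r c a) * ∑ c, κ s b' c * τ r c b =
      ∑ c, ∑ c', star (κ s b' c) * κ s b' c' * (star (τ r c a) * τ r c' b) := by
    intro s b'
    rw [star_sum, Finset.sum_mul_sum]
    refine Finset.sum_congr rfl fun c _ => Finset.sum_congr rfl fun c' _ => ?_
    rw [star_mul]
    ring
  have h2 : ∑ s, ∑ b', ∑ c, ∑ c', star (κ s b' c) * κ s b' c' * (star (τ r c a) * τ r c' b) =
      ∑ c, ∑ c', (∑ s, ∑ b', star (κ s b' c) * κ s b' c') * (star (τ r c a) * τ r c' b) := by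
    simp only [Finset.sum_mul]
    rw [Finset.sum_congr rfl fun s _ => Finset.sum_comm, Finset.sum_comm]
    refine Finset.sum_congr rfl fun c _ => ?_
    rw [Finset.sum_congr rfl fun s _ => Finset.sum_comm, Finset.sum_comm]
  simp only [h1]
  rw [h2]
  refine Finset.sum_congr rfl fun c _ => ?_
  simp only [hκ c]
  simp

end IsKraus

/-! ### Locally prepared states -/

/-- The classes of wires: `none` for the wires that are discarded, `some none` for the wires that
belong to a shared state, and `some (some p)` for the wires of the party `p`. -/
abbrev WireClass (Pt : Type) : Type := Option (Option Pt)

/-- The function that is `z` on the discarded wires and `c` on the others. -/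
def overrideDiscarded {W A Pt : Type} (cls : W → WireClass Pt) (z : {w // cls w = none} → A)
    (c : W → A) : W → A :=
  fun w => match h : cls w with
    | none => z ⟨w, h⟩
    | some _ => c w

theorem overrideDiscarded_of_none {W A Pt : Type} {cls : W → WireClass Pt}
    (z : {w // cls w = none} → A) (c : W → A) (w : {w // cls w = none}) :
    overrideDiscarded cls z c w = z w := by
  unfold overrideDiscarded
  split
  · rfl
  · next h => rw [w.2] at h; cases h

theorem overrideDiscarded_of_ne {W A Pt : Type} {cls : W → WireClass Pt}
    (z : {w // cls w = none} → A) (c : W → A) {w : W} (hw : cls w ≠ none) :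
    overrideDiscarded cls z c w = c w := by
  unfold overrideDiscarded
  split
  · next h => exact absurd h hw
  · rfl

/-- The entries of the reduced state of the wires that are not discarded. -/
def reducedState {W A Pt : Type} [Fintype W] [DecidableEq W] [DecidableEq Pt] [Fintype A]
    (cls : W → WireClass Pt) (σ : (W → A) → (W → A) → ℂ) (c c' : W → A) : ℂ :=
  ∑ z : {w // cls w = none} → A, σ (overrideDiscarded cls z c) (overrideDiscarded cls z c')

/-- A family `σ` of (unnormalized) states of the wires `W`, indexed by `X`, that is prepared by
parties `p : Pt` from a shared state `∑ ψ ψ†`: on input `x` the party `p` applies the channel with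
Kraus operators `F p x e` and produces its wires. The discarded wires are traced out. -/
structure LocalPreparation {W A Pt X : Type} [Fintype W] [DecidableEq W] [Fintype A] [DecidableEq A]
    [Fintype Pt] [DecidableEq Pt] (cls : W → WireClass Pt) (agree : Pt → X → X → Prop)
    (σ : X → (W → A) → (W → A) → ℂ) where
  H : Pt → Type
  [fintypeH : ∀ p, Fintype (H p)]
  [decEqH : ∀ p, DecidableEq (H p)]
  E : Option Pt → Type
  [fintypeE : ∀ γ, Fintype (E γ)]
  ψ : E none → (∀ p, H p) → ({w // cls w = some none} → A) → ℂ
  F : ∀ p, X → E (some p) → ({w // cls w = some (some p)} → A) → H p → ℂ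
  isKraus : ∀ p x, IsKraus (F p x)
  local_dep : ∀ p x x', agree p x x' → F p x = F p x'
  eq : ∀ x c c', reducedState cls (σ x) c c' = ∑ ε : ∀ γ, E γ,
    (∑ h, ψ (ε none) h (fun w => c w) * ∏ p, F p x (ε (some p)) (fun w => c w) (h p)) *
      star (∑ h, ψ (ε none) h (fun w => c' w) * ∏ p, F p x (ε (some p)) (fun w => c' w) (h p))

/-- Functions on the wires of the party `p` after some shared wires were handed to `p`. -/
def handEquiv {W A Pt : Type} [DecidableEq Pt] (cls cls' : W → WireClass Pt) (p : Pt)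
    (h : ∀ w, cls w = some (some p) → cls' w = some (some p)) :
    ({w // cls' w = some (some p)} → A) ≃ ({w // cls w = some (some p)} → A) ×
      ({w // cls' w = some (some p) ∧ cls w ≠ some (some p)} → A) where
  toFun c := (fun w => c ⟨w, h w w.2⟩, fun w => c ⟨w, w.2.1⟩)
  invFun b w := if hw : cls w = some (some p) then b.1 ⟨w, hw⟩ else b.2 ⟨w, w.2, hw⟩
  left_inv c := by
    funext w
    by_cases hw : cls w = some (some p) <;> simp [hw]
  right_inv b := by
    ext w
    · exact dif_pos w.2
    · exact dif_neg w.2.2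

/-- Restoring the shared wires from those that were handed to the parties and the rest. -/
def unhand {W A Pt : Type} (cls cls' : W → WireClass Pt) (h : ∀ w, cls' w = none ↔ cls w = none)
    (c : {w // cls' w = some none} → A)
    (s : ∀ p, {w // cls' w = some (some p) ∧ cls w ≠ some (some p)} → A) :
    {w // cls w = some none} → A := fun w =>
  match hw : cls' w.1 with
  | none => absurd ((h w).mp hw) (by rw [w.2]; simp)
  | some none => c ⟨w.1, hw⟩
  | some (some p) => s p ⟨w.1, hw, by rw [w.2]; simp⟩

theorem unhand_restrict {W A Pt : Type} (cls cls' : W → WireClass Pt)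
    (h : ∀ w, cls' w = none ↔ cls w = none) (c : W → A) :
    unhand cls cls' h (fun w : {w // cls' w = some none} => c w) (fun _ w => c w) =
      fun w : {w // cls w = some none} => c w := by
  funext w
  unfold unhand
  split
  · next hw => exact absurd ((h w).mp hw) (by rw [w.2]; simp)
  · rfl
  · rfl

theorem reducedState_congr {W A Pt : Type} [Fintype W] [DecidableEq W] [DecidableEq Pt] [Fintype A]
    {cls cls' : W → WireClass Pt} (h : ∀ w, cls' w = none ↔ cls w = none)
    (σ : (W → A) → (W → A) → ℂ) (c c' : W → A) :
    reducedState cls' σ c c' = reducedState cls σ c c' := by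
  let φ : {w // cls' w = none} ≃ {w // cls w = none} := Equiv.subtypeEquivRight h
  refine Fintype.sum_equiv (φ.arrowCongr (Equiv.refl A)) _ _ fun z => ?_
  have key : ∀ c : W → A, overrideDiscarded cls' z c =
      overrideDiscarded cls (φ.arrowCongr (Equiv.refl A) z) c := by
    intro c
    funext w
    by_cases hw : cls w = none
    · rw [overrideDiscarded_of_none z c ⟨w, (h w).mpr hw⟩,
        overrideDiscarded_of_none _ c ⟨w, hw⟩]
      rfl
    · rw [overrideDiscarded_of_ne _ _ hw,
        overrideDiscarded_of_ne _ _ fun h' => hw ((h w).mp h')]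
  rw [key c, key c']

/-- Functions on the wires of class `γ` before some of them are discarded. -/
def mergeEquiv {W A Pt : Type} (cls cls' : W → WireClass Pt)
    (h : ∀ w, cls' w ≠ none → cls' w = cls w) (γ : Option Pt) :
    ({w // cls w = some γ ∧ cls' w = none} → A) × ({w // cls' w = some γ} → A) ≃
      ({w // cls w = some γ} → A) where
  toFun b w := match hw : cls' w with
    | none => b.1 ⟨w, w.2, hw⟩
    | some _ => b.2 ⟨w, by rw [h w (by rw [hw]; simp)]; exact w.2⟩
  invFun c := (fun w => c ⟨w, w.2.1⟩, fun w => c ⟨w, by rw [← h w (by rw [w.2]; simp)]; exact w.2⟩)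
  left_inv b := by
    ext w
    · dsimp only
      split
      · rfl
      · next hw => rw [w.2.2] at hw; cases hw
    · dsimp only
      split
      · next hw => rw [w.2] at hw; cases hw
      · rfl
  right_inv c := by
    funext w
    dsimp only
    split <;> rfl

/-- Functions on the discarded wires after more wires are discarded. -/
def discardEquiv {W A Pt : Type} (cls cls' : W → WireClass Pt)
    (h : ∀ w, cls' w ≠ none → cls' w = cls w) :
    ({w // cls' w = none} → A) ≃
      (∀ γ, {w // cls w = some γ ∧ cls' w = none} → A) × ({w // cls w = none} → A) where
  toFun z := (fun _ w => z ⟨w, w.2.2⟩, fun w => z ⟨w, by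
    by_contra hw
    exact hw ((h w hw).trans w.2)⟩)
  invFun b w := match hw : cls w with
    | none => b.2 ⟨w, hw⟩
    | some γ => b.1 γ ⟨w, hw, w.2⟩
  left_inv z := by
    funext w
    dsimp only
    split <;> rfl
  right_inv b := by
    refine Prod.ext (funext fun γ => funext fun w => ?_) (funext fun w => ?_)
    · dsimp only
      split
      · next hw => rw [w.2.1] at hw; cases hw
      · next γ' hw =>
        obtain rfl : γ = γ' := Option.some.inj (w.2.1.symm.trans hw)
        rfl
    · dsimp only
      split
      · rfl
      · next hw => rw [w.2] at hw; cases hw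

/-- The function that is `s` on the newly discarded wires and `c` on the others. -/
def overrideNew {W A Pt : Type} (cls cls' : W → WireClass Pt)
    (s : ∀ γ, {w // cls w = some γ ∧ cls' w = none} → A) (c : W → A) : W → A := fun w =>
  match hw' : cls' w, hw : cls w with
  | none, some γ => s γ ⟨w, hw, hw'⟩
  | none, none => c w
  | some _, _ => c w

theorem overrideNew_restrict {W A Pt : Type} (cls cls' : W → WireClass Pt)
    (h : ∀ w, cls' w ≠ none → cls' w = cls w)
    (s : ∀ γ, {w // cls w = some γ ∧ cls' w = none} → A) (c : W → A) (γ : Option Pt) :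
    (fun w : {w // cls w = some γ} => overrideNew cls cls' s c w) =
      mergeEquiv cls cls' h γ (s γ, fun w => c w) := by
  funext w
  simp only [mergeEquiv, Equiv.coe_fn_mk, overrideNew]
  split
  · next γ' hw' hw =>
    obtain rfl : γ = γ' := Option.some.inj (w.2.symm.trans hw)
    split
    · rfl
    · next h' => rw [hw'] at h'; cases h'
  · next hw' hw => rw [w.2] at hw; cases hw
  · next hw' =>
    split
    · next h' => rw [hw'] at h'; cases h'
    · rfl

theorem overrideDiscarded_discardEquiv_symm {W A Pt : Type} (cls cls' : W → WireClass Pt)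
    (h : ∀ w, cls' w ≠ none → cls' w = cls w)
    (s : ∀ γ, {w // cls w = some γ ∧ cls' w = none} → A) (z : {w // cls w = none} → A)
    (c : W → A) :
    overrideDiscarded cls' ((discardEquiv cls cls' h).symm (s, z)) c =
      overrideDiscarded cls z (overrideNew cls cls' s c) := by
  funext w
  rcases hw' : cls' w with _ | γ'
  · rw [overrideDiscarded_of_none _ c ⟨w, hw'⟩]
    simp only [discardEquiv, Equiv.coe_fn_symm_mk, overrideDiscarded]
    split
    · rfl
    · next γ hw =>
      simp only [overrideNew]
      split
      · next γ'' _ hw'' =>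
        obtain rfl : γ = γ'' := Option.some.inj (hw.symm.trans hw'')
        rfl
      · next hw'' => rw [hw] at hw''; cases hw''
      · next hw'' => rw [hw'] at hw''; cases hw''
  · have hne : cls' w ≠ none := by rw [hw']; simp
    rw [overrideDiscarded_of_ne _ _ hne, overrideDiscarded_of_ne _ _ (by rw [← h w hne]; exact hne)]
    simp only [overrideNew]
    split
    · next hw'' _ => rw [hw'] at hw''; cases hw''
    · rfl
    · rfl

/-- Partial traces compose: the larger trace is the old one followed by a sum over basis states of
the newly discarded wires, and these split by their old class, so that each party can perform its
share. -/
theorem reducedState_discard {W A Pt : Type} [Fintype W] [DecidableEq W] [Fintype Pt]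
    [DecidableEq Pt] [Fintype A] {cls cls' : W → WireClass Pt}
    (h : ∀ w, cls' w ≠ none → cls' w = cls w) (σ : (W → A) → (W → A) → ℂ) (c c' : W → A) :
    reducedState cls' σ c c' = ∑ s : ∀ γ, {w // cls w = some γ ∧ cls' w = none} → A,
      reducedState cls σ (overrideNew cls cls' s c) (overrideNew cls cls' s c') := by
  unfold reducedState
  rw [← (discardEquiv cls cls' h).symm.sum_comp, Fintype.sum_prod_type]
  simp only [overrideDiscarded_discardEquiv_symm]

namespace LocalPreparation

attribute [instance] fintypeH decEqH fintypeE

variable {W A Pt X : Type} [Fintype W] [DecidableEq W] [Fintype A] [DecidableEq A] [Fintype Pt]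
  [DecidableEq Pt] {cls : W → WireClass Pt} {agree : Pt → X → X → Prop}
  {σ : X → (W → A) → (W → A) → ℂ}

/-- Basis states are locally prepared. -/
def ofBasis (cls : W → WireClass Pt) (agree : Pt → X → X → Prop) (f : X → W → A)
    (hnone : ∀ w, cls w = some none → ∀ x x', f x w = f x' w)
    (hsome : ∀ w p, cls w = some (some p) → ∀ x x', agree p x x' → f x w = f x' w) (x₀ : X) :
    LocalPreparation cls agree (fun x c c' => if f x = c ∧ f x = c' then 1 else 0) where
  H _ := Unit
  E _ := Unit
  -- By `hnone` the shared wires do not depend on the input, so any reference input gives the same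
  -- state.
  ψ _ _ c := if ∀ w, c w = f x₀ w then 1 else 0
  F p x _ c _ := if ∀ w, c w = f x w then 1 else 0
  isKraus p x a b := by
    rw [Finset.univ_unique, Finset.sum_singleton, Finset.sum_eq_single (fun w : {w // cls w = some (some p)} => f x w)]
    · simp
    · intro c _ hc
      have : ¬ ∀ w, c w = f x w := fun h => hc (funext h)
      beta_reduce
      rw [if_neg this, mul_zero]
    · simp
  local_dep p x x' h := by
    funext _ c _
    congr 1
    refine propext (forall_congr' fun w => ?_)
    rw [hsome w p w.2 x x' h]
  eq x c c' := by
    have key : ∀ c : W → A, (if ∀ w : {w // cls w = some none}, c w = f x₀ w then (1 : ℂ) else 0) *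
        ∏ p, (if ∀ w : {w // cls w = some (some p)}, c w = f x w then (1 : ℂ) else 0) =
        if ∀ w, cls w ≠ none → f x w = c w then 1 else 0 := by
      intro c
      by_cases hc : ∀ w, cls w ≠ none → f x w = c w
      · have h1 : ∀ w : {w // cls w = some none}, c w = f x₀ w := fun w => by
          rw [← hc w (by rw [w.2]; simp)]
          exact hnone w w.2 _ _
        have h2 : ∀ p, ∀ w : {w // cls w = some (some p)}, c w = f x w := fun p w =>
          (hc w (by rw [w.2]; simp)).symm
        rw [if_pos h1, if_pos hc, Finset.prod_eq_one fun p _ => if_pos (h2 p), one_mul]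
      · rw [if_neg hc]
        push Not at hc
        obtain ⟨w, hw0, hw⟩ := hc
        rcases h : cls w with _ | _ | p
        · exact absurd h hw0
        · rw [if_neg, zero_mul]
          intro h'
          exact hw ((hnone w h _ _).trans (h' ⟨w, h⟩).symm)
        · rw [Finset.prod_eq_zero (Finset.mem_univ p), mul_zero]
          rw [if_neg]
          intro h'
          exact hw (h' ⟨w, h⟩).symm
    have hov : ∀ (z : {w // cls w = none} → A) (c : W → A), f x = overrideDiscarded cls z c ↔
        z = (fun w : {w // cls w = none} => f x w) ∧ ∀ w, cls w ≠ none → f x w = c w := by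
      intro z c
      constructor
      · intro h
        refine ⟨funext fun w => ?_, fun w hw => ?_⟩
        · rw [h, overrideDiscarded_of_none]
        · rw [h, overrideDiscarded_of_ne _ _ hw]
      · rintro ⟨rfl, h⟩
        funext w
        by_cases hw : cls w = none
        · exact (overrideDiscarded_of_none (fun w : {w // cls w = none} => f x w) c ⟨w, hw⟩).symm
        · rw [overrideDiscarded_of_ne _ _ hw, h w hw]
    simp only [Finset.univ_unique, Finset.sum_singleton, key, reducedState, hov]
    rw [Finset.sum_eq_single (fun w : {w // cls w = none} => f x w)]
    · by_cases h1 : ∀ w, cls w ≠ none → f x w = c w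
      · by_cases h2 : ∀ w, cls w ≠ none → f x w = c' w
        · rw [if_pos ⟨⟨rfl, h1⟩, rfl, h2⟩, if_pos h1, if_pos h2, star_one, one_mul]
        · rw [if_neg fun h' => h2 h'.2.2, if_neg h2, star_zero, mul_zero]
      · rw [if_neg fun h' => h1 h'.1.2, if_neg h1, zero_mul]
    · intro z _ hz
      rw [if_neg fun h' => hz h'.1.1]
    · simp

/-- Handing shared wires to the parties. -/
def handOver (D : LocalPreparation cls agree σ) (cls' : W → WireClass Pt) (h₀ : ∀ w, cls' w = none ↔ cls w = none)
    (h : ∀ w p, cls w = some (some p) → cls' w = some (some p)) : LocalPreparation cls' agree σ where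
  H p := D.H p × ({w // cls' w = some (some p) ∧ cls w ≠ some (some p)} → A)
  E := D.E
  ψ ε hs c := D.ψ ε (fun p => (hs p).1) (unhand cls cls' h₀ c fun p => (hs p).2)
  -- The received wires lie in an additional register, and the Kraus operators are those of `D`
  -- tensored with the identity on it.
  F p x e c hs :=
    D.F p x e (fun w => c ⟨w, h w p w.2⟩) hs.1 *
      if (fun w : {w // cls' w = some (some p) ∧ cls w ≠ some (some p)} => c ⟨w, w.2.1⟩) = hs.2 then 1 else 0
  isKraus p x a b := by
    have h2 : ∀ e, (∑ c : {w // cls' w = some (some p)} → A,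
        star (D.F p x e (fun w => c ⟨w, h w p w.2⟩) a.1 *
          if (fun w : {w // cls' w = some (some p) ∧ cls w ≠ some (some p)} => c ⟨w, w.2.1⟩) = a.2
            then (1 : ℂ) else 0) *
        (D.F p x e (fun w => c ⟨w, h w p w.2⟩) b.1 *
          if (fun w : {w // cls' w = some (some p) ∧ cls w ≠ some (some p)} => c ⟨w, w.2.1⟩) = b.2
            then (1 : ℂ) else 0)) =
        (∑ c, star (D.F p x e c a.1) * D.F p x e c b.1) * if a.2 = b.2 then 1 else 0 := by
      intro e
      have h3 := (handEquiv (A := A) cls cls' p fun w => h w p).sum_comp fun z =>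
        star (D.F p x e z.1 a.1 * if z.2 = a.2 then (1 : ℂ) else 0) *
          (D.F p x e z.1 b.1 * if z.2 = b.2 then (1 : ℂ) else 0)
      refine h3.trans ?_
      rw [Fintype.sum_prod_type, Finset.sum_mul]
      refine Finset.sum_congr rfl fun c _ => ?_
      rw [Finset.sum_eq_single a.2]
      · simp
      · intro s _ hs
        simp [hs]
      · simp
    simp only [h2, ← Finset.sum_mul, D.isKraus p x a.1 b.1]
    by_cases ha : a.1 = b.1 <;> by_cases hb : a.2 = b.2 <;> simp [ha, hb, Prod.ext_iff]
  local_dep p x x' hx := by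
    rw [D.local_dep p x x' hx]
  eq x c c' := by
    rw [reducedState_congr h₀, D.eq]
    have key : ∀ (ε : ∀ γ, D.E γ) (c : W → A),
        (∑ hs : ∀ p, D.H p × ({w // cls' w = some (some p) ∧ cls w ≠ some (some p)} → A),
          D.ψ (ε none) (fun p => (hs p).1) (unhand cls cls' h₀ (fun w => c w) fun p => (hs p).2) *
          ∏ p, (D.F p x (ε (some p)) (fun w => c w) (hs p).1 *
            if (fun w : {w // cls' w = some (some p) ∧ cls w ≠ some (some p)} => c w) = (hs p).2
              then 1 else 0)) =
        ∑ h, D.ψ (ε none) h (fun w => c w) * ∏ p, D.F p x (ε (some p)) (fun w => c w) (h p) := by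
      intro ε c
      rw [sum_pi_prod]
      refine Finset.sum_congr rfl fun h _ => ?_
      rw [Finset.sum_eq_single
        (fun p (w : {w // cls' w = some (some p) ∧ cls w ≠ some (some p)}) => c w)]
      · simp only [if_true, mul_one]
        rw [unhand_restrict]
      · intro s _ hs
        obtain ⟨p, hp⟩ := Function.ne_iff.mp hs
        rw [Finset.prod_eq_zero (Finset.mem_univ p), mul_zero]
        rw [if_neg (Ne.symm hp), mul_zero]
      · simp
    refine Finset.sum_congr rfl fun ε _ => ?_
    rw [← key ε c, ← key ε c']

/-- Discarding wires. -/
def discard (D : LocalPreparation cls agree σ) (cls' : W → WireClass Pt)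
    (h : ∀ w, cls' w ≠ none → cls' w = cls w) : LocalPreparation cls' agree σ where
  H := D.H
  -- The basis state of a traced-out wire becomes an additional Kraus index of the class that held
  -- the wire.
  E γ := D.E γ × ({w // cls w = some γ ∧ cls' w = none} → A)
  ψ ε h' c := D.ψ ε.1 h' (mergeEquiv cls cls' h none (ε.2, c))
  F p x ε c h' := D.F p x ε.1 (mergeEquiv cls cls' h (some p) (ε.2, c)) h'
  isKraus p x a b := by
    rw [← D.isKraus p x a b, Fintype.sum_prod_type]
    refine Finset.sum_congr rfl fun ε _ => ?_
    rw [← (mergeEquiv cls cls' h (some p)).sum_comp, Fintype.sum_prod_type]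
  local_dep p x x' hx := by
    rw [D.local_dep p x x' hx]
  eq x c c' := by
    rw [reducedState_discard h, sum_pi_prod, Finset.sum_comm]
    refine Finset.sum_congr rfl fun s _ => ?_
    rw [D.eq]
    simp only [overrideNew_restrict cls cls' h]

end LocalPreparation

/-! ### Layers of gates that respect the classes -/

/-- The wires adjacent to the gates of class `γ` are partitioned by these gates. -/
def classFiberEquiv {W G Γ : Type} (A : Type) (f : W → G) (gcls : G → Γ) (γ : Γ) :
    ({w // gcls (f w) = γ} → A) ≃ ∀ g : {g // gcls g = γ}, {w // f w = g} → A where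
  toFun c g w := c ⟨w, by rw [w.2]; exact g.2⟩
  invFun b w := b ⟨f w, w.2⟩ ⟨w, rfl⟩
  left_inv _ := rfl
  right_inv b := by
    funext g w
    obtain ⟨g, hg⟩ := g
    obtain ⟨w, hw⟩ := w
    dsimp only at hw
    subst hw
    rfl

/-- A Kraus operator of all the gates of class `γ`. -/
def classGate {W W' G Γ A : Type} [Fintype G] [DecidableEq Γ] {R : G → Type}
    {reads : W → G} {writes : W' → G} (gcls : G → Γ)
    (κ : ∀ g, R g → ({w // writes w = g} → A) → ({w // reads w = g} → A) → ℂ) (γ : Γ)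
    (e : ∀ g : {g // gcls g = γ}, R g) (c : {w // gcls (writes w) = γ} → A)
    (d : {w // gcls (reads w) = γ} → A) : ℂ :=
  ∏ g : {g // gcls g = γ}, κ g (e g) (classFiberEquiv A writes gcls γ c g)
    (classFiberEquiv A reads gcls γ d g)

theorem isKraus_classGate {W W' G Γ A : Type} [Fintype W] [DecidableEq W] [Fintype W']
    [DecidableEq W'] [Fintype G] [DecidableEq G] [DecidableEq Γ] [Fintype A] [DecidableEq A]
    {R : G → Type} [∀ g, Fintype (R g)] {reads : W → G} {writes : W' → G} (gcls : G → Γ)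
    {κ : ∀ g, R g → ({w // writes w = g} → A) → ({w // reads w = g} → A) → ℂ}
    (hκ : ∀ g, IsKraus (κ g)) (γ : Γ) : IsKraus (classGate gcls κ γ) :=
  (IsKraus.tensor fun g : {g // gcls g = γ} => hκ g).reindex
    (classFiberEquiv A writes gcls γ) (classFiberEquiv A reads gcls γ)

theorem prod_classGate {W W' G Γ A : Type} [Fintype G] [DecidableEq G] [Fintype Γ] [DecidableEq Γ]
    {R : G → Type} {reads : W → G} {writes : W' → G} (gcls : G → Γ)
    (κ : ∀ g, R g → ({w // writes w = g} → A) → ({w // reads w = g} → A) → ℂ) (e : ∀ g, R g)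
    (c : W' → A) (d : W → A) :
    ∏ γ, classGate gcls κ γ (fun g => e g) (fun w => c w) (fun w => d w) =
      ∏ g, κ g (e g) (fun w => c w) (fun w => d w) :=
  Fintype.prod_fiberwise gcls fun g => κ g (e g) (fun w => c w) (fun w => d w)

theorem sum_mul_sum_star {E B : Type} [Fintype E] [Fintype B] (a b : B → ℂ) (v : E → B → ℂ) :
    ∑ d, ∑ d', a d * (∑ ε, v ε d * star (v ε d')) * star (b d') =
      ∑ ε, (∑ d, a d * v ε d) * star (∑ d, b d * v ε d) := by
  simp only [star_sum, Finset.mul_sum, Finset.sum_mul]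
  rw [Finset.sum_congr rfl fun d _ => Finset.sum_comm, Finset.sum_comm]
  refine Finset.sum_congr rfl fun ε _ => ?_
  rw [Finset.sum_comm]
  refine Finset.sum_congr rfl fun d _ => Finset.sum_congr rfl fun d' _ => ?_
  rw [star_mul]
  ring

/-- A function on all wires, from its restrictions to the discarded wires and to the classes of the
other wires. -/
def joinEquiv {W Pt : Type} (A : Type) (cls : W → WireClass Pt) :
    ({w // cls w = none} → A) × (∀ γ, {w // cls w = some γ} → A) ≃ (W → A) :=
  Equiv.piOptionEquivProd.symm.trans (fiberEquiv cls fun _ => A).symm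

theorem joinEquiv_restrict_none {W A Pt : Type} {cls : W → WireClass Pt}
    (z : {w // cls w = none} → A) (c : ∀ γ, {w // cls w = some γ} → A) :
    (fun w : {w // cls w = none} => joinEquiv A cls (z, c) w) = z :=
  congrFun ((fiberEquiv cls fun _ => A).apply_symm_apply
    (Equiv.piOptionEquivProd.symm (z, c))) none

theorem joinEquiv_restrict_some {W A Pt : Type} {cls : W → WireClass Pt}
    (z : {w // cls w = none} → A) (c : ∀ γ, {w // cls w = some γ} → A) (γ : Option Pt) :
    (fun w : {w // cls w = some γ} => joinEquiv A cls (z, c) w) = c γ :=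
  congrFun ((fiberEquiv cls fun _ => A).apply_symm_apply
    (Equiv.piOptionEquivProd.symm (z, c))) (some γ)

theorem overrideDiscarded_joinEquiv {W A Pt : Type} {cls : W → WireClass Pt}
    (z z' : {w // cls w = none} → A) (c : ∀ γ, {w // cls w = some γ} → A) :
    overrideDiscarded cls z (joinEquiv A cls (z', c)) = joinEquiv A cls (z, c) := by
  apply (fiberEquiv cls fun _ => A).injective
  funext γ
  rcases γ with _ | γ
  · refine Eq.trans ?_ (joinEquiv_restrict_none z c).symm
    funext w
    exact overrideDiscarded_of_none _ _ w
  · refine Eq.trans ?_ ((joinEquiv_restrict_some z' c γ).trans (joinEquiv_restrict_some z c γ).symm)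
    funext w
    exact overrideDiscarded_of_ne _ _ (by rw [w.2]; simp)

theorem reducedState_joinEquiv {W A Pt : Type} [Fintype W] [DecidableEq W] [DecidableEq Pt]
    [Fintype A] {cls : W → WireClass Pt} (σ : (W → A) → (W → A) → ℂ)
    (z z' : {w // cls w = none} → A) (c c' : ∀ γ, {w // cls w = some γ} → A) :
    reducedState cls σ (joinEquiv A cls (z, c)) (joinEquiv A cls (z', c')) =
      ∑ y, σ (joinEquiv A cls (y, c)) (joinEquiv A cls (y, c')) := by
  simp only [reducedState, overrideDiscarded_joinEquiv]

/-- The reduced state after a channel on the discarded wires does not depend on that channel. -/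
theorem sum_isKraus {R B C D : Type} [Fintype R] [Fintype B] [Fintype C] [DecidableEq C]
    [Fintype D] {κ : R → B → C → ℂ} (hκ : IsKraus κ) (a b : D → ℂ) (σ : C × D → C × D → ℂ) :
    ∑ z, ∑ e, ∑ d, ∑ d', κ e z d.1 * a d.2 * σ d d' * star (κ e z d'.1 * b d'.2) =
      ∑ d, ∑ d', a d * (∑ y, σ (y, d) (y, d')) * star (b d') := by
  have h1 : ∑ z, ∑ e, ∑ d, ∑ d', κ e z d.1 * a d.2 * σ d d' * star (κ e z d'.1 * b d'.2) =
      ∑ d, ∑ d', (∑ e, ∑ z, star (κ e z d'.1) * κ e z d.1) *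
        (a d.2 * σ d d' * star (b d'.2)) := by
    simp only [Finset.sum_mul]
    rw [Finset.sum_comm, Finset.sum_congr rfl fun e _ => Finset.sum_comm, Finset.sum_comm]
    refine Finset.sum_congr rfl fun d _ => ?_
    rw [Finset.sum_congr rfl fun e _ => Finset.sum_comm, Finset.sum_comm]
    refine Finset.sum_congr rfl fun d' _ => Finset.sum_congr rfl fun e _ =>
      Finset.sum_congr rfl fun z _ => ?_
    rw [star_mul]
    ring
  rw [h1]
  simp only [hκ _ _, Fintype.sum_prod_type]
  rw [Finset.sum_comm]
  refine Finset.sum_congr rfl fun d _ => ?_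
  simp only [Finset.mul_sum, Finset.sum_mul]
  rw [Finset.sum_comm (s := (Finset.univ : Finset D))]
  refine Finset.sum_congr rfl fun y _ => ?_
  rw [Finset.sum_comm]
  refine Finset.sum_congr rfl fun d' _ => ?_
  rw [Finset.sum_eq_single y]
  · rw [if_pos rfl, one_mul]
  · intro y' _ hy
    rw [if_neg hy, zero_mul]
  · simp

namespace LocalPreparation

variable {W W' A Pt X : Type} [Fintype W] [DecidableEq W] [Fintype W'] [DecidableEq W']
  [Fintype A] [DecidableEq A] [Fintype Pt] [DecidableEq Pt]
  {agree : Pt → X → X → Prop} {σ : X → (W → A) → (W → A) → ℂ}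

/-- The field `eq` in coordinates in which the wires of different classes vary independently; this
is the form that can be contracted with gates. -/
theorem eq_joinEquiv [Nonempty A] {cls : W → WireClass Pt} (D : LocalPreparation cls agree σ) (x : X)
    (d d' : ∀ γ, {w // cls w = some γ} → A) :
    ∑ y, σ x (joinEquiv A cls (y, d)) (joinEquiv A cls (y, d')) = ∑ ε : ∀ γ, D.E γ,
      (∑ h, D.ψ (ε none) h (d none) * ∏ p, D.F p x (ε (some p)) (d (some p)) (h p)) *
        star (∑ h, D.ψ (ε none) h (d' none) *
          ∏ p, D.F p x (ε (some p)) (d' (some p)) (h p)) := by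
  have z : {w // cls w = none} → A := fun _ => Classical.arbitrary A
  rw [← reducedState_joinEquiv (σ x) z z d d', D.eq]
  simp only [joinEquiv_restrict_some]

/-- Applying gates each of which acts on wires of a single class. -/
def applyGates [Nonempty A] {G : Type} [Fintype G] [DecidableEq G] {R : G → Type} [∀ g, Fintype (R g)]
    (reads : W → G) (writes : W' → G) (gcls : G → WireClass Pt)
    (κ : ∀ g, R g → ({w // writes w = g} → A) → ({w // reads w = g} → A) → ℂ)
    (hκ : ∀ g, IsKraus (κ g)) (D : LocalPreparation (fun w => gcls (reads w)) agree σ) :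
    LocalPreparation (fun w => gcls (writes w)) agree (fun x c c' => ∑ e : ∀ g, R g, ∑ d, ∑ d',
      (∏ g, κ g (e g) (fun w => c w) (fun w => d w)) * σ x d d' *
        star (∏ g, κ g (e g) (fun w => c' w) (fun w => d' w))) where
  H := D.H
  E γ := D.E γ × ∀ g : {g // gcls g = some γ}, R g
  ψ ε h c := ∑ d, classGate gcls κ (some none) ε.2 c d * D.ψ ε.1 h d
  F p x ε c h := ∑ d, classGate gcls κ (some (some p)) ε.2 c d * D.F p x ε.1 d h
  isKraus p x := (isKraus_classGate gcls hκ (some (some p))).comp (D.isKraus p x)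
  local_dep p x x' hx := by
    rw [D.local_dep p x x' hx]
  eq x c c' := by
    -- No gate mixes classes, so a Kraus operator of the layer is a product over the classes, with a
    -- separate factor for the discarded one.
    have hgate : ∀ (e0 : ∀ g : {g // gcls g = none}, R g)
        (e : ∀ γ, ∀ g : {g // gcls g = some γ}, R g)
        (z : {w // gcls (writes w) = none} → A) (c : W' → A)
        (d : ({w // gcls (reads w) = none} → A) × ∀ γ, {w // gcls (reads w) = some γ} → A),
        ∏ g, κ g ((fiberEquiv gcls R).symm (Equiv.piOptionEquivProd.symm (e0, e)) g)
          (fun w => overrideDiscarded (fun w => gcls (writes w)) z c w)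
          (fun w => joinEquiv A (fun w => gcls (reads w)) d w) =
        classGate gcls κ none e0 z d.1 *
          ∏ γ, classGate gcls κ (some γ) (e γ) (fun w => c w) (d.2 γ) := by
      intro e0 e z c d
      have hE : ∀ γ, (fun g : {g // gcls g = γ} =>
          (fiberEquiv gcls R).symm (Equiv.piOptionEquivProd.symm (e0, e)) g) =
          (Equiv.piOptionEquivProd (β := fun γ => ∀ g : {g // gcls g = γ}, R g)).symm (e0, e) γ :=
        fun γ => congrFun ((fiberEquiv gcls R).apply_symm_apply _) γ
      rw [← prod_classGate gcls, Fintype.prod_option]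
      simp only [hE]
      obtain ⟨d0, d⟩ := d
      congr 1
      · rw [joinEquiv_restrict_none]
        congr 1
        funext w
        exact overrideDiscarded_of_none _ _ w
      · refine Finset.prod_congr rfl fun γ _ => ?_
        rw [joinEquiv_restrict_some]
        congr 1
        funext w
        exact overrideDiscarded_of_ne _ _ (by rw [w.2]; simp)
    -- The gates of the shared class update `ψ` and those of party `p` update `F p`.
    have key : ∀ (ε : ∀ γ, D.E γ) (e : ∀ γ, ∀ g : {g // gcls g = some γ}, R g) (c : W' → A),
        ∑ d : ∀ γ, {w // gcls (reads w) = some γ} → A,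
          (∏ γ, classGate gcls κ (some γ) (e γ) (fun w => c w) (d γ)) *
          (∑ h, D.ψ (ε none) h (d none) * ∏ p, D.F p x (ε (some p)) (d (some p)) (h p)) =
        (∑ h, (∑ d, classGate gcls κ (some none) (e none) (fun w => c w) d *
            D.ψ (ε none) h d) *
          ∏ p, ∑ d, classGate gcls κ (some (some p)) (e (some p)) (fun w => c w) d *
            D.F p x (ε (some p)) d (h p)) := by
      intro ε e c
      simp only [Finset.mul_sum]
      rw [Finset.sum_comm]
      refine Finset.sum_congr rfl fun h _ => ?_
      -- The shared state is treated as one more factor, so that the sum over `d` distributes over a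
      -- product indexed by `Option Pt`.
      let φ : ∀ γ, ({w // gcls (reads w) = some γ} → A) → ℂ := fun γ =>
        match γ with
        | none => fun d => D.ψ (ε none) h d
        | some p => fun d => D.F p x (ε (some p)) d (h p)
      have h1 := Finset.prod_univ_sum
        (fun γ => (Finset.univ : Finset ({w // gcls (reads w) = some γ} → A))) (fun γ d =>
          classGate gcls κ (some γ) (e γ) (fun w => c w) d * φ γ d)
      rw [Fintype.prod_option, Fintype.piFinset_univ] at h1
      refine Eq.trans ?_ h1.symm
      refine Finset.sum_congr rfl fun d _ => ?_
      rw [Finset.prod_mul_distrib, Fintype.prod_option (fun γ => φ γ (d γ))]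
    have hR : ∀ φ : (∀ g, R g) → ℂ, ∑ e, φ e = ∑ e : ∀ γ, ∀ g : {g // gcls g = some γ}, R g,
        ∑ e0 : ∀ g : {g // gcls g = none}, R g,
          φ ((fiberEquiv gcls R).symm (Equiv.piOptionEquivProd.symm (e0, e))) := by
      intro φ
      rw [← (fiberEquiv gcls R).symm.sum_comp, ← Equiv.piOptionEquivProd.symm.sum_comp,
        Fintype.sum_prod_type, Finset.sum_comm]
    unfold reducedState
    simp only [← (joinEquiv A fun w => gcls (reads w)).sum_comp]
    simp only [hR, hgate]
    rw [Finset.sum_comm]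
    -- Trace preservation removes the gates on the discarded wires.
    have htrace := fun e : ∀ γ, ∀ g : {g // gcls g = some γ}, R g => sum_isKraus
      (isKraus_classGate gcls hκ none)
      (fun d : ∀ γ, {w // gcls (reads w) = some γ} → A =>
        ∏ γ, classGate gcls κ (some γ) (e γ) (fun w => c w) (d γ))
      (fun d => ∏ γ, classGate gcls κ (some γ) (e γ) (fun w => c' w) (d γ)) fun d d' =>
        σ x (joinEquiv A (fun w => gcls (reads w)) d) (joinEquiv A (fun w => gcls (reads w)) d')
    refine (Finset.sum_congr rfl fun e _ => htrace e).trans ?_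
    simp only [D.eq_joinEquiv]
    rw [Finset.sum_congr rfl fun e _ => sum_mul_sum_star _ _ _]
    simp only [key]
    rw [sum_pi_prod, Finset.sum_comm]

end LocalPreparation

theorem sum_comm₃ {α β γ : Type} (s : Finset α) (t : Finset β) (u : Finset γ)
    (f : α → β → γ → ℂ) :
    ∑ a ∈ s, ∑ b ∈ t, ∑ c ∈ u, f a b c = ∑ c ∈ u, ∑ b ∈ t, ∑ a ∈ s, f a b c := by
  rw [Finset.sum_comm, Finset.sum_congr rfl fun b _ => Finset.sum_comm, Finset.sum_comm]

theorem sum_comm₄ {α β γ δ : Type} (s : Finset α) (t : Finset β) (u : Finset γ) (v : Finset δ)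
    (f : α → β → γ → δ → ℂ) :
    ∑ a ∈ s, ∑ b ∈ t, ∑ c ∈ u, ∑ d ∈ v, f a b c d =
      ∑ d ∈ v, ∑ c ∈ u, ∑ b ∈ t, ∑ a ∈ s, f a b c d := by
  rw [sum_comm₃, Finset.sum_congr rfl fun c _ => sum_comm₃ t s v fun b a d => f a b c d,
    Finset.sum_comm]
  exact Finset.sum_congr rfl fun d _ => Finset.sum_congr rfl fun c _ => Finset.sum_comm

/-- Trace preservation for a rank-one input; it normalizes the shared state of the strategy. -/
theorem IsKraus.sum_mul_star {R B C : Type} [Fintype R] [Fintype B] [Fintype C] [DecidableEq C]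
    {κ : R → B → C → ℂ} (hκ : IsKraus κ) (φ : C → ℂ) :
    ∑ e, ∑ c, (∑ h, φ h * κ e c h) * star (∑ h, φ h * κ e c h) = ∑ h, φ h * star (φ h) := by
  have h1 : ∑ e, ∑ c, (∑ h, φ h * κ e c h) * star (∑ h, φ h * κ e c h) =
      ∑ h, ∑ h', (∑ e, ∑ c, star (κ e c h') * κ e c h) * (φ h * star (φ h')) := by
    simp only [star_sum, Finset.sum_mul_sum]
    simp only [Finset.sum_mul]
    rw [Finset.sum_congr rfl fun e _ => Finset.sum_comm, Finset.sum_comm]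
    refine Finset.sum_congr rfl fun h _ => ?_
    rw [Finset.sum_congr rfl fun e _ => Finset.sum_comm, Finset.sum_comm]
    refine Finset.sum_congr rfl fun h' _ => Finset.sum_congr rfl fun e _ =>
      Finset.sum_congr rfl fun c _ => ?_
    rw [star_mul]
    ring
  rw [h1]
  refine Finset.sum_congr rfl fun h _ => ?_
  simp only [hκ _ _]
  simp

/-- The outcome probabilities of product measurements with effects `∑ w w†` in the state
`∑ u u†`. -/
theorem trace_tensor_mul_rankOne {P L : Type} [Fintype P] [DecidableEq P] [Fintype L]
    {H K : P → Type} [∀ p, Fintype (H p)] (s : ∀ p, Finset (K p))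
    (w : ∀ p, K p → H p → ℂ) (u : L → (∀ p, H p) → ℂ) :
    Matrix.trace ((Matrix.of fun c c' : ∀ p, H p =>
        ∏ p, (∑ k ∈ s p, Matrix.vecMulVec (w p k) (star (w p k))) (c p) (c' p)) *
      ∑ l, Matrix.vecMulVec (u l) (star (u l))) =
    ∑ l, ∑ k ∈ Fintype.piFinset s, (∑ c, u l c * ∏ p, star (w p (k p) (c p))) *
      star (∑ c, u l c * ∏ p, star (w p (k p) (c p))) := by
  have h1 : ∀ c c' : ∀ p, H p,
      ∏ p, (∑ k ∈ s p, Matrix.vecMulVec (w p k) (star (w p k))) (c p) (c' p) =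
        ∑ k ∈ Fintype.piFinset s, (∏ p, w p (k p) (c p)) * ∏ p, star (w p (k p) (c' p)) := by
    intro c c'
    simp only [Matrix.sum_apply, Matrix.vecMulVec_apply, Pi.star_apply]
    rw [Finset.prod_univ_sum]
    simp only [Finset.prod_mul_distrib]
  simp only [Matrix.trace, Matrix.diag_apply, Matrix.mul_apply, Matrix.of_apply]
  simp only [h1]
  simp only [Matrix.sum_apply, Matrix.vecMulVec_apply, Pi.star_apply, star_sum,
    Finset.sum_mul_sum]
  rw [sum_comm₄]
  refine Finset.sum_congr rfl fun l _ => Finset.sum_congr rfl fun k _ =>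
    Finset.sum_congr rfl fun c _ => Finset.sum_congr rfl fun c' _ => ?_
  simp only [star_mul, star_prod, star_star]
  ring

namespace LocalPreparation

variable {W A ι : Type} [Fintype W] [DecidableEq W] [Fintype A] [DecidableEq A] [Fintype ι]
  [DecidableEq ι] {cls : W → WireClass ι} {Q Ans : ι → Type} [∀ i, Fintype (Ans i)]
  [∀ i, DecidableEq (Ans i)]
  {σ : (∀ i, Q i) → (W → A) → (W → A) → ℂ}

/-- Used twice: with weight `1` it computes the trace of the shared state, and with the indicator of
an event on the undiscarded wires it computes the probability of that event. -/
theorem sum_amplitude [Nonempty A]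
    (D : LocalPreparation cls (fun i x x' => x i = x' i) σ) (x : ∀ i, Q i) (f : (W → A) → ℂ)
    (hf : ∀ c c', (∀ w, cls w ≠ none → c w = c' w) → f c = f c') :
    ∑ c, f c * σ x c c =
      ∑ l : D.E none × ({w // cls w = some none} → A),
        ∑ k : ∀ i, D.E (some i) × ({w // cls w = some (some i)} → A),
          f (joinEquiv A cls (fun _ => Classical.arbitrary A,
            Equiv.piOptionEquivProd.symm (l.2, fun i => (k i).2))) *
          ((∑ h, D.ψ l.1 h l.2 * ∏ i, D.F i x (k i).1 (k i).2 (h i)) *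
            star (∑ h, D.ψ l.1 h l.2 * ∏ i, D.F i x (k i).1 (k i).2 (h i))) := by
  have hf' : ∀ y c, f (joinEquiv A cls (y, c)) =
      f (joinEquiv A cls (fun _ => Classical.arbitrary A, c)) := by
    intro y c
    refine hf _ _ fun w hw => ?_
    rcases hγ : cls w with _ | γ
    · exact absurd hγ hw
    · exact (congrFun (joinEquiv_restrict_some y c γ) ⟨w, hγ⟩).trans
        (congrFun (joinEquiv_restrict_some _ c γ) ⟨w, hγ⟩).symm
  rw [← (joinEquiv A cls).sum_comp, Fintype.sum_prod_type, Finset.sum_comm]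
  simp only [hf', ← Finset.mul_sum, D.eq_joinEquiv]
  have hE : ∀ φ : (∀ γ, D.E γ) → ℂ, ∑ ε, φ ε = ∑ e0, ∑ e : ∀ i, D.E (some i),
      φ (Equiv.piOptionEquivProd.symm (e0, e)) := by
    intro φ
    rw [← Equiv.piOptionEquivProd.symm.sum_comp, Fintype.sum_prod_type]
  rw [← Equiv.piOptionEquivProd.symm.sum_comp, Fintype.sum_prod_type]
  simp only [hE, sum_pi_prod (P := ι), Fintype.sum_prod_type]
  simp only [Finset.mul_sum]
  rw [Finset.sum_comm (γ := D.E none)]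
  refine Finset.sum_congr rfl fun c0 _ => ?_
  rw [Finset.sum_comm]
  refine Finset.sum_congr rfl fun e0 _ => ?_
  rw [Finset.sum_comm]
  rfl

/-- Locally prepared states, measured by the parties, give rise to a strategy. -/
theorem exists_strategy [Nonempty A]
    (D : LocalPreparation cls (fun i x x' => x i = x' i) σ) (g : ∀ i, (W → A) → Ans i)
    (hg : ∀ i c c', (∀ w, cls w = some none ∨ cls w = some (some i) → c w = c' w) →
      g i c = g i c')
    (x₀ : ∀ i, Q i) (htr : ∑ c, σ x₀ c c = 1) :
    ∃ S : Strategy Q Ans, ∀ x a,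
      S.prob x a = (∑ c with ∀ i, g i c = a i, σ x c c).re := by
  -- Values of the shared wires. Only diagonal entries of the final state matter, so these wires can
  -- be measured in advance and every player can hold a copy of the result.
  let C0 : Type := {w // cls w = some none} → A
  let arb : {w // cls w = none} → A := fun _ => Classical.arbitrary A
  let K : ι → Type := fun i => C0 × (D.E (some i) × ({w // cls w = some (some i)} → A))
  -- Player `i` fills in arbitrary symbols on the wires of the others, which `g i` ignores by `hg`.
  let g' : ∀ i, K i → Ans i := fun i k => g i (joinEquiv A cls (arb,
    Equiv.piOptionEquivProd.symm (k.1, Function.update (fun _ _ => Classical.arbitrary A) i k.2.2)))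
  have hg' : ∀ i (c0 : C0) (c : ∀ i, {w // cls w = some (some i)} → A) (e : D.E (some i)),
      g i (joinEquiv A cls (arb, Equiv.piOptionEquivProd.symm (c0, c))) = g' i (c0, e, c i) := by
    intro i c0 c e
    refine hg i _ _ fun w hw => ?_
    rcases hw with hw | hw
    · refine (congrFun (joinEquiv_restrict_some arb _ none) ⟨w, hw⟩).trans
        (Eq.trans ?_ (congrFun (joinEquiv_restrict_some arb _ none) ⟨w, hw⟩).symm)
      rfl
    · refine (congrFun (joinEquiv_restrict_some arb _ (some i)) ⟨w, hw⟩).trans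
        (Eq.trans ?_ (congrFun (joinEquiv_restrict_some arb _ (some i)) ⟨w, hw⟩).symm)
      simp [Equiv.piOptionEquivProd]
  -- The shared state is the mixture over `l` of the vectors `u l`, in which all players' copies
  -- equal `l.2`.
  let u : D.E none × C0 → (∀ i, D.H i × C0) → ℂ := fun l hs =>
    if ∀ i, (hs i).2 = l.2 then D.ψ l.1 (fun i => (hs i).1) l.2 else 0
  -- The measurement vector is conjugated because the amplitude of an outcome contains `star (w i q
  -- k)`. The questions of the other players are filled in from `x₀`, which is harmless by
  -- `local_dep`.
  let w : ∀ i, Q i → K i → D.H i × C0 → ℂ := fun i q k hs =>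
    if hs.2 = k.1 then star (D.F i (Function.update x₀ i q) k.2.1 k.2.2 hs.1) else 0
  have hFu : ∀ i (x : ∀ i, Q i), D.F i (Function.update x₀ i (x i)) = D.F i x := fun i x =>
    D.local_dep i _ _ (Function.update_self ..)
  have hamp : ∀ (x : ∀ i, Q i) (l : D.E none × C0) (k : ∀ i, K i),
      ∑ hs, u l hs * ∏ i, star (w i (x i) (k i) (hs i)) = if ∀ i, (k i).1 = l.2 then
        ∑ h, D.ψ l.1 h l.2 * ∏ i, D.F i x (k i).2.1 (k i).2.2 (h i) else 0 := by
    intro x l k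
    have h1 : ∀ h : ∀ i, D.H i, ∑ s : ∀ _ : ι, C0, u l (fun i => (h i, s i)) *
        ∏ i, star (w i (x i) (k i) (h i, s i)) = if ∀ i, (k i).1 = l.2 then
          D.ψ l.1 h l.2 * ∏ i, D.F i x (k i).2.1 (k i).2.2 (h i) else 0 := by
      intro h
      rw [Finset.sum_eq_single (fun _ => l.2)]
      · simp only [u, w, hFu, implies_true, if_true]
        split_ifs with hk
        · congr 1
          refine Finset.prod_congr rfl fun i _ => ?_
          rw [if_pos (hk i).symm, star_star]
        · push Not at hk
          obtain ⟨i, hi⟩ := hk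
          rw [Finset.prod_eq_zero (Finset.mem_univ i), mul_zero]
          rw [if_neg (Ne.symm hi), star_zero]
      · intro s _ hs
        have : ¬ ∀ i, s i = l.2 := fun h' => hs (funext h')
        simp only [u]
        rw [if_neg this, zero_mul]
      · simp
    rw [sum_pi_prod]
    simp only [h1]
    split_ifs <;> simp
  let M : ∀ i, Q i → Ans i → Matrix (D.H i × C0) (D.H i × C0) ℂ := fun i q a =>
    ∑ k with g' i k = a, Matrix.vecMulVec (w i q k) (star (w i q k))
  have hM : ∀ i q, ∑ a, M i q a = 1 := by
    intro i q
    simp only [M]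
    rw [Finset.sum_fiberwise]
    ext hs hs'
    simp only [Matrix.sum_apply, Matrix.vecMulVec_apply, Pi.star_apply, K, Fintype.sum_prod_type, w]
    rw [Finset.sum_eq_single hs.2]
    · have h1 := D.isKraus i (Function.update x₀ i q) hs.1 hs'.1
      simp only [if_true]
      by_cases h2 : hs'.2 = hs.2
      · simp only [h2, if_true, star_star, h1, Matrix.one_apply, Prod.ext_iff, and_true]
      · simp only [if_neg h2, star_zero, mul_zero, Finset.sum_const_zero]
        rw [Matrix.one_apply_ne]
        exact fun h' => h2 (by rw [h'])
    · intro s _ h2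
      simp [Ne.symm h2]
    · simp
  let ρ : Matrix (∀ i, D.H i × C0) (∀ i, D.H i × C0) ℂ :=
    ∑ l, Matrix.vecMulVec (u l) (star (u l))
  have hρ : ρ.trace = 1 := by
    -- The state does not depend on the query, so normalization at the single query `x₀` is enough.
    have h1 := D.sum_amplitude x₀ (fun _ => 1) fun _ _ _ => rfl
    simp only [one_mul, htr] at h1
    rw [h1]
    simp only [ρ, Matrix.trace_sum, Matrix.trace_vecMulVec, dotProduct, Pi.star_apply]
    refine Finset.sum_congr rfl fun l _ => ?_
    rw [sum_pi_prod (P := ι) (B := fun i => D.E (some i))]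
    refine Eq.trans ?_ ((IsKraus.tensor fun i => D.isKraus i x₀).sum_mul_star
      fun h => D.ψ l.1 h l.2).symm
    rw [sum_pi_prod]
    refine Finset.sum_congr rfl fun h _ => ?_
    rw [Finset.sum_eq_single (fun _ => l.2)]
    · simp [u]
    · intro s _ hs
      have : ¬ ∀ i, s i = l.2 := fun h' => hs (funext h')
      simp [u, this]
    · simp
  refine ⟨⟨fun i => D.H i × C0, ρ, Matrix.posSemidef_sum _ fun l _ =>
    Matrix.posSemidef_vecMulVec_self_star _, hρ, M, fun i q a => Matrix.posSemidef_sum _ fun k _ =>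
    Matrix.posSemidef_vecMulVec_self_star _, hM⟩, fun x a => ?_⟩
  unfold Strategy.prob
  congr 1
  dsimp only [M, ρ]
  rw [trace_tensor_mul_rankOne]
  have h1 := D.sum_amplitude x (fun c => if ∀ i, g i c = a i then 1 else 0) (by
    intro c c' h
    simp only [fun i => hg i c c' fun w hw => h w (by rcases hw with hw | hw <;> rw [hw] <;> simp)])
  rw [Finset.sum_filter, Finset.sum_congr rfl fun c _ => (by
    rw [ite_mul, one_mul, zero_mul] :
    (if ∀ i, g i c = a i then σ x c c else 0) = (if ∀ i, g i c = a i then 1 else 0) * σ x c c), h1]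
  refine Finset.sum_congr rfl fun l _ => ?_
  have hpi : Fintype.piFinset (fun i => Finset.univ.filter fun k => g' i k = a i) =
      Finset.univ.filter fun k => ∀ i, g' i (k i) = a i := by
    ext k
    simp [Fintype.mem_piFinset]
  -- Outcomes in which some player reports another value of the shared wires than `l.2` have
  -- amplitude zero.
  rw [hpi, Finset.sum_filter, sum_pi_prod, Finset.sum_eq_single (fun _ => l.2)]
  · refine Finset.sum_congr rfl fun k _ => ?_
    rw [hamp]
    simp only [implies_true, if_true, ite_mul, one_mul, zero_mul]
    refine if_congr (forall_congr' fun i => ?_) rfl rfl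
    rw [← hg' i l.2 (fun i => (k i).2) (k i).1]
  · intro s _ hs
    have hs' : ¬ ∀ i, s i = l.2 := fun h' => hs (funext h')
    refine Finset.sum_eq_zero fun k _ => ?_
    rw [hamp, if_neg hs', zero_mul, ite_self]
  · simp

end LocalPreparation

/-! ### Reach of wires and local simulation of circuits -/

namespace Circuit

variable {N : ℕ} {A : Type} [Fintype A] [DecidableEq A] {ι : Type}

/-- The labels `i`, attached to input vertices by `I`, on which the wire `w` of layer `t` depends. -/
def wireReach (C : Circuit N A) (I : Grid N → Set ι) : ∀ t, Fin (C.width t) → Set ι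
  | 0 => fun w => {i | ∃ u, C.source w = Sum.inl u ∧ i ∈ I u}
  | t + 1 => fun w => {i | ∃ w', C.reads t w' = C.writes t w ∧ i ∈ C.wireReach I t w'}

/-- The labels on which the gate `g` of layer `t` depends. -/
def gateReach (C : Circuit N A) (I : Grid N → Set ι) (t : ℕ) (g : Fin (C.gates t)) : Set ι :=
  {i | ∃ w, C.reads t w = g ∧ i ∈ C.wireReach I t w}

/-- Reach is defined by recursion on the layers, light cones by paths in the circuit graph.
Following the recursion backwards yields a path, so reach is bounded by the light cone, which is the
direction needed here. -/
theorem exists_path_of_mem_gateReach (C : Circuit N A) (I : Grid N → Set ι) {i : ι} :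
    ∀ (t : ℕ) (g : Fin (C.gates t)), t < C.depth → i ∈ C.gateReach I t g →
      ∃ u, i ∈ I u ∧ Relation.ReflTransGen C.Edge (.input u) (.gate t g)
  | 0, g, ht, ⟨w, hw, u, hu, hi⟩ => by
    subst hw
    exact ⟨u, hi, .single (.inputGate u w ht hu)⟩
  | t + 1, g, ht, ⟨w, hw, hi⟩ => by
    subst hw
    obtain ⟨u, hu, hpath⟩ := exists_path_of_mem_gateReach C I t (C.writes t w) (by omega) hi
    exact ⟨u, hu, hpath.tail (.gateGate t w ht)⟩

theorem exists_mem_backwardLightcone (C : Circuit N A) (I : Grid N → Set ι) {i : ι} (v : Grid N) :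
    ∀ (t : ℕ) (w : Fin (C.width t)), t = C.depth → (C.target v : ℕ) = w → i ∈ C.wireReach I t w →
      ∃ u, i ∈ I u ∧ u ∈ C.backwardLightcone (.output v)
  | 0, w, ht, hw, ⟨u, hu, hi⟩ => ⟨u, hi, .single (.inputOutput u w v ht.symm hw hu)⟩
  | t + 1, w, ht, hw, hi => by
    obtain ⟨u, hu, hpath⟩ := C.exists_path_of_mem_gateReach I t (C.writes t w) (by omega) hi
    exact ⟨u, hu, hpath.tail (.gateOutput t w v ht hw)⟩

open Classical in
/-- Wires that depend on no label are shared, wires that depend on a single label belong to it, all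
other wires are discarded. -/
noncomputable def reachClass (S : Set ι) : WireClass ι :=
  if S = ∅ then some none else if h : ∃ i, S = {i} then some (some h.choose) else none

theorem reachClass_eq_shared {S : Set ι} : reachClass S = some none ↔ S = ∅ := by
  unfold reachClass
  split_ifs with h1 h2 <;> simp [h1]

theorem reachClass_eq_party {S : Set ι} {i : ι} : reachClass S = some (some i) ↔ S = {i} := by
  unfold reachClass
  split_ifs with h1 h2
  · simp [h1]
  · have := h2.choose_spec
    constructor
    · intro h
      rw [← Option.some.inj (Option.some.inj h)]
      exact this
    · intro h
      rw [Set.singleton_injective (this.symm.trans h)]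
  · simp only [false_iff]
    exact fun h => h2 ⟨i, h⟩

/-- The reach of an input wire is contained in that of its gate. If the latter has at most one
element, the wire is shared or already belongs to the class of the gate. -/
theorem reachClass_mono {S S' : Set ι} (h : S ⊆ S') (hS' : reachClass S' ≠ none) :
    reachClass S = some none ∨ reachClass S = reachClass S' := by
  rcases h' : reachClass S' with _ | _ | i
  · exact absurd h' hS'
  · rw [reachClass_eq_shared] at h' ⊢
    exact .inl (Set.subset_eq_empty h h')
  · rw [reachClass_eq_party] at h'
    rw [reachClass_eq_shared, reachClass_eq_party]
    exact Set.subset_singleton_iff_eq.mp (h' ▸ h)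

variable [Fintype ι] [DecidableEq ι]

/-- The state of each layer is locally prepared. -/
theorem nonempty_localPreparation [Nonempty A] (C : Circuit N A) {Q : ι → Type}
    (input : (∀ i, Q i) → Grid N → A) (I : Grid N → Set ι)
    (hI : ∀ u x x', (∀ i ∈ I u, x i = x' i) → input x u = input x' u) (x₀ : ∀ i, Q i) (t : ℕ) :
    Nonempty (LocalPreparation (fun w => reachClass (C.wireReach I t w))
      (fun i (x x' : ∀ i, Q i) => x i = x' i) (fun x c c' => C.state (input x) t c c')) := by
  induction t with
  | zero =>
    have hw : ∀ w x x', (∀ i ∈ C.wireReach I 0 w, x i = x' i) →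
        Sum.elim (input x) id (C.source w) = Sum.elim (input x') id (C.source w) := by
      intro w x x' h
      rcases hs : C.source w with u | a
      · exact hI u x x' fun i hi => h i ⟨u, hs, hi⟩
      · rfl
    have D := LocalPreparation.ofBasis (fun w => reachClass (C.wireReach I 0 w))
      (fun i (x x' : ∀ i, Q i) => x i = x' i) (fun x w => Sum.elim (input x) id (C.source w))
      (fun w h x x' => hw w x x' fun i hi => by
        rw [reachClass_eq_shared.mp h] at hi
        exact absurd hi (Set.notMem_empty i))
      (fun w p h x x' hp => hw w x x' fun i hi => by
        rw [reachClass_eq_party.mp h] at hi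
        rw [Set.mem_singleton_iff.mp hi]
        exact hp) x₀
    have hσ : (fun (x : ∀ i, Q i) (c c' : Fin (C.width 0) → A) => C.state (input x) 0 c c') =
        fun x c c' => if (fun w => Sum.elim (input x) id (C.source w)) = c ∧
          (fun w => Sum.elim (input x) id (C.source w)) = c' then 1 else 0 := by
      funext x c c'
      rw [state, Matrix.single_apply]
    rw [hσ]
    exact ⟨D⟩
  | succ t ih =>
    obtain ⟨D⟩ := ih
    -- The reach of a wire of layer `t + 1` is by definition that of the gate that writes it, so
    -- these are also the classes of the next layer.
    let gcls : Fin (C.gates t) → WireClass ι := fun g => reachClass (C.gateReach I t g)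
    have hmono : ∀ w, gcls (C.reads t w) ≠ none →
        reachClass (C.wireReach I t w) = some none ∨
          reachClass (C.wireReach I t w) = gcls (C.reads t w) :=
      fun w h => reachClass_mono (fun i hi => ⟨w, rfl, hi⟩) h
    -- First every input of a discarded gate is discarded, whatever its own class. By `hmono` the
    -- remaining wires then have the class of their gate or are shared, and in the latter case they
    -- are handed over.
    let cls₁ : Fin (C.width t) → WireClass ι := fun w =>
      if gcls (C.reads t w) = none then none else reachClass (C.wireReach I t w)
    have D₁ := D.discard cls₁ fun w hw => by
      simp only [cls₁] at hw ⊢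
      split_ifs with h
      · simp [h] at hw
      · rfl
    have D₂ := D₁.handOver (fun w => gcls (C.reads t w)) (fun w => by
      simp only [cls₁]
      split_ifs with h
      · simp [h]
      · rcases hmono w h with h' | h' <;> simp [h, h']) (fun w p hw => by
      simp only [cls₁] at hw
      split_ifs at hw with h
      rcases hmono w h with h' | h'
      · rw [h'] at hw
        cases hw
      · rw [← h', hw])
    have D₃ := LocalPreparation.applyGates (C.reads t) (C.writes t) gcls
      (fun g e b c => C.kraus t g e b c) (fun g => isKraus_of_matrix _ (C.kraus_complete t g)) D₂
    have hσ : (fun (x : ∀ i, Q i) (c c' : Fin (C.width (t + 1)) → A) =>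
        C.state (input x) (t + 1) c c') = fun x c c' => ∑ e : ∀ g, Fin (C.rank t g), ∑ d, ∑ d',
          (∏ g, C.kraus t g (e g) (fun w => c w) (fun w => d w)) * C.state (input x) t d d' *
            star (∏ g, C.kraus t g (e g) (fun w => c' w) (fun w => d' w)) := by
      funext x c c'
      rw [state, Matrix.sum_apply]
      refine Finset.sum_congr rfl fun e _ => ?_
      simp only [Matrix.mul_apply, Finset.sum_mul]
      rw [Finset.sum_comm]
      rfl
    rw [hσ]
    exact ⟨D₃⟩

theorem state_posSemidef (C : Circuit N A) (input : Grid N → A) (t : ℕ) :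
    (C.state input t).PosSemidef := by
  induction t with
  | zero =>
    rw [state, ← Matrix.diagonal_single]
    refine Matrix.PosSemidef.diagonal fun c => ?_
    rw [Pi.single_apply]
    split_ifs <;> simp
  | succ t ih =>
    rw [state]
    exact Matrix.posSemidef_sum _ fun e _ => ih.mul_mul_conjTranspose_same _

theorem outProb_nonneg (C : Circuit N A) (input y : Grid N → A) : 0 ≤ C.outProb input y := by
  unfold outProb
  refine Finset.sum_nonneg fun c _ => ?_
  have := (C.state_posSemidef input C.depth).diag_nonneg (i := c)
  exact (Complex.nonneg_iff.mp this).1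

/-- A layer is a tensor product of channels, so it preserves the trace. -/
theorem trace_state (C : Circuit N A) (input : Grid N → A) (t : ℕ) :
    ∑ c, C.state input t c c = 1 := by
  induction t with
  | zero => simp [state, Matrix.single_apply]
  | succ t ih =>
    have hK : IsKraus fun (e : ∀ g, Fin (C.rank t g)) (c : Fin (C.width (t + 1)) → A)
        (d : Fin (C.width t) → A) =>
        ∏ g, C.kraus t g (e g) (fun w => c w) (fun w => d w) :=
      (IsKraus.tensor fun g => isKraus_of_matrix _ (C.kraus_complete t g)).reindex
        (fiberEquiv (C.writes t) fun _ => A) (fiberEquiv (C.reads t) fun _ => A)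
    have h1 : ∑ c, C.state input (t + 1) c c =
        ∑ d, ∑ d', (∑ e, ∑ c, star (C.layerKraus t e c d') * C.layerKraus t e c d) *
          C.state input t d d' := by
      simp only [state, Matrix.sum_apply, Matrix.mul_apply, Matrix.conjTranspose_apply,
        Finset.sum_mul]
      rw [sum_comm₄]
      refine Finset.sum_congr rfl fun d _ => Finset.sum_congr rfl fun d' _ =>
        Finset.sum_congr rfl fun e _ => Finset.sum_congr rfl fun c _ => ?_
      ring
    rw [h1, ← ih]
    refine Finset.sum_congr rfl fun d _ => ?_
    have h2 : ∀ d d', ∑ e, ∑ c, star (C.layerKraus t e c d') * C.layerKraus t e c d =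
      if d' = d then 1 else 0 := fun d d' => hK d' d
    simp only [h2]
    simp

variable [NeZero N]

/-- Circuits with local dependence of the outputs on the inputs are simulated by entangled
strategies: if the outputs at the vertices in `region i`, from which `dec i` is computed, depend on
no other part of the query than the question of player `i`, then there is a strategy with the
same joint distribution of answers. -/
theorem exists_strategy [Nonempty A] (C : Circuit N A) {Q Ans : ι → Type}
    [∀ i, Fintype (Ans i)] [∀ i, DecidableEq (Ans i)]
    (input : (∀ i, Q i) → Grid N → A) (I : Grid N → Set ι)
    (hI : ∀ u x x', (∀ i ∈ I u, x i = x' i) → input x u = input x' u) (x₀ : ∀ i, Q i)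
    (region : ι → Set (Grid N)) (dec : ∀ i, (Grid N → A) → Ans i)
    (hdec : ∀ i y y', (∀ v ∈ region i, y v = y' v) → dec i y = dec i y')
    (hcone : ∀ i, ∀ v ∈ region i, ∀ u ∈ C.backwardLightcone (.output v), ∀ i' ∈ I u, i' = i) :
    ∃ S : Strategy Q Ans, ∀ x a,
      S.prob x a = ∑ y with ∀ i, dec i y = a i, C.outProb (input x) y := by
  obtain ⟨D⟩ := C.nonempty_localPreparation input I hI x₀ C.depth
  obtain ⟨S, hS⟩ := D.exists_strategy (Ans := Ans) (fun i c => dec i fun v => c (C.target v)) (by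
    intro i c c' h
    refine hdec i _ _ fun v hv => h _ ?_
    -- An output wire in the region of `i` is therefore shared or belongs to `i`; in particular it
    -- was never discarded.
    have hsub : C.wireReach I C.depth (C.target v) ⊆ {i} := by
      intro i' hi'
      obtain ⟨u, hu, huv⟩ := C.exists_mem_backwardLightcone I v _ _ rfl rfl hi'
      exact hcone i v hv u huv i' hu
    rw [reachClass_eq_shared, reachClass_eq_party]
    exact Set.subset_singleton_iff_eq.mp hsub) x₀ (C.trace_state _ _)
  refine ⟨S, fun x a => ?_⟩
  rw [hS, Complex.re_sum]
  unfold outProb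
  rw [← Finset.sum_fiberwise _ (fun c v => c (C.target v))]
  rw [Finset.sum_filter]
  refine Finset.sum_congr rfl fun y _ => ?_
  rw [Finset.filter_filter]
  split_ifs with hy
  · refine Finset.sum_congr (Finset.ext fun c => ?_) fun _ _ => rfl
    simp only [Finset.mem_filter, Finset.mem_univ, true_and]
    constructor
    · rintro ⟨_, h⟩ v
      exact congrFun h v
    · intro h
      obtain rfl : (fun v => c (C.target v)) = y := funext h
      exact ⟨hy, rfl⟩
  · refine Finset.sum_eq_zero fun c hc => ?_
    obtain ⟨_, h, rfl⟩ := Finset.mem_filter.mp hc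
    exact absurd h hy

end Circuit

/-! ### Honest measurements on Pauli-rotated states -/

theorem rootPow_add {d : ℕ} [NeZero d] (a b : ZMod d) :
    rootPow d (a + b) = rootPow d a * rootPow d b :=
  AddChar.map_add_eq_mul _ _ _

theorem rootPow_zero {d : ℕ} [NeZero d] : rootPow d 0 = 1 := AddChar.map_zero_eq_one _

theorem rootPow_sum {d : ℕ} [NeZero d] {α : Type} (s : Finset α) (f : α → ZMod d) :
    rootPow d (∑ i ∈ s, f i) = ∏ i ∈ s, rootPow d (f i) := by
  classical
  induction s using Finset.induction_on with
  | empty => simp [rootPow_zero]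
  | insert a s ha ih => rw [Finset.sum_insert ha, Finset.prod_insert ha, rootPow_add, ih]

theorem rootPow_natCast_mul {d : ℕ} [NeZero d] (t : ℕ) (a : ZMod d) :
    rootPow d (a * t) = rootPow d a ^ t := by
  rw [mul_comm, ← nsmul_eq_mul]
  exact AddChar.map_nsmul_eq_pow _ _ _

theorem conj_rootPow {d : ℕ} [NeZero d] (a : ZMod d) :
    (starRingEnd ℂ) (rootPow d a) = rootPow d (-a) :=
  (AddChar.map_neg_eq_conj _ _).symm

theorem mul_pauli_apply {d : ℕ} [NeZero d] {κ : Type} [Fintype κ] [DecidableEq κ]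
    (M : Matrix (κ → ZMod d) (κ → ZMod d) ℂ) (q : PauliLabel d κ) (f g : κ → ZMod d) :
    (M * pauli q) f g = M f (fun i => g i + (q i).1) * rootPow d (∑ i, (q i).2 * g i) := by
  rw [Matrix.mul_apply, Finset.sum_eq_single (fun i => g i + (q i).1)]
  · rw [pauli_apply, if_pos rfl]
  · intro b _ hb
    rw [pauli_apply, if_neg hb, mul_zero]
  · simp

/-- The factors are passed one at a time and in order, so they need not commute with each other;
`HonestStrategy.proj` can thus be treated for all questions. -/
theorem list_ofFn_prod_mul {R : Type} [Monoid R] (b : R) : ∀ {m : ℕ} (f g : Fin m → R),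
    (∀ s, f s * b = b * g s) → (List.ofFn f).prod * b = b * (List.ofFn g).prod
  | 0, _, _, _ => by simp
  | m + 1, f, g, h => by
    rw [List.ofFn_succ, List.ofFn_succ, List.prod_cons, List.prod_cons, mul_assoc,
      list_ofFn_prod_mul b _ _ fun s => h s.succ, ← mul_assoc, h, mul_assoc]

/-- Each of the `t` factors contributes one commutator phase `ω ^ cor r q`. -/
theorem pow_mul_pauli {d : ℕ} [NeZero d] {κ : Type} [Fintype κ] [DecidableEq κ] (z : ℂ)
    (q r : PauliLabel d κ) (t : ℕ) :
    (z • pauli q) ^ t * pauli r = rootPow d (cor r q * t) • (pauli r * (z • pauli q) ^ t) := by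
  have h1 : z • pauli q * pauli r = rootPow d (cor r q) • (pauli r * (z • pauli q)) := by
    rw [Matrix.smul_mul, pauli_commutator, Matrix.mul_smul, smul_comm]
  rw [rootPow_natCast_mul]
  induction t with
  | zero => simp
  | succ t ih =>
    rw [pow_succ, Matrix.mul_assoc, h1, Matrix.mul_smul, ← Matrix.mul_assoc, ih, Matrix.smul_mul,
      smul_smul, Matrix.mul_assoc, pow_succ']

namespace HonestStrategy

variable {ℓ d : ℕ} [NeZero d] {κ : Fin ℓ → Type} [∀ j, Fintype (κ j)] [∀ j, DecidableEq (κ j)]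
  {m : Fin ℓ → ℕ} {G : StabilizerGame ℓ d κ m}

/-- Conjugating the honest measurement by a Pauli operator shifts the answers by the correction
values. -/
theorem proj_mul_pauli (S : HonestStrategy G) (j : Fin ℓ) (x : G.Question j)
    (a : Fin (m j) → ZMod d) (r : PauliLabel d (κ j)) :
    S.proj j x a * pauli r =
      pauli r * S.proj j x (fun s => a s - cor r (x s : PauliLabel d (κ j))) := by
  refine list_ofFn_prod_mul _ _ _ fun s => ?_
  rw [Matrix.smul_mul, Matrix.mul_smul, Matrix.sum_mul, Matrix.mul_sum]
  congr 1
  refine Finset.sum_congr rfl fun t _ => ?_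
  -- The phase `ω ^ (t cor)` merges with `ω ^ (-a t)`, which replaces `a` by `a - cor`.
  rw [Matrix.smul_mul, pow_mul_pauli, smul_smul, ← rootPow_add, Matrix.mul_smul]
  congr 2
  ring

/-- If the answers `a`, corrected by the rotation strings `r`, lose, then the projections for `a`
annihilate the state rotated by `r`. -/
theorem sum_proj_mul_pauli_eq_zero (S : HonestStrategy G) (hS : S.Perfect) {x : G.Query}
    (hx : x ∈ G.dist.support) (a : ∀ j, Fin (m j) → ZMod d) (r : ∀ j, PauliLabel d (κ j))
    (hlose : ¬ G.Wins x fun j s => a j s - cor (r j) (x j s : PauliLabel d (κ j)))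
    (f : ∀ j, κ j → ZMod d) :
    ∑ g : ∀ j, κ j → ZMod d, (∏ j, (S.proj j (x j) (a j) * pauli (r j)) (f j) (g j)) * S.ψ g = 0 := by
  have h0 := hS x hx _ hlose
  unfold prob at h0
  rw [Finset.sum_eq_zero_iff_of_nonneg fun c _ => by positivity] at h0
  -- The probability is a sum of squared norms, so each amplitude vanishes.
  have h1 : ∀ c : ∀ j, κ j → ZMod d, ∑ g, (∏ j, S.proj j (x j)
      (fun s => a j s - cor (r j) (x j s : PauliLabel d (κ j))) (c j) (g j)) * S.ψ g = 0 := by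
    intro c
    have := h0 c (Finset.mem_univ c)
    simpa using this
  have h2 : ∀ g : ∀ j, κ j → ZMod d, ∏ j, (S.proj j (x j) (a j) * pauli (r j)) (f j) (g j) =
      ∑ c : ∀ j, κ j → ZMod d, (∏ j, pauli (r j) (f j) (c j)) * ∏ j, S.proj j (x j)
        (fun s => a j s - cor (r j) (x j s : PauliLabel d (κ j))) (c j) (g j) := by
    intro g
    simp only [proj_mul_pauli]
    simp only [Matrix.mul_apply, ← Finset.prod_mul_distrib]
    rw [Finset.prod_univ_sum, Fintype.piFinset_univ]
  simp only [h2, Finset.sum_mul, mul_assoc]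
  rw [Finset.sum_comm]
  refine Finset.sum_eq_zero fun c _ => ?_
  rw [← Finset.mul_sum, h1, mul_zero]

/-- A translated form of `sum_proj_mul_pauli_eq_zero`. -/
theorem sum_proj_translate_eq_zero (S : HonestStrategy G) (hS : S.Perfect) {x : G.Query}
    (hx : x ∈ G.dist.support) (a : ∀ j, Fin (m j) → ZMod d) (r : ∀ j, PauliLabel d (κ j))
    (hlose : ¬ G.Wins x fun j s => a j s - cor (r j) (x j s : PauliLabel d (κ j)))
    (f g : ∀ j, κ j → ZMod d) :
    ∑ h : ∀ j, κ j → ZMod d, (∏ j, rootPow d (∑ s, (r j s).2 * h j s) *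
      S.proj j (x j) (a j) (f j) (fun s => g j s + (r j s).1 + h j s)) *
        S.ψ (fun j s => g j s + h j s) = 0 := by
  have h1 := S.sum_proj_mul_pauli_eq_zero hS hx a r hlose f
  -- Substituting `g + h` for the summation variable leaves a phase that depends on `g` alone and
  -- can be divided out.
  rw [← Equiv.sum_comp (Equiv.addLeft g)] at h1
  have h2 : ∀ h : ∀ j, κ j → ZMod d,
      (∏ j, (S.proj j (x j) (a j) * pauli (r j)) (f j) (Equiv.addLeft g h j)) *
        S.ψ (Equiv.addLeft g h) = (∏ j, rootPow d (∑ s, (r j s).2 * g j s)) *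
      ((∏ j, rootPow d (∑ s, (r j s).2 * h j s) *
        S.proj j (x j) (a j) (f j) (fun s => g j s + (r j s).1 + h j s)) *
        S.ψ (fun j s => g j s + h j s)) := by
    intro h
    rw [← mul_assoc, ← Finset.prod_mul_distrib]
    congr 1
    refine Finset.prod_congr rfl fun j _ => ?_
    rw [mul_pauli_apply, ← mul_assoc, ← rootPow_add, ← Finset.sum_add_distrib, mul_comm]
    congr 2
    · refine Finset.sum_congr rfl fun s _ => ?_
      simp only [Equiv.coe_addLeft, Pi.add_apply]
      ring
    · funext s
      simp only [Equiv.coe_addLeft, Pi.add_apply]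
      ring
  simp only [h2, ← Finset.mul_sum] at h1
  refine (mul_eq_zero.mp h1).resolve_left ?_
  refine Finset.prod_ne_zero_iff.mpr fun j _ => ?_
  exact ((ZMod.stdAddChar (N := d)).val_isUnit _).ne_zero

end HonestStrategy

/-- Bell states are eigenvectors of equal shifts of both qudits, so a translation only produces a
phase. -/
theorem CircuitGame.bellAmp_add {d : ℕ} [NeZero d] (o : ZMod d × ZMod d) (a b h : ZMod d) :
    bellAmp o (a + h) (b + h) = rootPow d (o.2 * h) * bellAmp o a b := by
  unfold CircuitGame.bellAmp
  have : b + h = a + h + o.1 ↔ b = a + o.1 := by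
    rw [add_right_comm, add_left_inj]
  simp only [this]
  split_ifs
  · rw [mul_add, rootPow_add]
    ring
  · simp

/-! ### Translations of the computational basis along a route -/

namespace Dir

theorem opp_opp (e : Dir) : e.opp.opp = e := by cases e <;> rfl

theorem move_opp_move {N : ℕ} (e : Dir) (v : Grid N) : e.opp.move (e.move v) = v := by
  cases e <;> simp [move, opp]

end Dir

namespace Wiring

variable {N r ℓ : ℕ} {P : InputPattern N r ℓ} (W : Wiring P)

theorem inDir_zero (i : Fin r) (j : Fin ℓ) : W.inDir i j 0 = W.share i j := rfl

theorem inDir_succ (i : Fin r) (j : Fin ℓ) (t : Fin (W.route i j).len) :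
    W.inDir i j t.succ = ((W.route i j).dir t).opp := rfl

/-- The group of qudits at `v` that faces `e` is used by the `j`-th route of the `i`-th star. -/
def OnRoute (i : Fin r) (j : Fin ℓ) (v : Grid N) (e : Dir) : Prop :=
  (∃ t, v = (W.route i j).pt t ∧ e = W.inDir i j t) ∨
    ∃ t : Fin (W.route i j).len, v = (W.route i j).pt t.castSucc ∧ e = (W.route i j).dir t

/-- All routes of all stars are vertex-disjoint. -/
def RoutesDisjoint : Prop :=
  ∀ i j i' j' t t', (W.route i j).pt t = (W.route i' j').pt t' → i = i' ∧ j = j'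

variable {W}

theorem OnRoute.exists_pt {i : Fin r} {j : Fin ℓ} {v : Grid N} {e : Dir} (h : W.OnRoute i j v e) :
    ∃ t, v = (W.route i j).pt t := by
  rcases h with ⟨t, h, _⟩ | ⟨t, h, _⟩
  exacts [⟨t, h⟩, ⟨_, h⟩]

/-- Shares sit only at first vertices of routes, and there `share_ne` keeps the outgoing direction
free. -/
theorem not_isShare_out (hW : W.RoutesDisjoint) (i : Fin r) (j : Fin ℓ)
    (t : Fin (W.route i j).len) :
    ¬ CircuitGame.IsShare W ((W.route i j).pt t.castSucc) ((W.route i j).dir t) := by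
  rintro ⟨i', j', hv, he⟩
  obtain ⟨rfl, rfl⟩ := hW _ _ _ _ _ _ hv
  have := congrArg Fin.val ((W.route i j).simple hv)
  exact W.share_ne i j t this he.symm

theorem not_isShare_in (hW : W.RoutesDisjoint) (i : Fin r) (j : Fin ℓ)
    (t : Fin (W.route i j).len) (e : Dir) :
    ¬ CircuitGame.IsShare W ((W.route i j).pt t.succ) e := by
  rintro ⟨i', j', hv, -⟩
  obtain ⟨rfl, rfl⟩ := hW _ _ _ _ _ _ hv
  exact Fin.succ_ne_zero t ((W.route i j).simple hv)

/-- The two groups of an edge of a route. -/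
theorem OnRoute.opp (hW : W.RoutesDisjoint) {i : Fin r} {j : Fin ℓ} {v : Grid N} {e : Dir}
    (h : W.OnRoute i j v e) (hs : ¬ CircuitGame.IsShare W v e) :
    W.OnRoute i j (e.move v) e.opp ∧ ¬ CircuitGame.IsShare W (e.move v) e.opp := by
  rcases h with ⟨t, rfl, rfl⟩ | ⟨t, rfl, rfl⟩
  · induction t using Fin.cases with
    | zero => exact absurd ⟨i, j, rfl, rfl⟩ hs
    | succ t =>
      rw [inDir_succ, (W.route i j).step, Dir.move_opp_move, Dir.opp_opp]
      exact ⟨.inr ⟨t, rfl, rfl⟩, not_isShare_out hW i j t⟩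
  · rw [← (W.route i j).step]
    exact ⟨.inl ⟨t.succ, rfl, rfl⟩, not_isShare_in hW i j t _⟩

variable (W)

open Classical in
/-- The translation of the computational basis by `h j` in all groups of qudits that are used by the
`j`-th route of the `i`-th star. -/
noncomputable def routeShift {d : ℕ} {k : Fin ℓ → ℕ} (i : Fin r)
    (h : ∀ _ : Fin ℓ, Fin (maxQudits k) → ZMod d) (q : CircuitGame.Qudit N k) : ZMod d :=
  ∑ j, if W.OnRoute i j q.1 q.2.1 then h j q.2.2 else 0

variable {W} {d : ℕ} {k : Fin ℓ → ℕ}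

theorem routeShift_of_onRoute (hW : W.RoutesDisjoint) {i : Fin r} {j : Fin ℓ}
    (h : ∀ _ : Fin ℓ, Fin (maxQudits k) → ZMod d) {v : Grid N} {e : Dir}
    (hv : W.OnRoute i j v e) (s : Fin (maxQudits k)) : W.routeShift i h (v, e, s) = h j s := by
  unfold routeShift
  rw [Finset.sum_eq_single j, if_pos hv]
  · intro j' _ hj'
    rw [if_neg]
    intro hv'
    obtain ⟨t, ht⟩ := hv.exists_pt
    obtain ⟨t', ht'⟩ := hv'.exists_pt
    exact hj' (hW _ _ _ _ _ _ (ht'.symm.trans ht)).2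
  · simp

theorem routeShift_of_not {i : Fin r}
    (h : ∀ _ : Fin ℓ, Fin (maxQudits k) → ZMod d) {v : Grid N} {e : Dir}
    (hv : ∀ j, ¬ W.OnRoute i j v e) (s : Fin (maxQudits k)) : W.routeShift i h (v, e, s) = 0 :=
  Finset.sum_eq_zero fun j _ => if_neg (hv j)

theorem routeShift_of_ne (hW : W.RoutesDisjoint) {i i' : Fin r} (hi : i' ≠ i)
    (h : ∀ _ : Fin ℓ, Fin (maxQudits k) → ZMod d) (j' : Fin ℓ) (t : Fin ((W.route i' j').len + 1))
    (e : Dir) (s : Fin (maxQudits k)) :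
    W.routeShift i h ((W.route i' j').pt t, e, s) = 0 := by
  refine routeShift_of_not h (fun j hv => ?_) s
  obtain ⟨t', ht'⟩ := hv.exists_pt
  exact hi (hW _ _ _ _ _ _ ht').1

/-- By `OnRoute.opp`, both ends of an entangled link are translated by the same amount, possibly
zero. A group in the state `|0⟩` faces a share, hence is not on a route and is not translated.
Groups that hold shares do not occur in the link amplitudes. -/
theorem linkAmp_add_routeShift [NeZero d] [NeZero N] (hW : W.RoutesDisjoint) (i : Fin r)
    (h : ∀ _ : Fin ℓ, Fin (maxQudits k) → ZMod d) (c : CircuitGame.Qudit N k → ZMod d)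
    (v : Grid N) (e : Dir) :
    CircuitGame.linkAmp W (c + W.routeShift i h) v e = CircuitGame.linkAmp W c v e := by
  have hback : ∀ j, W.OnRoute i j (e.move v) e.opp → ¬ CircuitGame.IsShare W (e.move v) e.opp →
      W.OnRoute i j v e ∧ ¬ CircuitGame.IsShare W v e := by
    intro j h1 h2
    have := h1.opp hW h2
    rwa [Dir.move_opp_move, Dir.opp_opp] at this
  unfold CircuitGame.linkAmp
  by_cases h1 : CircuitGame.IsShare W v e
  · simp only [if_pos h1]
    by_cases h2 : CircuitGame.IsShare W (e.move v) e.opp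
    · simp only [if_pos h2]
    · simp only [if_neg h2, Pi.add_apply]
      have : ∀ s, W.routeShift i h (e.move v, e.opp, s) = 0 :=
        routeShift_of_not h fun j hj => (hback j hj h2).2 h1
      simp only [this, add_zero]
  · simp only [if_neg h1]
    by_cases h2 : CircuitGame.IsShare W (e.move v) e.opp
    · simp only [if_pos h2, Pi.add_apply]
      have : ∀ s, W.routeShift i h (v, e, s) = 0 :=
        routeShift_of_not h fun j hj => (hj.opp hW h1).2 h2
      simp only [this, add_zero]
    · simp only [if_neg h2, Pi.add_apply]
      have : ∀ s, W.routeShift i h (e.move v, e.opp, s) = W.routeShift i h (v, e, s) := by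
        intro s
        unfold routeShift
        refine Finset.sum_congr rfl fun j _ => ?_
        by_cases h' : W.OnRoute i j v e
        · rw [if_pos h', if_pos (h'.opp hW h1).1]
        · rw [if_neg h', if_neg fun h'' => h' (hback j h'' h2).1]
      simp only [this, add_left_inj]

end Wiring

namespace CircuitGame

variable {ℓ d : ℕ} {k m : Fin ℓ → ℕ} {N r L : ℕ} {A : Type}

/-- Extension by zero to `k` qudits. -/
def padZero (k : Fin ℓ → ℕ) (h : ∀ j, Fin (k j) → ZMod d) (j : Fin ℓ) (s : Fin (maxQudits k)) :
    ZMod d :=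
  if hs : (s : ℕ) < k j then h j ⟨s, hs⟩ else 0

theorem padZero_castLE (h : ∀ j, Fin (k j) → ZMod d) (j : Fin ℓ) (s : Fin (k j)) :
    padZero k h j (Fin.castLE (le_maxQudits k j) s) = h j s := by
  simp [padZero]

theorem sum_mul_padZero (h : ∀ j, Fin (k j) → ZMod d) (j : Fin ℓ) (f : Fin (maxQudits k) → ZMod d) :
    ∑ s, f s * padZero k h j s = ∑ s : Fin (k j), f (Fin.castLE (le_maxQudits k j) s) * h j s := by
  rw [← Finset.sum_subset (Finset.subset_univ
    (Finset.univ.map (Fin.castLEEmb (le_maxQudits k j)))), Finset.sum_map]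
  · refine Finset.sum_congr rfl fun s _ => ?_
    rw [Fin.coe_castLEEmb, padZero_castLE]
  · intro s _ hs
    have : ¬ (s : ℕ) < k j := by
      intro h'
      exact hs (Finset.mem_map.mpr ⟨⟨s, h'⟩, Finset.mem_univ _, rfl⟩)
    simp [padZero, this]

variable [NeZero d] (𝒢 : CircuitGame ℓ d k m N r L A) {P : InputPattern N r ℓ}

/-- At the last vertex only the first `k j` qudits of the incoming group are measured. This is why
the translation is padded by zero: it must not move qudits on which the ideal projection is the
identity. -/
theorem routeShift_of_not_measured (hW : (𝒢.wiring P).RoutesDisjoint) (i : Fin r)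
    (h : ∀ j, Fin (k j) → ZMod d) {q : Qudit N k} (hq : ¬ 𝒢.Measured P q) :
    (𝒢.wiring P).routeShift i (padZero k h) q = 0 := by
  obtain ⟨v, e, s⟩ := q
  by_cases hv : ∃ j, (𝒢.wiring P).OnRoute i j v e
  · obtain ⟨j, hv⟩ := hv
    rw [Wiring.routeShift_of_onRoute hW _ hv]
    unfold padZero
    split_ifs with hs
    · refine absurd ⟨i, j, ?_⟩ hq
      rcases hv with ⟨t, rfl, rfl⟩ | ⟨t, rfl, rfl⟩
      · induction t using Fin.lastCases with
        | last =>
          right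
          exact ⟨⟨s, hs⟩, by rw [(𝒢.wiring P).route_end]; rfl⟩
        | cast t => exact .inl ⟨t, s, .inl rfl⟩
      · exact .inl ⟨t, s, .inr rfl⟩
    · rfl
  · push Not at hv
    exact Wiring.routeShift_of_not _ hv s

end CircuitGame

theorem Fin.eq_add_sum_of_succ {G : Type} [AddCommMonoid G] : ∀ {n : ℕ} (u : Fin (n + 1) → G)
    (w : Fin n → G), (∀ t, u t.succ = u t.castSucc + w t) → u (Fin.last n) = u 0 + ∑ t, w t
  | 0, u, w, _ => by simp
  | n + 1, u, w, h => by
    have ih := Fin.eq_add_sum_of_succ (fun t => u t.castSucc) (fun t => w t.castSucc)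
      fun t => by rw [← h, Fin.succ_castSucc]
    rw [Fin.sum_univ_castSucc, ← add_assoc, ← Fin.succ_last, h, ih, Fin.castSucc_zero]

/-- Every translate of `T` has the same total, so the double sum is `Fintype.card H` times this
total. It thus suffices to find cancellation within the family of translates of each single point.
-/
theorem sum_eq_zero_of_sum_translates {G H R : Type} [AddCommGroup G] [Fintype G] [Fintype H]
    [Nonempty H] [Field R] [CharZero R] (T : G → R) (τ : H → G)
    (h : ∀ c, ∑ x, T (c + τ x) = 0) : ∑ c, T c = 0 := by
  have h1 : ∑ x : H, ∑ c, T (c + τ x) = 0 := by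
    rw [Finset.sum_comm]
    exact Finset.sum_eq_zero fun c _ => h c
  have h2 : ∀ x : H, ∑ c, T (c + τ x) = ∑ c, T c := fun x => Equiv.sum_comp (Equiv.addRight (τ x)) T
  simp only [h2, Finset.sum_const, Finset.card_univ, nsmul_eq_mul] at h1
  exact (mul_eq_zero.mp h1).resolve_left (by exact_mod_cast Fintype.card_ne_zero)

/-! ### Outcomes of the ideal circuit win the rotated game -/

namespace CircuitGame

variable {ℓ d : ℕ} {k m : Fin ℓ → ℕ} {N r L : ℕ} {A : Type}

theorem eq_of_linkAmp_ne_zero [NeZero N] {P : InputPattern N r ℓ} {W : Wiring P}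
    {c : Qudit N k → ZMod d} {v : Grid N} {e : Dir} (h : linkAmp W c v e ≠ 0)
    (h1 : ¬ IsShare W v e) (h2 : ¬ IsShare W (e.move v) e.opp) (s : Fin (maxQudits k)) :
    c (v, e, s) = c (e.move v, e.opp, s) := by
  unfold linkAmp at h
  rw [if_neg h1, if_neg h2, Finset.prod_ne_zero_iff] at h
  by_contra hne
  exact h s (Finset.mem_univ s) (if_neg hne)

/-- The two groups of an edge that do not hold shares are in the same basis state. -/
theorem eq_of_prod_linkAmp_ne_zero [NeZero N] {P : InputPattern N r ℓ} {W : Wiring P}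
    {c : Qudit N k → ZMod d} (h : ∏ v, linkAmp W c v .right * linkAmp W c v .up ≠ 0)
    {v : Grid N} {e : Dir}
    (h1 : ¬ IsShare W v e) (h2 : ¬ IsShare W (e.move v) e.opp) (s : Fin (maxQudits k)) :
    c (v, e, s) = c (e.move v, e.opp, s) := by
  rw [Finset.prod_ne_zero_iff] at h
  have h3 := fun v => mul_ne_zero_iff.mp (h v (Finset.mem_univ v))
  have hm : (e.opp).move (e.move v) = v := Dir.move_opp_move e v
  cases e with
  | right => exact eq_of_linkAmp_ne_zero (h3 v).1 h1 h2 s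
  | up => exact eq_of_linkAmp_ne_zero (h3 v).2 h1 h2 s
  -- The product over `.right` and `.up` contains each link once, so the other two directions are
  -- read off at the opposite end.
  | left =>
    change Dir.right.move (Dir.left.move v) = v at hm
    have := eq_of_linkAmp_ne_zero (h3 (Dir.move .left v)).1 h2
      (by rw [hm]; exact h1) s
    rw [hm] at this
    exact this.symm
  | down =>
    change Dir.up.move (Dir.down.move v) = v at hm
    have := eq_of_linkAmp_ne_zero (h3 (Dir.move .down v)).2 h2
      (by rw [hm]; exact h1) s
    rw [hm] at this
    exact this.symm

variable [NeZero d]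

theorem eq_add_of_bellAmp_ne_zero {o : ZMod d × ZMod d} {a b : ZMod d} (h : bellAmp o a b ≠ 0) :
    b = a + o.1 := by
  by_contra hne
  exact h (if_neg hne)

variable (𝒢 : CircuitGame ℓ d k m N r L A) {P : InputPattern N r ℓ}

/-- The rotation of the qudits of player `j` that results from the teleportation along the `j`-th
route, for the outcomes `o`. -/
def routeRotation (o : 𝒢.IdealOutcome P) (i : Fin r) (j : Fin ℓ) : PauliLabel d (Fin (k j)) :=
  fun s => (∑ t, ((o i j).1 t (Fin.castLE (le_maxQudits k j) s)).1,
    -∑ t, ((o i j).1 t (Fin.castLE (le_maxQudits k j) s)).2)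

/-- A telescoping argument: a nonzero Bell amplitude raises the basis value by the first component
of the outcome within a vertex, and a nonzero link amplitude carries the value unchanged to the next
vertex. -/
theorem route_teleport [NeZero N] (hW : (𝒢.wiring P).RoutesDisjoint) (o : 𝒢.IdealOutcome P)
    {c : Qudit N k → ZMod d}
    (hc : ∏ v, linkAmp (𝒢.wiring P) c v .right * linkAmp (𝒢.wiring P) c v .up ≠ 0)
    (i : Fin r) (j : Fin ℓ)
    (hb : ∀ t s, bellAmp ((o i j).1 t s)
      (c (((𝒢.wiring P).route i j).pt t.castSucc, (𝒢.wiring P).inDir i j t.castSucc, s))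
      (c (((𝒢.wiring P).route i j).pt t.castSucc, ((𝒢.wiring P).route i j).dir t, s)) ≠ 0)
    (s : Fin (k j)) :
    c (P.loc i j, (𝒢.wiring P).inDir i j (Fin.last _), Fin.castLE (le_maxQudits k j) s) =
      c (((𝒢.wiring P).route i j).pt 0, (𝒢.wiring P).share i j,
        Fin.castLE (le_maxQudits k j) s) + (𝒢.routeRotation o i j s).1 := by
  rw [← (𝒢.wiring P).route_end]
  refine Fin.eq_add_sum_of_succ (fun t => c (((𝒢.wiring P).route i j).pt t,
    (𝒢.wiring P).inDir i j t, Fin.castLE (le_maxQudits k j) s)) _ fun t => ?_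
  rw [← eq_add_of_bellAmp_ne_zero (hb t _), eq_of_prod_linkAmp_ne_zero hc
    (Wiring.not_isShare_out hW i j t), ((𝒢.wiring P).route i j).step, Wiring.inDir_succ]
  rw [← ((𝒢.wiring P).route i j).step]
  exact Wiring.not_isShare_in hW i j t _

theorem paddedψ_add_padZero (c : Fin ℓ → Fin (maxQudits k) → ZMod d) (h : ∀ j, Fin (k j) → ZMod d) :
    𝒢.paddedψ (fun j s => c j s + padZero k h j s) =
      (∏ j, ∏ s : Fin (maxQudits k), if (s : ℕ) < k j ∨ c j s = 0 then 1 else 0) *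
        𝒢.honest.ψ fun j s => c j (Fin.castLE (le_maxQudits k j) s) + h j s := by
  unfold paddedψ
  rw [mul_comm]
  congr 1
  · refine Finset.prod_congr rfl fun j _ => Finset.prod_congr rfl fun s _ => ?_
    by_cases hs : (s : ℕ) < k j
    · simp [hs]
    · simp [hs, padZero]
  · simp only [padZero_castLE]

/-- Links are invariant, and the copies of `ψ` for other stars lie on other routes; only the `i`-th
copy is translated. The condition on `K` makes `route_teleport` applicable whenever the term does
not vanish. -/
theorem idealState_add_routeShift [NeZero N] (hW : (𝒢.wiring P).RoutesDisjoint) (i : Fin r)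
    (c : Qudit N k → ZMod d) :
    ∃ K : ℂ, (K ≠ 0 → ∏ v, linkAmp (𝒢.wiring P) c v .right * linkAmp (𝒢.wiring P) c v .up ≠ 0) ∧
      ∀ h : ∀ j, Fin (k j) → ZMod d,
        𝒢.idealState P (c + (𝒢.wiring P).routeShift i (padZero k h)) =
          K * 𝒢.honest.ψ fun j s => c (((𝒢.wiring P).route i j).pt 0, (𝒢.wiring P).share i j,
            Fin.castLE (le_maxQudits k j) s) + h j s := by
  refine ⟨(∏ v, linkAmp (𝒢.wiring P) c v .right * linkAmp (𝒢.wiring P) c v .up) *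
    ((∏ i' ∈ Finset.univ.erase i, 𝒢.paddedψ fun j s =>
      c (((𝒢.wiring P).route i' j).pt 0, (𝒢.wiring P).share i' j, s)) *
      ∏ j, ∏ s : Fin (maxQudits k), if (s : ℕ) < k j ∨
        c (((𝒢.wiring P).route i j).pt 0, (𝒢.wiring P).share i j, s) = 0 then 1 else 0),
    fun h => (mul_ne_zero_iff.mp h).1, fun h => ?_⟩
  unfold idealState
  rw [mul_assoc, mul_assoc]
  congr 1
  · simp only [Wiring.linkAmp_add_routeShift hW]
  · rw [← Finset.mul_prod_erase _ _ (Finset.mem_univ i), mul_comm]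
    congr 1
    · refine Finset.prod_congr rfl fun i' hi' => ?_
      simp only [Pi.add_apply, Wiring.routeShift_of_ne hW (Finset.ne_of_mem_erase hi'), add_zero]
    · rw [← paddedψ_add_padZero]
      congr 1
      funext j s
      rw [Pi.add_apply, ← Wiring.inDir_zero,
        Wiring.routeShift_of_onRoute hW _ (.inl ⟨0, rfl, rfl⟩)]

/-- Only the column argument is translated. Its Bell amplitudes contribute the phase of the `Z`-part
of the rotation, the honest measurements of star `i` see a translated argument, and all else is
absorbed in `K`. -/
theorem idealProj_add_routeShift (hW : (𝒢.wiring P).RoutesDisjoint) (x : 𝒢.Queries)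
    (o : 𝒢.IdealOutcome P) (i : Fin r) (c₀ c : Qudit N k → ZMod d) :
    ∃ K : ℂ, (K ≠ 0 → ∀ j t s, bellAmp ((o i j).1 t s)
        (c (((𝒢.wiring P).route i j).pt t.castSucc, (𝒢.wiring P).inDir i j t.castSucc, s))
        (c (((𝒢.wiring P).route i j).pt t.castSucc, ((𝒢.wiring P).route i j).dir t, s)) ≠ 0) ∧
      ∀ h : ∀ j, Fin (k j) → ZMod d,
        𝒢.idealProj P x o c₀ (c + (𝒢.wiring P).routeShift i (padZero k h)) =
          K * ∏ j, (rootPow d (∑ s, (𝒢.routeRotation o i j s).2 * h j s) *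
            𝒢.honest.proj j (x i j) (o i j).2
              (fun s => c₀ (P.loc i j, (𝒢.wiring P).inDir i j (Fin.last _),
                Fin.castLE (le_maxQudits k j) s))
              (fun s => c (P.loc i j, (𝒢.wiring P).inDir i j (Fin.last _),
                Fin.castLE (le_maxQudits k j) s) + h j s)) := by
  classical
  let B : Fin r → Fin ℓ → (Qudit N k → ZMod d) → ℂ := fun i' j c =>
    ∏ t : Fin ((𝒢.wiring P).route i' j).len, ∏ s : Fin (maxQudits k),
      bellAmp ((o i' j).1 t s)
          (c₀ (((𝒢.wiring P).route i' j).pt t.castSucc, (𝒢.wiring P).inDir i' j t.castSucc, s))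
          (c₀ (((𝒢.wiring P).route i' j).pt t.castSucc, ((𝒢.wiring P).route i' j).dir t, s)) *
        (starRingEnd ℂ) (bellAmp ((o i' j).1 t s)
          (c (((𝒢.wiring P).route i' j).pt t.castSucc, (𝒢.wiring P).inDir i' j t.castSucc, s))
          (c (((𝒢.wiring P).route i' j).pt t.castSucc, ((𝒢.wiring P).route i' j).dir t, s)))
  let M : Fin r → Fin ℓ → (Qudit N k → ZMod d) → ℂ := fun i' j c =>
    𝒢.honest.proj j (x i' j) (o i' j).2
      (fun s => c₀ (P.loc i' j, (𝒢.wiring P).inDir i' j (Fin.last _),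
        Fin.castLE (le_maxQudits k j) s))
      (fun s => c (P.loc i' j, (𝒢.wiring P).inDir i' j (Fin.last _),
        Fin.castLE (le_maxQudits k j) s))
  have hproj : ∀ c, 𝒢.idealProj P x o c₀ c = (∏ i', ∏ j, B i' j c * M i' j c) *
      if ∀ q, 𝒢.Measured P q ∨ c₀ q = c q then 1 else 0 := by
    intro c
    unfold idealProj
    congr
  have hne : ∀ (h : ∀ j, Fin (k j) → ZMod d) (i' : Fin r), i' ≠ i → ∀ j,
      B i' j (c + (𝒢.wiring P).routeShift i (padZero k h)) * M i' j
        (c + (𝒢.wiring P).routeShift i (padZero k h)) = B i' j c * M i' j c := by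
    intro h i' hi' j
    simp only [B, M, Pi.add_apply, Wiring.routeShift_of_ne hW hi', add_zero,
      ← (𝒢.wiring P).route_end]
  have hB : ∀ (h : ∀ j, Fin (k j) → ZMod d) j,
      B i j (c + (𝒢.wiring P).routeShift i (padZero k h)) =
        B i j c * rootPow d (∑ s, (𝒢.routeRotation o i j s).2 * h j s) := by
    intro h j
    have h1 : ∀ (t : Fin ((𝒢.wiring P).route i j).len) s, (𝒢.wiring P).routeShift i (padZero k h)
        (((𝒢.wiring P).route i j).pt t.castSucc, (𝒢.wiring P).inDir i j t.castSucc, s) =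
        padZero k h j s := fun t s =>
      Wiring.routeShift_of_onRoute hW _ (.inl ⟨t.castSucc, rfl, rfl⟩) s
    have h2 : ∀ (t : Fin ((𝒢.wiring P).route i j).len) s, (𝒢.wiring P).routeShift i (padZero k h)
        (((𝒢.wiring P).route i j).pt t.castSucc, ((𝒢.wiring P).route i j).dir t, s) =
        padZero k h j s := fun t s =>
      Wiring.routeShift_of_onRoute hW _ (.inr ⟨t, rfl, rfl⟩) s
    -- The minus sign in the `Z`-part of the rotation comes from the complex conjugate of the Bell
    -- amplitude of the column argument.
    have h3 : ∑ s, (𝒢.routeRotation o i j s).2 * h j s =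
        ∑ t, ∑ s, -(((o i j).1 t s).2 * padZero k h j s) := by
      rw [Finset.sum_comm]
      simp only [← neg_mul, ← Finset.sum_mul, Finset.sum_neg_distrib]
      rw [sum_mul_padZero]
      rfl
    simp only [B, Pi.add_apply, h1, h2, bellAmp_add, map_mul, conj_rootPow]
    rw [h3]
    simp only [rootPow_sum, ← Finset.prod_mul_distrib]
    refine Finset.prod_congr rfl fun t _ => Finset.prod_congr rfl fun s _ => ?_
    ring
  have hM : ∀ (h : ∀ j, Fin (k j) → ZMod d) j,
      M i j (c + (𝒢.wiring P).routeShift i (padZero k h)) =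
        𝒢.honest.proj j (x i j) (o i j).2
              (fun s => c₀ (P.loc i j, (𝒢.wiring P).inDir i j (Fin.last _),
                Fin.castLE (le_maxQudits k j) s))
              (fun s => c (P.loc i j, (𝒢.wiring P).inDir i j (Fin.last _),
                Fin.castLE (le_maxQudits k j) s) + h j s) := by
    intro h j
    simp only [M, Pi.add_apply]
    congr 1
    funext s
    rw [Wiring.routeShift_of_onRoute hW _
      (.inl ⟨Fin.last _, ((𝒢.wiring P).route_end i j).symm, rfl⟩), padZero_castLE]
  refine ⟨(∏ i' ∈ Finset.univ.erase i, ∏ j, B i' j c * M i' j c) * (∏ j, B i j c) *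
    if ∀ q, 𝒢.Measured P q ∨ c₀ q = c q then 1 else 0, fun hK j t s => ?_, fun h => ?_⟩
  · have h1 := Finset.prod_ne_zero_iff.mp (right_ne_zero_of_mul (left_ne_zero_of_mul hK)) j
      (Finset.mem_univ j)
    have h2 := Finset.prod_ne_zero_iff.mp (Finset.prod_ne_zero_iff.mp h1 t (Finset.mem_univ t)) s
      (Finset.mem_univ s)
    exact (map_ne_zero _).mp (right_ne_zero_of_mul h2)
  · have hδ : (∀ q, 𝒢.Measured P q ∨ c₀ q = (c + (𝒢.wiring P).routeShift i (padZero k h)) q) ↔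
        ∀ q, 𝒢.Measured P q ∨ c₀ q = c q := by
      refine forall_congr' fun q => or_congr_right' fun hq => ?_
      rw [Pi.add_apply, 𝒢.routeShift_of_not_measured hW i h hq, add_zero]
    rw [hproj, ← Finset.mul_prod_erase _ _ (Finset.mem_univ i)]
    simp only [hδ, hB, hM]
    rw [Finset.prod_congr rfl fun i' hi' => Finset.prod_congr rfl fun j _ =>
      hne h i' (Finset.ne_of_mem_erase hi') j]
    simp only [mul_assoc, Finset.prod_mul_distrib]
    ring

/-- Every outcome of the ideal circuit of nonzero probability wins every instance of the rotated
game. -/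
theorem wins_of_idealProb_ne_zero [NeZero N] (hW : (𝒢.wiring P).RoutesDisjoint) (x : 𝒢.Queries)
    (o : 𝒢.IdealOutcome P) (ho : 𝒢.idealProb P x o ≠ 0) (i : Fin r)
    (hx : x i ∈ 𝒢.game.dist.support) :
    𝒢.game.Wins (x i) fun j s =>
      (o i j).2 s - cor (𝒢.routeRotation o i j) (x i j s : PauliLabel d (Fin (k j))) := by
  by_contra hlose
  refine ho (Finset.sum_eq_zero fun c₀ _ => ?_)
  -- The amplitude at `c₀` is a sum over `c`; it is enough to sum over the translates of each `c`
  -- along the routes of star `i`.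
  rw [sum_eq_zero_of_sum_translates (fun c => 𝒢.idealProj P x o c₀ c * 𝒢.idealState P c)
    fun h : ∀ j, Fin (k j) → ZMod d => (𝒢.wiring P).routeShift i (padZero k h)]
  · simp
  intro c
  obtain ⟨K₁, hK₁, h1⟩ := 𝒢.idealProj_add_routeShift hW x o i c₀ c
  obtain ⟨K₂, hK₂, h2⟩ := 𝒢.idealState_add_routeShift hW i c
  simp only [h1, h2]
  by_cases hK : K₁ = 0 ∨ K₂ = 0
  · rcases hK with rfl | rfl <;> simp
  push Not at hK
  -- With `K₁` and `K₂` nonzero, the arguments of the honest projections and of `ψ` differ exactly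
  -- by the `X`-part of the rotation.
  have h3 := fun j => 𝒢.route_teleport hW o (hK₂ hK.2) i j (hK₁ hK.1 j)
  simp only [h3]
  have h4 := 𝒢.honest.sum_proj_translate_eq_zero 𝒢.perfect hx (fun j => (o i j).2)
    (𝒢.routeRotation o i) hlose
    (fun j s => c₀ (P.loc i j, (𝒢.wiring P).inDir i j (Fin.last _),
      Fin.castLE (le_maxQudits k j) s))
    (fun j s => c (((𝒢.wiring P).route i j).pt 0, (𝒢.wiring P).share i j,
      Fin.castLE (le_maxQudits k j) s))
  rw [← mul_zero (K₁ * K₂), ← h4, Finset.mul_sum]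
  refine Finset.sum_congr rfl fun h _ => ?_
  ring

end CircuitGame

/-! ### Geometry of stars and the partition among the players -/

namespace GridStar

variable {N ℓ : ℕ} (Γ : GridStar N ℓ)

theorem pt_zero_mem_centralBox (j : Fin ℓ) : (Γ.path j).pt 0 ∈ Γ.centralBox := (Γ.path_start j).1

theorem pt_last_mem_leafBox (j : Fin ℓ) : (Γ.path j).pt (Fin.last _) ∈ Γ.leafBox j :=
  (Γ.path_end j).1

theorem not_mem_leafBox_of_mem_leafBox {j j' : Fin ℓ} (h : j ≠ j') {v : Grid N}
    (hv : v ∈ Γ.leafBox j) : v ∉ Γ.leafBox j' :=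
  Set.disjoint_left.mp (Γ.leaf_disjoint j j' h) hv

theorem not_mem_leafBox_of_mem_path {j j' : Fin ℓ} (h : j ≠ j') {v : Grid N}
    (hv : v ∈ (Γ.path j).verts) : v ∉ Γ.leafBox j' := by
  obtain ⟨t, rfl⟩ := hv
  by_cases h0 : t = 0
  · subst h0
    exact Set.disjoint_left.mp (Γ.center_disjoint j') (Γ.pt_zero_mem_centralBox j)
  by_cases h1 : t = Fin.last _
  · subst h1
    exact Γ.not_mem_leafBox_of_mem_leafBox h (Γ.pt_last_mem_leafBox j)
  · exact (Γ.path_inner j t h0 h1).2 j'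

end GridStar

namespace Wiring

variable {N r ℓ : ℕ} {P : InputPattern N r ℓ} (W : Wiring P)

theorem route_cases (i : Fin r) (j : Fin ℓ) (t : Fin ((W.route i j).len + 1)) :
    (W.route i j).pt t ∈ (P.star i).centralBox ∨ (W.route i j).pt t ∈ ((P.star i).path j).verts ∨
      (W.route i j).pt t ∈ (P.star i).leafBox j := by
  obtain ⟨B, E, h, hB, hE⟩ := W.route_extends i j
  have h1 : (W.route i j).pt t ∈ List.ofFn (W.route i j).pt := (List.mem_ofFn' _ _).mpr ⟨t, rfl⟩
  rw [h, List.mem_append, List.mem_append, List.mem_ofFn'] at h1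
  rcases h1 with (h1 | h1) | h1
  exacts [.inl (hB _ h1), .inr (.inl h1), .inr (.inr (hE _ h1))]

theorem route_mem_verts (i : Fin r) (j : Fin ℓ) (t : Fin ((W.route i j).len + 1)) :
    (W.route i j).pt t ∈ (P.star i).verts := by
  rcases W.route_cases i j t with h | h | h
  · exact .inl (.inl h)
  · exact .inr (Set.mem_iUnion.mpr ⟨j, h⟩)
  · exact .inl (.inr (Set.mem_iUnion.mpr ⟨j, h⟩))

theorem route_not_mem_leafBox {i : Fin r} {j j' : Fin ℓ} (hj : j ≠ j')
    (t : Fin ((W.route i j).len + 1)) : (W.route i j).pt t ∉ (P.star i).leafBox j' := by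
  rcases W.route_cases i j t with h | h | h
  · exact Set.disjoint_left.mp ((P.star i).center_disjoint j') h
  · exact (P.star i).not_mem_leafBox_of_mem_path hj h
  · exact (P.star i).not_mem_leafBox_of_mem_leafBox hj h

/-- Within a star this is part of the wiring; routes of different stars stay inside disjoint stars.
-/
theorem routesDisjoint
    (hP : ∀ i i', i ≠ i' → Disjoint (P.star i).verts (P.star i').verts) : W.RoutesDisjoint := by
  intro i j i' j' t t' h
  have hi : i = i' := by
    by_contra hne
    refine Set.disjoint_left.mp (hP i i' hne) (W.route_mem_verts i j t) ?_
    rw [h]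
    exact W.route_mem_verts i' j' t'
  subst hi
  refine ⟨rfl, ?_⟩
  by_contra hne
  exact Set.disjoint_left.mp (W.route_disjoint i j j' hne) ⟨t, rfl⟩ ⟨t', h.symm⟩

/-- A vertex of a star belongs to player `j` if it lies on the `j`-th route or in the `j`-th
noncentral box; the remaining ones belong to player `j₀`. -/
def Owns (j₀ : Fin ℓ) (i : Fin r) (j : Fin ℓ) (v : Grid N) : Prop :=
  v ∈ (P.star i).verts ∧ (v ∈ (P.star i).leafBox j ∨ v ∈ (W.route i j).verts ∨
    j = j₀ ∧ ∀ j', v ∉ (P.star i).leafBox j' ∧ v ∉ (W.route i j').verts)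

variable {W}

/-- Routes avoid the noncentral boxes of other players and leftover vertices lie in no such box, so
the choice of `j₀` cannot spoil causality. -/
theorem Owns.eq_of_mem_leafBox {j₀ : Fin ℓ} {i : Fin r} {j j' : Fin ℓ} {v : Grid N}
    (h : W.Owns j₀ i j v) (h' : v ∈ (P.star i).leafBox j') : j = j' := by
  by_contra hne
  obtain ⟨_, h | ⟨t, rfl⟩ | h⟩ := h
  · exact (P.star i).not_mem_leafBox_of_mem_leafBox hne h h'
  · exact W.route_not_mem_leafBox hne t h'
  · exact (h.2 j').1 h'

theorem Owns.eq {j₀ : Fin ℓ} {i : Fin r} {j j' : Fin ℓ} {v : Grid N}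
    (h : W.Owns j₀ i j v) (h' : W.Owns j₀ i j' v) : j = j' := by
  by_contra hne
  have h1 := h
  have h1' := h'
  obtain ⟨_, h | h | h⟩ := h
  · exact hne (h1'.eq_of_mem_leafBox h).symm
  · obtain ⟨_, h' | h' | h'⟩ := h'
    · exact hne (h1.eq_of_mem_leafBox h')
    · exact Set.disjoint_left.mp (W.route_disjoint i j j' hne) h h'
    · exact (h'.2 j).2 h
  · obtain ⟨_, h' | h' | h'⟩ := h'
    · exact hne (h1.eq_of_mem_leafBox h')
    · exact (h.2 j').2 h'
    · exact hne (h.1.trans h'.1.symm)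

variable (W)

open Classical in
/-- The partition of the stars according to `Owns`. -/
noncomputable def ownedRegions [NeZero N] (j₀ : Fin ℓ) : CircuitGame.Regions W where
  region i j := Finset.univ.filter fun v => W.Owns j₀ i j v
  disjoint i j j' hj := by
    rw [Finset.disjoint_left]
    intro v h h'
    exact hj ((Finset.mem_filter.mp h).2.eq (Finset.mem_filter.mp h').2)
  cover i v := by
    simp only [Finset.mem_filter, Finset.mem_univ, true_and]
    refine ⟨fun h => ?_, fun ⟨j, h⟩ => h.1⟩
    by_cases h1 : ∃ j, v ∈ (P.star i).leafBox j ∨ v ∈ (W.route i j).verts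
    · obtain ⟨j, h1⟩ := h1
      exact ⟨j, h, h1.imp_right .inl⟩
    · push Not at h1
      exact ⟨j₀, h, .inr (.inr ⟨rfl, h1⟩)⟩
  route_mem i j t := by
    simp only [Finset.mem_filter, Finset.mem_univ, true_and]
    exact ⟨W.route_mem_verts i j t, .inr (.inl ⟨t, rfl⟩)⟩

theorem mem_ownedRegions [NeZero N] {j₀ : Fin ℓ} {i : Fin r} {j : Fin ℓ} {v : Grid N} :
    v ∈ (W.ownedRegions j₀).region i j ↔ W.Owns j₀ i j v := by
  classical
  simp [ownedRegions]

end Wiring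

theorem PatternSampler.disjoint_verts {N r ℓ L : ℕ} (D : PatternSampler N r ℓ L)
    {P : InputPattern N r ℓ} (hP : P ∈ D.dist.support) (i i' : Fin r) (hi : i ≠ i') :
    Disjoint (P.star i).verts (P.star i').verts := by
  rw [PatternSampler.dist, PMF.support_map] at hP
  obtain ⟨ω, -, rfl⟩ := hP
  exact (D.square_disjoint i i' hi).mono (D.stars_subset i _ _) (D.stars_subset i' _ _)

/-- The light cone of another valid pair misses the star. That of the same pair meets it only in the
box of its own location, and this box has a single owner. -/
theorem CircuitSpec.Causal.eq_of_mem_lightcone {N r ℓ : ℕ} {P : InputPattern N r ℓ}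
    {spec : CircuitSpec N} {V : Set (Fin r)} (h : spec.Causal P V) {W : Wiring P} {j₀ : Fin ℓ}
    {i i' : Fin r} (hi : i ∈ V) (hi' : i' ∈ V) {j j' : Fin ℓ} {v : Grid N}
    (hv : W.Owns j₀ i j v) (hl : v ∈ spec.lightcone (P.loc i' j')) : i' = i ∧ j' = j := by
  obtain ⟨⟨h1, h2, -⟩, -⟩ := h i hi
  have : i' = i := by
    by_contra hne
    have h3 : v ∈ (∅ : Set (Grid N)) := h2 i' hi' hne j' ▸ ⟨hl, hv.1⟩
    exact h3
  subst this
  exact ⟨rfl, (hv.eq_of_mem_leafBox (h1 j' ⟨hl, hv.1⟩)).symm⟩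

/-! ### Product distributions and fixing the queries of the invalid pairs -/

theorem pmfPi_apply {r : ℕ} {X : Fin r → Type} [∀ i, Fintype (X i)] (π : ∀ i, PMF (X i))
    (x : ∀ i, X i) : pmfPi π x = ∏ i, π i (x i) := rfl

theorem mem_support_pmfPi {r : ℕ} {X : Fin r → Type} [∀ i, Fintype (X i)] {π : ∀ i, PMF (X i)}
    {x : ∀ i, X i} : x ∈ (pmfPi π).support ↔ ∀ i, x i ∈ (π i).support := by
  simp [PMF.mem_support_iff, pmfPi_apply, Finset.prod_eq_zero_iff]

theorem pmfPi_map {r : ℕ} {X Y : Fin r → Type} [∀ i, Fintype (X i)] [∀ i, Fintype (Y i)]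
    (π : ∀ i, PMF (X i)) (f : ∀ i, X i → Y i) :
    pmfPi (fun i => (π i).map (f i)) = (pmfPi π).map fun x i => f i (x i) := by
  classical
  ext y
  simp only [pmfPi_apply, PMF.map_apply, tsum_fintype]
  rw [Finset.prod_univ_sum, Fintype.piFinset_univ]
  refine Finset.sum_congr rfl fun x _ => ?_
  by_cases h : y = fun i => f i (x i)
  · subst h
    simp
  · rw [if_neg h]
    obtain ⟨i, hi⟩ := Function.ne_iff.mp h
    exact Finset.prod_eq_zero (Finset.mem_univ i) (if_neg hi)

theorem PMF.sum_toReal_map {X Y : Type} [Fintype X] [Fintype Y] (μ : PMF X) (f : X → Y)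
    (F : Y → ℝ) : ∑ y, (μ.map f y).toReal * F y = ∑ x, (μ x).toReal * F (f x) := by
  classical
  have h : ∀ y, (μ.map f y).toReal = ∑ x, if y = f x then (μ x).toReal else 0 := by
    intro y
    rw [PMF.map_apply, tsum_fintype, ENNReal.toReal_sum]
    · refine Finset.sum_congr rfl fun x _ => ?_
      split_ifs <;> simp
    · intro x _
      split_ifs
      exacts [μ.apply_ne_top x, ENNReal.zero_ne_top]
  simp only [h, Finset.sum_mul]
  rw [Finset.sum_comm]
  simp [ite_mul]

theorem PMF.sum_toReal {X : Type} [Fintype X] (μ : PMF X) : ∑ x, (μ x).toReal = 1 := by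
  rw [← ENNReal.toReal_sum fun x _ => μ.apply_ne_top x, ← tsum_fintype (L := .unconditional _),
    μ.tsum_coe, ENNReal.toReal_one]

/-- Replace the coordinates outside of `V`. -/
def replaceOutside {r : ℕ} {X : Type} (V : Finset (Fin r)) (x z : Fin r → X) : Fin r → X :=
  fun i => if i ∈ V then x i else z i

/-- The coordinates outside of `V` of independent samples can be fixed without decreasing an
expectation. -/
theorem exists_replaceOutside_ge {r : ℕ} {X : Type} [Fintype X] (π : PMF X)
    (V : Finset (Fin r)) (w : (Fin r → X) → ℝ) :
    ∃ z : Fin r → X, (∀ i, z i ∈ π.support) ∧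
      ∑ x, (pmfPi (fun _ => π) x).toReal * w x ≤
        ∑ x, (pmfPi (fun _ => π) x).toReal * w (replaceOutside V x z) := by
  classical
  set q : (Fin r → X) → ℝ := fun x => (pmfPi (fun _ => π) x).toReal with hq
  have hq1 : ∑ x, q x = 1 := PMF.sum_toReal _
  have hq0 : ∀ x, 0 ≤ q x := fun x => ENNReal.toReal_nonneg
  have hqprod : ∀ x, q x = ∏ i, (π (x i)).toReal := fun x => by
    rw [hq]
    simp only [pmfPi_apply, ENNReal.toReal_prod]
  -- For two independent samples, exchanging the coordinates outside of `V` preserves the product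
  -- weight. Hence the hybrid of both samples is distributed like one sample, which is `hmain`.
  let σ : (Fin r → X) × (Fin r → X) → (Fin r → X) × (Fin r → X) :=
    fun a => (replaceOutside V a.1 a.2, replaceOutside V a.2 a.1)
  have hσ : Function.Involutive σ := by
    intro a
    refine Prod.ext (funext fun i => ?_) (funext fun i => ?_) <;>
    · simp only [σ, replaceOutside]
      split_ifs <;> rfl
  have hqσ : ∀ a, q (σ a).1 * q (σ a).2 = q a.1 * q a.2 := by
    intro a
    simp only [hqprod, ← Finset.prod_mul_distrib]
    refine Finset.prod_congr rfl fun i _ => ?_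
    simp only [σ, replaceOutside]
    split_ifs
    · rfl
    · exact mul_comm _ _
  have hmain : ∑ z, q z * ∑ x, q x * w (replaceOutside V x z) = ∑ x, q x * w x := by
    have h1 : ∑ z, q z * ∑ x, q x * w (replaceOutside V x z) =
        ∑ a : (Fin r → X) × (Fin r → X), q (σ a).1 * q (σ a).2 * w (σ a).1 := by
      rw [Fintype.sum_prod_type_right]
      refine Finset.sum_congr rfl fun z _ => ?_
      rw [Finset.mul_sum]
      refine Finset.sum_congr rfl fun x _ => ?_
      rw [hqσ]
      simp only [σ]
      ring
    refine h1.trans ((Equiv.sum_comp hσ.toPerm fun a => q a.1 * q a.2 * w a.1).trans ?_)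
    rw [Fintype.sum_prod_type]
    refine Finset.sum_congr rfl fun x _ => ?_
    change ∑ y, q x * q y * w x = _
    rw [← Finset.sum_mul, ← Finset.mul_sum, hq1, mul_one]
  -- If every admissible `z` were strictly worse than the average, so would be the average over `z`;
  -- the point `z₀` of positive weight makes the inequality strict.
  by_contra! hlt
  have hsupp : ∀ z, q z ≠ 0 → ∀ i, z i ∈ π.support := by
    intro z hz
    have : z ∈ (pmfPi fun _ : Fin r => π).support := by
      rw [PMF.mem_support_iff]
      intro h0
      exact hz (by rw [hq]; simp only [h0, ENNReal.toReal_zero])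
    exact mem_support_pmfPi.mp this
  obtain ⟨z₀, hz₀⟩ : ∃ z, q z ≠ 0 := by
    by_contra! h0
    simp [h0] at hq1
  refine hmain.not_lt ?_
  calc ∑ z, q z * ∑ x, q x * w (replaceOutside V x z)
      < ∑ z, q z * ∑ x, q x * w x := by
        refine Finset.sum_lt_sum (fun z _ => ?_) ⟨z₀, Finset.mem_univ _, ?_⟩
        · by_cases hz : q z = 0
          · simp [hz]
          · exact mul_le_mul_of_nonneg_left (hlt z (hsupp z hz)).le (hq0 z)
        · exact mul_lt_mul_of_pos_left (hlt z₀ (hsupp z₀ hz₀)) ((hq0 z₀).lt_of_ne' hz₀)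
    _ = ∑ x, q x * w x := by rw [← Finset.sum_mul, hq1, one_mul]

theorem Finset.sum_filter_sum_filter_eq {α β M : Type} [Fintype α] [Fintype β] [DecidableEq β]
    [AddCommMonoid M] (g : α → β) (p : β → Prop) [DecidablePred p] (F : α → M) :
    ∑ b with p b, ∑ a with g a = b, F a = ∑ a with p (g a), F a := by
  rw [Finset.sum_filter, Finset.sum_filter, ← Finset.sum_fiberwise _ g]
  refine Finset.sum_congr rfl fun b _ => ?_
  split_ifs with hb
  · refine Finset.sum_congr rfl fun a ha => ?_
    rw [(Finset.mem_filter.mp ha).2, if_pos hb]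
  · refine (Finset.sum_eq_zero fun a ha => ?_).symm
    rw [(Finset.mem_filter.mp ha).2, if_neg hb]

/-! ### Decoding into the rotated stretched game -/

theorem cor_extendLabel_right {d : ℕ} {κ κ' : Type} [Fintype κ] [Fintype κ'] (e : κ ↪ κ')
    (r : PauliLabel d κ') (q : PauliLabel d κ) : cor r (extendLabel e q) = cor (r ∘ e) q := by
  classical
  unfold cor
  rw [← Finset.sum_subset (Finset.subset_univ (Finset.univ.map e)), Finset.sum_map]
  · simp only [extendLabel_apply, Function.comp_apply]
  · intro i _ hi
    have : ¬ ∃ a, e a = i := by simpa using hi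
    simp [extendLabel_apply_of_not e _ i this]

namespace StabilizerGame

variable {ℓ d : ℕ} [NeZero d] {κ κ' : Fin ℓ → Type} [∀ j, Fintype (κ j)] [∀ j, DecidableEq (κ j)]
  {m : Fin ℓ → ℕ}

theorem unstretchQuery_stretchQuery (G : StabilizerGame ℓ d κ m) (e : ∀ j, κ j ↪ κ' j)
    (x : G.Query) : G.unstretchQuery e (G.stretchQuery e x) = x := by
  funext j s
  exact Subtype.ext (extendLabel_comp _ _)

theorem unstretchQuery_congr (G : StabilizerGame ℓ d κ m) (e : ∀ j, κ j ↪ κ' j)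
    {x x' : ∀ j, Fin (m j) →
      ((G.labels j).map (extendLabel (e j)) : Finset (PauliLabel d (κ' j)))} {j : Fin ℓ}
    (h : x j = x' j) : G.unstretchQuery e x j = G.unstretchQuery e x' j := by
  funext s
  refine Subtype.ext ?_
  change (x j s : PauliLabel d (κ' j)) ∘ e j = (x' j s : PauliLabel d (κ' j)) ∘ e j
  rw [h]

variable [∀ j, Fintype (κ' j)] [∀ j, DecidableEq (κ' j)]

/-- Stretched questions are trivial off the designated qudits, so the rotation string counts only
through its restriction to them; the teleportation outcomes recorded at other vertices do not affect
the correction. -/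
theorem rotated_stretch_wins_iff (G : StabilizerGame ℓ d κ m) (e : ∀ j, κ j ↪ κ' j)
    (x : G.Query) (a : ∀ j, RotatedAnswer d κ' m j) :
    (G.stretch e).rotated.wins (G.stretchQuery e x) a ↔
      G.Wins x fun j s => (a j).1 s - cor ((a j).2 ∘ e j) (x j s : PauliLabel d (κ j)) := by
  simp only [rotated, Wins, stretch, unstretchQuery_stretchQuery, stretchQuery,
    cor_extendLabel_right]

end StabilizerGame

namespace CircuitGame

variable {ℓ d : ℕ} [NeZero d] {k m : Fin ℓ → ℕ} {N r L : ℕ} {A : Type}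
  (𝒢 : CircuitGame ℓ d k m N r L A) {P : InputPattern N r ℓ}

/-- The input symbol at a vertex depends on the questions whose input location is this vertex. -/
theorem encode_congr {x x' : 𝒢.Queries} {v : Grid N}
    (h : ∀ i j, P.loc i j = v → x i j = x' i j) : 𝒢.encode P x v = 𝒢.encode P x' v := by
  unfold encode inputSymbol
  congr 1
  dsimp only
  split_ifs with h1 h2 h3
  · rfl
  · rfl
  -- In this branch the index is not below the length of the route, so the vertex is the last one,
  -- which is the input location.
  · congr 1
    refine h _ _ ?_
    conv_rhs => rw [← h1.choose_spec]
    rw [← (𝒢.wiring P).route_end]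
    congr 1
    refine Fin.ext ?_
    have := h1.choose.2.2.is_lt
    simp only [Fin.val_last]
    omega
  · rfl

/-- The decoded answer of a player depends on the output symbols in the player's region. -/
theorem decode_congr (Γ : Regions (𝒢.wiring P)) (p : Fin r × Fin ℓ) {y y' : Grid N → A}
    (h : ∀ v ∈ Γ.region p.1 p.2, y v = y' v) : 𝒢.decode Γ y p = 𝒢.decode Γ y' p := by
  unfold decode
  refine Prod.ext ?_ (funext fun q => ?_)
  · simp only [h _ (Γ.loc_mem p.1 p.2)]
  · simp only [h _ (Γ.route_mem p.1 p.2 _), h _ q.1.2]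

/-- The questions of an instance as a query of the stabilizer game. -/
noncomputable def instanceQuery (Γ : Regions (𝒢.wiring P)) (X : ∀ p, 𝒢.PlayerQuestion Γ p)
    (i : Fin r) : 𝒢.game.Query :=
  𝒢.game.unstretchQuery (fun j => Γ.designated k i j) fun j => X (i, j)

theorem instanceQuery_playerQuestions (Γ : Regions (𝒢.wiring P)) (x : 𝒢.Queries) :
    𝒢.instanceQuery Γ (𝒢.playerQuestions Γ x) = x := by
  funext i
  exact 𝒢.game.unstretchQuery_stretchQuery _ _

theorem instanceQuery_congr (Γ : Regions (𝒢.wiring P)) {X X' : ∀ p, 𝒢.PlayerQuestion Γ p}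
    {i : Fin r} {j : Fin ℓ} (h : X (i, j) = X' (i, j)) :
    𝒢.instanceQuery Γ X i j = 𝒢.instanceQuery Γ X' i j :=
  𝒢.game.unstretchQuery_congr _ h

theorem repeated_dist (Γ : Regions (𝒢.wiring P)) :
    (NonlocalGame.repeated (𝒢.instanceGame Γ)).dist =
      (pmfPi fun _ : Fin r => 𝒢.game.dist).map (𝒢.playerQuestions Γ) := by
  exact (congrArg (PMF.map _) (pmfPi_map (fun _ => 𝒢.game.dist) fun i =>
    𝒢.game.stretchQuery fun j => Γ.designated k i j)).trans (PMF.map_comp _ _ _)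

/-- The entry decoded at the input location is the total correction along the route, which is the
rotation for which the ideal outcome was shown to win. -/
theorem decode_rotation_designated (Γ : Regions (𝒢.wiring P)) (o : 𝒢.IdealOutcome P) (i : Fin r)
    (j : Fin ℓ) (y : Grid N → A)
    (hy : ∀ t, y (((𝒢.wiring P).route i j).pt t.castSucc) = 𝒢.encTel ((o i j).1 t)) :
    (𝒢.decode Γ y (i, j)).2 ∘ Γ.designated k i j = 𝒢.routeRotation o i j := by
  funext s
  have h1 : ∀ t, 𝒢.decTel (y (((𝒢.wiring P).route i j).pt t.castSucc)) = (o i j).1 t := by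
    intro t
    rw [hy]
    exact Function.leftInverse_invFun 𝒢.encTel.injective _
  change (if P.loc i j = P.loc i j then _ else _) = _
  rw [if_pos rfl]
  simp only [h1]
  rfl

/-- Outputs of the circuit that win the circuit game win the rotated stretched games. -/
theorem instance_wins_of_relation [NeZero N] (hW : (𝒢.wiring P).RoutesDisjoint)
    (Γ : Regions (𝒢.wiring P)) {x x' : 𝒢.Queries} {y : Grid N → A}
    (h : ((P, x), y) ∈ 𝒢.relation) {i : Fin r} (hx : x i ∈ 𝒢.game.dist.support)
    (hx' : x' i = x i) :
    (𝒢.instanceGame Γ i).wins (fun j => 𝒢.playerQuestions Γ x' (i, j))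
      fun j => 𝒢.decode Γ y (i, j) := by
  obtain ⟨-, o, ho, hy⟩ := h
  refine (𝒢.game.rotated_stretch_wins_iff _ (x' i) _).mpr ?_
  rw [hx']
  have h1 := 𝒢.wins_of_idealProb_ne_zero hW x o ho i hx
  refine (congrArg (𝒢.game.Wins (x i)) (funext fun j => funext fun s => ?_)).mpr h1
  congr 1
  · change Function.invFun (𝒢.encAns j) (y (P.loc i j)) s = _
    rw [show y (P.loc i j) = 𝒢.encAns j (o i j).2 from (hy i j).2]
    exact congrFun (Function.leftInverse_invFun (𝒢.encAns j).injective _) s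
  · rw [← 𝒢.decode_rotation_designated Γ o i j y (hy i j).1]

theorem dist_apply (P : InputPattern N r ℓ) (x : 𝒢.Queries) :
    𝒢.dist (P, x) = 𝒢.sampler.dist P * pmfPi (fun _ : Fin r => 𝒢.game.dist) x := by
  classical
  unfold dist
  rw [PMF.bind_apply, tsum_eq_single P]
  · congr 1
    rw [PMF.map_apply, tsum_eq_single x]
    · rw [if_pos rfl]
    · intro x' hx'
      rw [if_neg]
      intro h
      exact hx' (Prod.ext_iff.mp h).2.symm
  · intro P' hP'
    rw [PMF.map_apply]
    refine mul_eq_zero_of_right _ (ENNReal.tsum_eq_zero.mpr fun x' => if_neg fun h => ?_)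
    exact hP' (Prod.ext_iff.mp h).1.symm

/-- Pattern and queries are independent, so the nonzero weight of `P` cancels. -/
theorem condWinProb_eq [NeZero N] [Fintype A] [DecidableEq A] (C : Circuit N A)
    (hP : P ∈ 𝒢.sampler.dist.support) :
    𝒢.condWinProb C P =
      ∑ x, (pmfPi (fun _ : Fin r => 𝒢.game.dist) x).toReal * 𝒢.winProbOn C (P, x) := by
  unfold condWinProb
  have h0 : (𝒢.sampler.dist P).toReal ≠ 0 :=
    ENNReal.toReal_ne_zero.mpr ⟨(PMF.mem_support_iff _ _).mp hP, PMF.apply_ne_top _ _⟩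
  simp only [dist_apply, ENNReal.toReal_mul, ← Finset.mul_sum, mul_assoc, PMF.sum_toReal, mul_one]
  rw [mul_div_cancel_left₀ _ h0]

end CircuitGame

/-! ### The simulating strategy -/

open Classical in
theorem mainTheorem3 {ℓ d N r L K D : ℕ} [NeZero d] [NeZero N] {k m : Fin ℓ → ℕ}
    {A : Type} [Fintype A] [DecidableEq A]
    (hr : 1 ≤ r) (hrN : r ≤ N)
    (𝒢 : CircuitGame ℓ d k m N r L A)
    (C : Circuit N A) (hfan : C.FanInLE K) (hdepth : C.depth = D)
    (P : InputPattern N r ℓ) (hP : P ∈ 𝒢.sampler.dist.support)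
    (p : ℝ) (hp : 𝒢.condWinProb C P = p)
    (badIn : Set (Grid N)) (spec : CircuitSpec N)
    (hspec : spec = ⟨C.forwardLightcone, badIn, ∅⟩)
    (V : Finset (Fin r)) (hV : V = Finset.univ.filter fun i => spec.Valid P i)
    (hcausal : spec.Causal P V)
    (δ : ℝ) (hδ0 : 0 ≤ δ) (hδ1 : δ ≤ 1) (hfrac : (1 - δ) * r ≤ V.card) :
    ∃ Γ : CircuitGame.Regions (𝒢.wiring P),
      (∀ i ∈ V, ∀ j, ∀ v ∈ Γ.region i j, ∀ i' ∈ V, ∀ j',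
        P.loc i' j' ∈ C.backwardLightcone (.output v) → i' = i ∧ j' = j) ∧
      ∃ (S : Strategy (𝒢.PlayerQuestion Γ) (𝒢.PlayerAnswer Γ)) (xbar : 𝒢.Queries),
        (∀ i, xbar i ∈ 𝒢.game.dist.support) ∧
        p ≤ S.probWinsAtLeast (𝒢.instanceGame Γ) ((1 - δ) * r) ∧
        ∀ (x : 𝒢.Queries) (α : ∀ q, 𝒢.PlayerAnswer Γ q),
          (∑ a with ∀ i ∈ V, ∀ j, a (i, j) = α (i, j), S.prob (𝒢.playerQuestions Γ x) a) =
            ∑ y : Grid N → A with ∀ i ∈ V, ∀ j, 𝒢.decode Γ y (i, j) = α (i, j),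
              C.outProb (𝒢.encode P fun i => if i ∈ V then x i else xbar i) y := by
  have hdisj := fun i i' => 𝒢.sampler.disjoint_verts hP i i'
  have hW : (𝒢.wiring P).RoutesDisjoint := (𝒢.wiring P).routesDisjoint hdisj
  subst hspec
  let Γ := (𝒢.wiring P).ownedRegions ⟨0, 𝒢.sampler.ell_pos⟩
  have hΓ : ∀ i ∈ V, ∀ j, ∀ v ∈ Γ.region i j, ∀ i' ∈ V, ∀ j',
      P.loc i' j' ∈ C.backwardLightcone (.output v) → i' = i ∧ j' = j :=
    fun i hi j v hv i' hi' j' h =>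
      hcausal.eq_of_mem_lightcone hi hi' ((𝒢.wiring P).mem_ownedRegions.mp hv) h
  obtain ⟨xbar, hxbar, hge⟩ := exists_replaceOutside_ge 𝒢.game.dist V
    fun x => 𝒢.winProbOn C (P, x)
  rw [← 𝒢.condWinProb_eq C hP, hp] at hge
  have : Nonempty A := ⟨𝒢.encIn .idle⟩
  obtain ⟨S, hS⟩ := C.exists_strategy (Q := 𝒢.PlayerQuestion Γ) (Ans := 𝒢.PlayerAnswer Γ)
    (fun X => 𝒢.encode P (replaceOutside V (𝒢.instanceQuery Γ X) xbar))
    -- Only players of valid pairs label input vertices, since the input at the other locations is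
    -- fixed by `xbar`.
    (fun u => {q | q.1 ∈ V ∧ P.loc q.1 q.2 = u})
    (by
      intro u X X' h
      refine 𝒢.encode_congr fun i j hu => ?_
      by_cases hi : i ∈ V
      · simp only [replaceOutside, if_pos hi]
        exact 𝒢.instanceQuery_congr Γ (h (i, j) ⟨hi, hu⟩)
      · simp only [replaceOutside, if_neg hi])
    (𝒢.playerQuestions Γ xbar)
    (fun q => {v | q.1 ∈ V ∧ v ∈ Γ.region q.1 q.2})
    -- Players of invalid pairs answer `0` without looking at any output, so nothing is required of
    -- the light cones in their stars.
    (fun q y => if q.1 ∈ V then 𝒢.decode Γ y q else 0)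
    (by
      intro q y y' h
      by_cases hq : q.1 ∈ V
      · simp only [if_pos hq]
        exact 𝒢.decode_congr Γ q fun v hv => h v ⟨hq, hv⟩
      · simp only [if_neg hq])
    (by
      rintro q v ⟨hq, hv⟩ u hu q' ⟨hq', rfl⟩
      exact Prod.ext_iff.mpr (hΓ q.1 hq q.2 v hv q'.1 hq' q'.2 hu))
  -- The exact identity of output distributions for an arbitrary event; both the bound on winning
  -- and the reproduction of the valid answers are instances.
  have hsum : ∀ (x : 𝒢.Queries) (E : (∀ q, 𝒢.PlayerAnswer Γ q) → Prop),
      (∑ a with E a, S.prob (𝒢.playerQuestions Γ x) a) =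
        ∑ y : Grid N → A with E fun q => if q.1 ∈ V then 𝒢.decode Γ y q else 0,
          C.outProb (𝒢.encode P (replaceOutside V x xbar)) y := by
    intro x E
    rw [← Finset.sum_filter_sum_filter_eq
      (fun (y : Grid N → A) (q : Fin r × Fin ℓ) => if q.1 ∈ V then 𝒢.decode Γ y q else 0) E]
    refine Finset.sum_congr rfl fun a _ => ?_
    rw [hS, 𝒢.instanceQuery_playerQuestions]
    refine Finset.sum_congr (Finset.ext fun y => ?_) fun _ _ => rfl
    simp only [Finset.mem_filter, Finset.mem_univ, true_and, funext_iff]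
  refine ⟨Γ, hΓ, S, xbar, hxbar, hge.trans ?_, fun x α => ?_⟩
  · unfold Strategy.probWinsAtLeast
    rw [𝒢.repeated_dist, PMF.sum_toReal_map]
    refine Finset.sum_le_sum fun x _ => mul_le_mul_of_nonneg_left ?_ ENNReal.toReal_nonneg
    rw [hsum]
    unfold CircuitGame.winProbOn
    -- Outputs that win the circuit game on the hybrid query form a subset of those whose decoding
    -- wins all instances in `V`; on `V` the hybrid query agrees with `x`.
    refine Finset.sum_le_sum_of_subset_of_nonneg (fun y hy => ?_)
      fun y _ _ => C.outProb_nonneg _ y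
    rw [Finset.mem_filter] at hy ⊢
    refine ⟨Finset.mem_univ y, hfrac.trans ?_⟩
    norm_cast
    refine Finset.card_le_card fun i hi => ?_
    rw [Finset.mem_filter]
    refine ⟨Finset.mem_univ i, ?_⟩
    simp only [if_pos hi]
    have hrel := hy.2
    refine 𝒢.instance_wins_of_relation hW Γ hrel ?_ (by simp only [replaceOutside, if_pos hi])
    have hsupp := hrel.1
    rw [PMF.mem_support_iff, 𝒢.dist_apply] at hsupp
    exact mem_support_pmfPi.mp ((PMF.mem_support_iff _ _).mpr (right_ne_zero_of_mul hsupp)) i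
  · refine Eq.trans (Finset.sum_congr (Finset.ext fun a => ?_) fun _ _ => rfl)
      ((hsum x fun a => ∀ i ∈ V, ∀ j, a (i, j) = α (i, j)).trans ?_)
    · simp only [Finset.mem_filter]
    refine Finset.sum_congr (Finset.ext fun y => ?_) fun _ _ => rfl
    simp only [Finset.mem_filter, Finset.mem_univ, true_and]
    refine forall₂_congr fun i hi => ?_
    simp only [if_pos hi]
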